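/- Let $B_\ell\subset\mathbb R^2$ be the open disc of radius $\ell>0$ centred at the origin and $S^1=\{x\in\mathbb R^2:|x|=1\}$. For an open set $\Omega\subset\mathbb R^2$ and $v\in C^1(\Omega;\mathbb R^2)$ let $$\mathcal A(v;\Omega)=\int_\Omega\sqrt{1+|\nabla v|^2+(\det\nabla v)^2}\,dx\in[0,+\infty],$$ where $|\cdot|$ is the Frobenius norm. For $u\in BV(\Omega;\mathbb R^2)$ let $|Du|(\Omega)$ be the total variation of $Du$ (with respect to the Frobenius norm), say that $v_k\to u$ strictly in $BV(\Omega;\mathbb R^2)$ if $v_k\to u$ in $L^1(\Omega;\mathbb R^2)$ and $|Dv_k|(\Omega)\to|Du|(\Omega)$, and set $$\overline{\mathcal A}_{BV}(u;\Omega)=\inf\Big\{\liminf_{k\to+\infty}\mathcal A(v_k;\Omega):\ (v_k)\subset C^1(\Omega;\mathbb R^2)\cap BV(\Omega;\mathbb R^2),\ v_k\to u\text{ strictly in }BV(\Omega;\mathbb R^2)\Big\}.$$ **Theorem.** Let $\ell>0$, let $\varphi:S^1\to S^1$ be Lipschitz, and let $w(x)=\varphi(x/|x|)$ for $x\in B_\ell\setminus\{0\}$.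 Then $w\in BV(B_\ell;\mathbb R^2)$, $w$ is differentiable almost everywhere in $B_\ell$, $\sqrt{1+|\nabla w|^2}$ is integrable on $B_\ell$, and $$\overline{\mathcal A}_{BV}(w;B_\ell)=\int_{B_\ell}\sqrt{1+|\nabla w|^2}\,dx+\pi|\deg\varphi|,$$ where $\deg\varphi=\frac1{2\pi}\int_{S^1}\big(\varphi_1\,\partial_s\varphi_2-\varphi_2\,\partial_s\varphi_1\big)\,ds$, with $s$ the counter-clockwise arc length on $S^1$. In particular, for the vortex map $u_V(x)=x/|x|$, $$\overline{\mathcal A}_{BV}(u_V;B_\ell)=\int_{B_\ell}\sqrt{1+|\nabla u_V|^2}\,dx+\pi.$$ -/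

import Mathlib

open MeasureTheory Filter Topology

noncomputable section

/-- The Euclidean plane `ℝ²`. -/
abbrev Plane : Type := EuclideanSpace ℝ (Fin 2)

/-- The unit circle `S¹ = {x ∈ ℝ² : |x| = 1}`. -/
abbrev UnitCircle : Type := Metric.sphere (0 : Plane) 1

/-- The partial derivative `∂ v_i / ∂ x_j` at `x`. -/
def partialDeriv (v : Plane → Plane) (i j : Fin 2) (x : Plane) : ℝ :=
  (fderiv ℝ v x (EuclideanSpace.single j 1)) i

/-- The squared Frobenius norm `|∇v(x)|² = |∇v₁(x)|² + |∇v₂(x)|²`. -/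
def gradNormSq (v : Plane → Plane) (x : Plane) : ℝ :=
  ∑ i, ∑ j, partialDeriv v i j x ^ 2

/-- The Jacobian determinant `det ∇v(x)`. -/
def jacobian (v : Plane → Plane) (x : Plane) : ℝ :=
  partialDeriv v 0 0 x * partialDeriv v 1 1 x - partialDeriv v 0 1 x * partialDeriv v 1 0 x

/-- The area `∫_Ω √(1 + |∇v₁|² + |∇v₂|² + (det ∇v)²) dx ∈ [0, ∞]` of the graph of a map `v` of
class `C¹` on the open set `Ω`. -/
def graphArea (v : Plane → Plane) (Ω : Set Plane) : ENNReal :=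
  ∫⁻ x in Ω, ENNReal.ofReal (√(1 + gradNormSq v x + jacobian v x ^ 2))

/-- The divergence of a vector field on the plane. -/
def divergence (ψ : Plane → Plane) (x : Plane) : ℝ :=
  ∑ j, partialDeriv ψ j j x

/-- Matrix-valued test fields of class `C¹_c(Ω; ℝ^{2×2})` with Frobenius norm at most `1`
everywhere; `ψ i` is the `i`-th row. -/
structure IsTestField (Ω : Set Plane) (ψ : Fin 2 → Plane → Plane) : Prop where
  contDiff : ∀ i, ContDiff ℝ 1 (ψ i)
  compactSupport : ∀ i, HasCompactSupport (ψ i)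
  support_subset : ∀ i, tsupport (ψ i) ⊆ Ω
  norm_le : ∀ x, ∑ i, ‖ψ i x‖ ^ 2 ≤ 1

/-- The total variation `|Du|(Ω) ∈ [0, ∞]` of an integrable map `u` on the open set `Ω`, that is
`sup ∑ᵢ ∫_Ω uᵢ div ψᵢ dx` over the test fields `ψ`. -/
def totalVariation (u : Plane → Plane) (Ω : Set Plane) : ENNReal :=
  ⨆ (ψ : Fin 2 → Plane → Plane) (_ : IsTestField Ω ψ),
    ENNReal.ofReal (∑ i, ∫ x in Ω, u x i * divergence (ψ i) x)

/-- `u ∈ BV(Ω; ℝ²)`. -/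
def MemBV (u : Plane → Plane) (Ω : Set Plane) : Prop :=
  IntegrableOn u Ω ∧ totalVariation u Ω < ⊤

/-- `v_k → u` strictly in `BV(Ω; ℝ²)`. -/
structure StrictTendsto (v : ℕ → Plane → Plane) (u : Plane → Plane) (Ω : Set Plane) : Prop where
  memBV_seq : ∀ k, MemBV (v k) Ω
  memBV_limit : MemBV u Ω
  tendsto_L1 : Tendsto (fun k => ∫⁻ x in Ω, ‖v k x - u x‖ₑ) atTop (𝓝 0)
  tendsto_variation :
    Tendsto (fun k => totalVariation (v k) Ω) atTop (𝓝 (totalVariation u Ω))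

/-- The relaxed area functional: the infimum of `liminf_k 𝒜(v_k; Ω)` over the sequences
`v_k ∈ C¹(Ω; ℝ²) ∩ BV(Ω; ℝ²)` with `v_k → u` strictly in `BV(Ω; ℝ²)`. -/
def relaxedAreaBV (u : Plane → Plane) (Ω : Set Plane) : ENNReal :=
  sInf {a | ∃ v : ℕ → Plane → Plane, (∀ k, ContDiffOn ℝ 1 (v k) Ω) ∧ StrictTendsto v u Ω ∧
    a = liminf (fun k => graphArea (v k) Ω) atTop}

/-- The vortex map `x ↦ x / |x|` (with value `0` at the origin, a null set). -/
def vortexMap (x : Plane) : Plane := ‖x‖⁻¹ • x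

theorem vortexMap_mem_sphere {x : Plane} (hx : x ≠ 0) :
    vortexMap x ∈ Metric.sphere (0 : Plane) 1 := by
  simp [vortexMap, norm_smul, hx]

/-- The map `w(x) = φ(x / |x|)` for `x ≠ 0` (with value `0` at the origin, a null set). -/
def vortexTypeMap (φ : UnitCircle → UnitCircle) (x : Plane) : Plane :=
  open Classical in
  if hx : x ≠ 0 then (φ ⟨vortexMap x, vortexMap_mem_sphere hx⟩ : Plane) else 0

/-- The point `(cos θ, sin θ)` of the unit circle. -/
def circlePoint (θ : ℝ) : UnitCircle :=
  ⟨!₂[Real.cos θ, Real.sin θ], by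
    simp [EuclideanSpace.norm_eq]⟩

/-- The degree `(1 / 2π) ∫_{S¹} (φ₁ ∂φ₂/∂s - φ₂ ∂φ₁/∂s) ds` of a Lipschitz map `φ : S¹ → S¹`,
written in the arc length parameter `θ ∈ [0, 2π]`. -/
def degree (φ : UnitCircle → UnitCircle) : ℝ :=
  1 / (2 * Real.pi) * ∫ θ in (0 : ℝ)..(2 * Real.pi),
    ((φ (circlePoint θ) : Plane) 0 * deriv (fun t => (φ (circlePoint t) : Plane) 1) θ
      - (φ (circlePoint θ) : Plane) 1 * deriv (fun t => (φ (circlePoint t) : Plane) 0) θ)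

end

/-! In polar coordinates `w` depends on the angle only, so every circle about the origin carries the
same closed curve, `profile φ`. The term `π |deg φ|` is the area, counted with multiplicity, that a
smooth approximation must sweep to fill this curve at the centre.

Lower bound. Let `v_k → w` strictly. The tangential part of the gradient, integrated over radii,
gives the lengths of the curves traced by `v_k` on circles. Length is lower semicontinuous, and the
total variations converge to that of `w`, which is the length of `profile φ` integrated over radii.
Hence on almost every circle the liminf of the lengths equals the limiting length. Along a
subsequence depending on the circle, lengths converge; together with almost everywhere convergence
this forces uniform convergence (`tendstoUniformlyOn_of_length_tendsto`) and convergence of the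
winding integrals (`tendsto_integral_cross_deriv`). By Stokes' formula
(`abs_winding_le_lintegral_jacobian`) half the winding integral on the circle of radius `r` is
bounded by the integral of `|det ∇v_k|` over the disc, so this disc costs at least `π |deg φ|` in
the limit. Outside it, lower semicontinuity of the length of graphs, circle by circle, gives the
area integral of `w` over the annulus. Adding the two and letting `r → 0` gives `lower_bound`.

Upper bound. Write `φ = exp(iΦ)` with `Φ` Lipschitz and `Φ(θ + 2π) = Φ(θ) + 2πd`, where `d = deg φ`
is an integer. The recovery maps, at scale `1 / m`, raise the modulus from `0` to `1` with phase
exactly `d θ`, which costs Jacobian mass at most `π |d|`; then, with modulus `1` and hence zero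
Jacobian, they turn the phase into a `C¹` average of `Φ`. Their gradients are bounded by `C / |x|`,
integrable in the plane, so dominated convergence yields strict convergence and convergence of the
integrals of `√(1 + |∇v|²)`.

Both halves use that the total variation is the `L¹` norm of the weak gradient
(`IsWeakGradient.totalVariation_eq`). -/

open scoped Real ENNReal

noncomputable section

/-! ### Polar coordinates and null sets -/

/-- The isometry `ℝ² ≃ ℂ`. -/
def planeToComplex : Plane ≃ₗᵢ[ℝ] ℂ := Complex.orthonormalBasisOneI.repr.symm

theorem planeToComplex_apply (x : Plane) : planeToComplex x = x 0 + x 1 * Complex.I :=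
  Complex.orthonormalBasisOneI_repr_symm_apply x

/-- The point with polar coordinates `(r, θ)`. -/
def polarPoint (r θ : ℝ) : Plane := !₂[r * Real.cos θ, r * Real.sin θ]

/-- The radial unit vector at angle `θ`. -/
def radialVec (θ : ℝ) : Plane := !₂[Real.cos θ, Real.sin θ]

/-- The angular unit vector at angle `θ`. -/
def angularVec (θ : ℝ) : Plane := !₂[-Real.sin θ, Real.cos θ]

/-- The planar cross product. -/
def cross (p q : Plane) : ℝ := p 0 * q 1 - p 1 * q 0

/-- The argument of a point of the plane, in `(-π, π]`. -/
def planeArg (x : Plane) : ℝ := (planeToComplex x).arg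

theorem planeToComplex_polarPoint (r θ : ℝ) :
    planeToComplex (polarPoint r θ) = Complex.polarCoord.symm (r, θ) := by
  rw [planeToComplex_apply, Complex.polarCoord_symm_apply]
  simp [polarPoint]
  ring

theorem continuous_polarPoint : Continuous fun p : ℝ × ℝ => polarPoint p.1 p.2 := by
  unfold polarPoint
  fun_prop

theorem norm_polarPoint (r θ : ℝ) : ‖polarPoint r θ‖ = |r| := by
  rw [← planeToComplex.norm_map, planeToComplex_polarPoint, Complex.norm_polarCoord_symm]

theorem planeArg_polarPoint {r θ : ℝ} (hr : 0 < r) (hθ : θ ∈ Set.Ioc (-π) π) :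
    planeArg (polarPoint r θ) = θ := by
  rw [planeArg, planeToComplex_polarPoint, Complex.polarCoord_symm_apply]
  exact_mod_cast Complex.arg_mul_cos_add_sin_mul_I hr hθ

theorem polarPoint_mem_slitPlane {r θ : ℝ} (hr : 0 < r) (hθ : θ ∈ Set.Ioo (-π) π) :
    planeToComplex (polarPoint r θ) ∈ Complex.slitPlane := by
  rw [planeToComplex_polarPoint]
  exact Complex.polarCoord.map_target (x := (r, θ)) ⟨hr, hθ⟩

theorem measurable_planeArg : Measurable planeArg :=
  Complex.measurable_arg.comp planeToComplex.continuous.measurable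

theorem polarPoint_norm_planeArg (x : Plane) : polarPoint ‖x‖ (planeArg x) = x := by
  apply planeToComplex.injective
  rw [planeToComplex_polarPoint, Complex.polarCoord_symm_apply, ← planeToComplex.norm_map]
  simpa [planeArg] using Complex.norm_mul_cos_add_sin_mul_I (planeToComplex x)

theorem lintegral_polar (f : Plane → ℝ≥0∞) :
    ∫⁻ x, f x = ∫⁻ p in Set.Ioi (0 : ℝ) ×ˢ Set.Ioo (-π) π,
      ENNReal.ofReal p.1 * f (polarPoint p.1 p.2) := by
  have h := planeToComplex.symm.measurePreserving.lintegral_comp_emb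
    planeToComplex.symm.toHomeomorph.measurableEmbedding f
  rw [← h, ← Complex.lintegral_comp_polarCoord_symm]
  change ∫⁻ p in Set.Ioi (0 : ℝ) ×ˢ Set.Ioo (-π) π, _ = _
  refine lintegral_congr fun p => ?_
  rw [smul_eq_mul, ← planeToComplex_polarPoint, planeToComplex.symm_apply_apply]

/-- Integration in polar coordinates over a measurable set of radii. -/
theorem setLIntegral_polar {f : Plane → ℝ≥0∞} (hf : Measurable f) {s : Set ℝ}
    (hs : MeasurableSet s) (hs0 : s ⊆ Set.Ioi 0) :
    ∫⁻ x in {x : Plane | ‖x‖ ∈ s}, f x =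
      ∫⁻ r in s, ∫⁻ θ in Set.Ioo (-π) π, ENNReal.ofReal r * f (polarPoint r θ) := by
  have hm : MeasurableSet {x : Plane | ‖x‖ ∈ s} := measurable_norm hs
  have hmeas : Measurable fun p : ℝ × ℝ => ENNReal.ofReal p.1 * f (polarPoint p.1 p.2) :=
    (ENNReal.measurable_ofReal.comp measurable_fst).mul (hf.comp continuous_polarPoint.measurable)
  rw [← lintegral_indicator hm, lintegral_polar, Measure.volume_eq_prod,
    ← Measure.prod_restrict]
  have e : ∀ᵐ p ∂((volume.restrict (Set.Ioi (0:ℝ))).prod (volume.restrict (Set.Ioo (-π) π))),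
      ENNReal.ofReal p.1 * Set.indicator {x : Plane | ‖x‖ ∈ s} f (polarPoint p.1 p.2)
      = Set.indicator (s ×ˢ Set.univ)
        (fun p : ℝ × ℝ => ENNReal.ofReal p.1 * f (polarPoint p.1 p.2)) p := by
    rw [Measure.prod_restrict]
    filter_upwards [ae_restrict_mem (measurableSet_Ioi.prod measurableSet_Ioo)] with p hp
    have h1 : ‖polarPoint p.1 p.2‖ = p.1 := by
      rw [norm_polarPoint, abs_of_pos hp.1]
    by_cases h : p.1 ∈ s <;> simp [Set.indicator, h1, h]
  rw [lintegral_congr_ae e, lintegral_indicator (hs.prod MeasurableSet.univ),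
    ← Measure.prod_restrict, Measure.restrict_univ, Measure.restrict_restrict hs,
    Set.inter_eq_left.2 hs0, lintegral_prod _ hmeas.aemeasurable]

theorem ball_ae_eq (l : ℝ) :
    (Metric.ball (0 : Plane) l : Set Plane) =ᵐ[volume] {x : Plane | ‖x‖ ∈ Set.Ioo 0 l} := by
  have h : ∀ᵐ x : Plane, x ≠ 0 := by simp [ae_iff]
  filter_upwards [h] with x hx
  apply propext
  change x ∈ Metric.ball 0 l ↔ ‖x‖ ∈ Set.Ioo 0 l
  simp [hx]

theorem lintegral_ball_polar {f : Plane → ℝ≥0∞} (hf : Measurable f) (l : ℝ) :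
    ∫⁻ x in Metric.ball (0 : Plane) l, f x =
      ∫⁻ r in Set.Ioo 0 l, ∫⁻ θ in Set.Ioo (-π) π, ENNReal.ofReal r * f (polarPoint r θ) := by
  rw [setLIntegral_congr (ball_ae_eq l),
    setLIntegral_polar hf measurableSet_Ioo Set.Ioo_subset_Ioi_self]

theorem ae_polarPoint_of_ae_ball {p : Plane → Prop} {l : ℝ}
    (h : ∀ᵐ x ∂volume.restrict (Metric.ball (0 : Plane) l), p x) :
    ∀ᵐ r ∂volume.restrict (Set.Ioo 0 l), ∀ᵐ θ ∂volume.restrict (Set.Ioo (-π) π),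
      p (polarPoint r θ) := by
  -- The exceptional set need not be measurable, so Tonelli is applied to a measurable null hull.
  set N := toMeasurable (volume.restrict (Metric.ball (0 : Plane) l)) {x | ¬ p x}
  have hN : volume.restrict (Metric.ball (0 : Plane) l) N = 0 := by
    rw [measure_toMeasurable]; exact h
  have hNm : MeasurableSet N := measurableSet_toMeasurable _ _
  have h0 := lintegral_ball_polar (f := N.indicator 1) (measurable_one.indicator hNm) l
  rw [lintegral_indicator_one hNm, hN] at h0
  have hmeas : Measurable fun p : ℝ × ℝ =>
      ENNReal.ofReal p.1 * N.indicator (1 : Plane → ℝ≥0∞) (polarPoint p.1 p.2) :=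
    (ENNReal.measurable_ofReal.comp measurable_fst).mul
      ((measurable_one.indicator hNm).comp continuous_polarPoint.measurable)
  rw [eq_comm, lintegral_eq_zero_iff hmeas.lintegral_prod_right'] at h0
  filter_upwards [h0, ae_restrict_mem measurableSet_Ioo] with r hr hrl
  have := (lintegral_eq_zero_iff (hmeas.comp measurable_prodMk_left)).1 hr
  filter_upwards [this] with θ hθ
  by_contra hp
  have : polarPoint r θ ∈ N := subset_toMeasurable _ _ hp
  simp [this] at hθ
  exact hrl.1.not_ge hθ

/-- A null set of angles spans a null cone, and the cut of the argument is null as well. This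
transfers Rademacher's theorem for functions of the angle to the plane. -/
theorem ae_planeArg_of_ae {q : ℝ → Prop} (h : ∀ᵐ θ, q θ) :
    ∀ᵐ x : Plane, planeToComplex x ∈ Complex.slitPlane ∧ q (planeArg x) := by
  set N := toMeasurable volume {θ | ¬ q θ}
  have hN : volume N = 0 := by
    rw [measure_toMeasurable]; exact h
  have hNm : MeasurableSet N := measurableSet_toMeasurable _ _
  have hS : MeasurableSet {x : Plane | planeToComplex x ∈ Complex.slitPlane} :=
    (Complex.isOpen_slitPlane.preimage planeToComplex.continuous).measurableSet
  set S : Set Plane := {x : Plane | planeToComplex x ∈ Complex.slitPlane}ᶜ ∪ planeArg ⁻¹' N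
  have hSm : MeasurableSet S := hS.compl.union (measurable_planeArg hNm)
  have h0 : volume S = 0 := by
    rw [← lintegral_indicator_one hSm, lintegral_polar, Measure.volume_eq_prod]
    have hmeas : Measurable fun p : ℝ × ℝ =>
        ENNReal.ofReal p.1 * S.indicator (1 : Plane → ℝ≥0∞) (polarPoint p.1 p.2) :=
      (ENNReal.measurable_ofReal.comp measurable_fst).mul
        ((measurable_one.indicator hSm).comp continuous_polarPoint.measurable)
    rw [← Measure.prod_restrict, lintegral_prod _ hmeas.aemeasurable]
    have : ∀ᵐ r ∂volume.restrict (Set.Ioi (0:ℝ)), ∫⁻ θ in Set.Ioo (-π) π,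
        ENNReal.ofReal r * S.indicator (1 : Plane → ℝ≥0∞) (polarPoint r θ) = 0 := by
      filter_upwards [ae_restrict_mem measurableSet_Ioi] with r hr
      refine (lintegral_eq_zero_iff (hmeas.comp measurable_prodMk_left)).2 ?_
      filter_upwards [ae_restrict_mem measurableSet_Ioo,
        ae_restrict_of_ae (measure_eq_zero_iff_ae_notMem.1 hN)] with θ hθ hθN
      have : polarPoint r θ ∉ S := by
        rintro (h | h)
        · exact h (polarPoint_mem_slitPlane hr hθ)
        · exact hθN (by simpa [planeArg_polarPoint hr ⟨hθ.1, hθ.2.le⟩] using h)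
      simp [this]
    rw [lintegral_congr_ae this, lintegral_zero]
  filter_upwards [measure_eq_zero_iff_ae_notMem.1 h0] with x hx
  simp only [S, Set.mem_union, not_or, Set.mem_compl_iff, not_not] at hx
  refine ⟨hx.1, ?_⟩
  by_contra hq
  exact hx.2 (subset_toMeasurable _ _ hq)

/-! ### Derivatives in the rotating polar frame -/

theorem hasDerivAt_plane {f : ℝ → Plane} {f' : Plane} {t : ℝ}
    (h : ∀ i, HasDerivAt (fun s => f s i) (f' i) t) : HasDerivAt f f' t :=
  ((PiLp.continuousLinearEquiv 2 ℝ fun _ : Fin 2 => ℝ).symm.hasFDerivAt.comp_hasDerivAt t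
    (hasDerivAt_pi.2 h) :)

theorem hasDerivAt_polarPoint_radius (r θ : ℝ) :
    HasDerivAt (fun ρ => polarPoint ρ θ) (radialVec θ) r := by
  apply hasDerivAt_plane
  intro i
  fin_cases i
  · simpa [polarPoint, radialVec] using (hasDerivAt_id r).mul_const (Real.cos θ)
  · simpa [polarPoint, radialVec] using (hasDerivAt_id r).mul_const (Real.sin θ)

theorem hasDerivAt_polarPoint_angle (r θ : ℝ) :
    HasDerivAt (fun t => polarPoint r t) (r • angularVec θ) θ := by
  apply hasDerivAt_plane
  intro i
  fin_cases i
  · simpa [polarPoint, angularVec] using (Real.hasDerivAt_cos θ).const_mul r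
  · simpa [polarPoint, angularVec] using (Real.hasDerivAt_sin θ).const_mul r

theorem fderiv_polar_apply (L : Plane →L[ℝ] Plane) (a b : ℝ) :
    L !₂[a, b] = a • L (EuclideanSpace.single 0 1) + b • L (EuclideanSpace.single 1 1) := by
  rw [← map_smul, ← map_smul, ← map_add]
  congr 1
  ext i
  fin_cases i <;> simp

/-- The Frobenius norm does not depend on the orthonormal frame, so radial and tangential
derivatives can be separated. -/
theorem gradNormSq_eq (v : Plane → Plane) (x : Plane) (θ : ℝ) :
    gradNormSq v x = ‖fderiv ℝ v x (radialVec θ)‖ ^ 2 + ‖fderiv ℝ v x (angularVec θ)‖ ^ 2 := by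
  simp only [gradNormSq, partialDeriv, radialVec, angularVec, fderiv_polar_apply,
    EuclideanSpace.norm_sq_eq, Fin.sum_univ_two, Real.norm_eq_abs, sq_abs, PiLp.add_apply,
    PiLp.smul_apply, smul_eq_mul]
  have := Real.sin_sq_add_cos_sq θ
  generalize fderiv ℝ v x (EuclideanSpace.single 0 1) 0 = a
  generalize fderiv ℝ v x (EuclideanSpace.single 1 1) 0 = b
  generalize fderiv ℝ v x (EuclideanSpace.single 0 1) 1 = c
  generalize fderiv ℝ v x (EuclideanSpace.single 1 1) 1 = d
  linear_combination (-(a^2+b^2+c^2+d^2)) * this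

theorem jacobian_eq (v : Plane → Plane) (x : Plane) (θ : ℝ) :
    jacobian v x = cross (fderiv ℝ v x (radialVec θ)) (fderiv ℝ v x (angularVec θ)) := by
  simp only [jacobian, partialDeriv, radialVec, angularVec, fderiv_polar_apply, cross,
    PiLp.add_apply, PiLp.smul_apply, smul_eq_mul]
  have := Real.sin_sq_add_cos_sq θ
  generalize fderiv ℝ v x (EuclideanSpace.single 0 1) 0 = a
  generalize fderiv ℝ v x (EuclideanSpace.single 1 1) 0 = b
  generalize fderiv ℝ v x (EuclideanSpace.single 0 1) 1 = c
  generalize fderiv ℝ v x (EuclideanSpace.single 1 1) 1 = d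
  linear_combination (-(a*d-b*c)) * this

theorem fderiv_eq_polar (v : Plane → Plane) (x h : Plane) (θ : ℝ) :
    fderiv ℝ v x h = (h 0 * Real.cos θ + h 1 * Real.sin θ) • fderiv ℝ v x (radialVec θ)
      + (h 1 * Real.cos θ - h 0 * Real.sin θ) • fderiv ℝ v x (angularVec θ) := by
  rw [← map_smul, ← map_smul, ← map_add]
  congr 1
  have := Real.sin_sq_add_cos_sq θ
  ext i
  fin_cases i
  · simp [radialVec, angularVec]
    linear_combination (-(h 0)) * this
  · simp [radialVec, angularVec]
    linear_combination (-(h 1)) * this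

theorem DifferentiableAt.hasDerivAt_radius {v : Plane → Plane} {r θ : ℝ}
    (h : DifferentiableAt ℝ v (polarPoint r θ)) :
    HasDerivAt (fun ρ => v (polarPoint ρ θ)) (fderiv ℝ v (polarPoint r θ) (radialVec θ)) r :=
  h.hasFDerivAt.comp_hasDerivAt r (hasDerivAt_polarPoint_radius r θ)

theorem DifferentiableAt.hasDerivAt_angle {v : Plane → Plane} {r θ : ℝ}
    (h : DifferentiableAt ℝ v (polarPoint r θ)) :
    HasDerivAt (fun t => v (polarPoint r t)) (r • fderiv ℝ v (polarPoint r θ) (angularVec θ)) θ := by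
  rw [← map_smul]
  exact h.hasFDerivAt.comp_hasDerivAt θ (hasDerivAt_polarPoint_angle r θ)

theorem measurable_partialDeriv (v : Plane → Plane) (i j : Fin 2) :
    Measurable (partialDeriv v i j) := by
  have := (measurable_fderiv_apply_const ℝ v (EuclideanSpace.single j 1))
  exact (EuclideanSpace.proj (𝕜 := ℝ) i).continuous.measurable.comp this

theorem measurable_gradNormSq (v : Plane → Plane) : Measurable (gradNormSq v) := by
  unfold gradNormSq
  exact Finset.measurable_sum _ fun i _ => Finset.measurable_sum _ fun j _ =>
    (measurable_partialDeriv v i j).pow_const 2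

theorem measurable_jacobian (v : Plane → Plane) : Measurable (jacobian v) := by
  unfold jacobian
  exact ((measurable_partialDeriv v _ _).mul (measurable_partialDeriv v _ _)).sub
    ((measurable_partialDeriv v _ _).mul (measurable_partialDeriv v _ _))

theorem gradNormSq_nonneg (v : Plane → Plane) (x : Plane) : 0 ≤ gradNormSq v x := by
  unfold gradNormSq
  positivity

theorem abs_cross_le (p q : Plane) : |cross p q| ≤ ‖p‖ * ‖q‖ := by
  apply abs_le_of_sq_le_sq _ (by positivity)
  rw [mul_pow, EuclideanSpace.norm_sq_eq, EuclideanSpace.norm_sq_eq]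
  simp only [cross, Fin.sum_univ_two, Real.norm_eq_abs, sq_abs]
  nlinarith [sq_nonneg (p 0 * q 0 + p 1 * q 1)]

/-! ### Total variation as the mass of a weak gradient -/

/-- The space of `2 × 2` matrices with the Frobenius norm, as pairs of rows. -/
abbrev GradSpace : Type := PiLp 2 fun _ : Fin 2 => Plane

/-- The gradient matrix of a map of the plane. -/
def gradField (v : Plane → Plane) (x : Plane) : GradSpace :=
  WithLp.toLp 2 fun i => WithLp.toLp 2 fun j => partialDeriv v i j x

/-- The matrix field with given rows. -/
def testVec (ψ : Fin 2 → Plane → Plane) (x : Plane) : GradSpace :=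
  WithLp.toLp 2 fun i => ψ i x

theorem norm_gradField_sq (v : Plane → Plane) (x : Plane) :
    ‖gradField v x‖ ^ 2 = gradNormSq v x := by
  simp [gradField, gradNormSq, PiLp.norm_sq_eq_of_L2]

theorem norm_gradField (v : Plane → Plane) (x : Plane) :
    ‖gradField v x‖ = √(gradNormSq v x) := by
  rw [← norm_gradField_sq, Real.sqrt_sq (norm_nonneg _)]

theorem enorm_gradField (v : Plane → Plane) (x : Plane) :
    ‖gradField v x‖ₑ = ENNReal.ofReal √(gradNormSq v x) := by
  rw [← norm_gradField, ofReal_norm]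

theorem measurable_gradField (v : Plane → Plane) : Measurable (gradField v) := by
  unfold gradField
  refine (WithLp.measurable_toLp 2 _).comp (measurable_pi_lambda _ fun i => ?_)
  refine (WithLp.measurable_toLp 2 _).comp (measurable_pi_lambda _ fun j => ?_)
  exact measurable_partialDeriv v i j

theorem norm_testVec_le {Ω : Set Plane} {ψ : Fin 2 → Plane → Plane} (h : IsTestField Ω ψ)
    (x : Plane) : ‖testVec ψ x‖ ≤ 1 := by
  have := h.norm_le x
  rw [← sq_le_one_iff₀ (norm_nonneg _)]
  simpa [testVec, PiLp.norm_sq_eq_of_L2] using this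

theorem IsTestField.continuous_testVec {Ω : Set Plane} {ψ : Fin 2 → Plane → Plane}
    (h : IsTestField Ω ψ) : Continuous (testVec ψ) := by
  unfold testVec
  exact (PiLp.continuous_toLp 2 _).comp (continuous_pi fun i => (h.contDiff i).continuous)

/-- `F` is the weak gradient of `u` on `Ω`. -/
def IsWeakGradient (F : Plane → GradSpace) (u : Plane → Plane) (Ω : Set Plane) : Prop :=
  ∀ ψ, IsTestField Ω ψ →
    ∑ i, ∫ x in Ω, u x i * divergence (ψ i) x = - ∫ x in Ω, inner ℝ (F x) (testVec ψ x)

theorem le_totalVariation {u : Plane → Plane} {Ω : Set Plane} {ψ : Fin 2 → Plane → Plane}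
    (hψ : IsTestField Ω ψ) :
    ENNReal.ofReal (∑ i, ∫ x in Ω, u x i * divergence (ψ i) x) ≤ totalVariation u Ω := by
  unfold totalVariation
  exact le_iSup₂_of_le ψ hψ le_rfl

theorem IsWeakGradient.totalVariation_le {F : Plane → GradSpace} {u : Plane → Plane}
    {Ω : Set Plane} (h : IsWeakGradient F u Ω) :
    totalVariation u Ω ≤ ∫⁻ x in Ω, ‖F x‖ₑ := by
  refine iSup₂_le fun ψ hψ => ?_
  rw [h ψ hψ]
  calc ENNReal.ofReal (- ∫ x in Ω, inner ℝ (F x) (testVec ψ x))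
      ≤ ‖∫ x in Ω, inner ℝ (F x) (testVec ψ x)‖ₑ := by
        rw [← enorm_neg]; exact Real.ofReal_le_enorm _
    _ ≤ ∫⁻ x in Ω, ‖inner ℝ (F x) (testVec ψ x)‖ₑ := enorm_integral_le_lintegral_enorm _
    _ ≤ ∫⁻ x in Ω, ‖F x‖ₑ := by
        refine lintegral_mono fun x => ?_
        rw [enorm_le_iff_norm_le]
        exact (norm_inner_le_norm _ _).trans
          (mul_le_of_le_one_right (norm_nonneg _) (norm_testVec_le hψ x))

/-- The field `G / √(δ² + |G|²)` replaces the direction `G / |G|`, which is singular at the zeros of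
`G`; the price is at most `δ`. -/
theorem sub_le_sq_div_sqrt {t δ : ℝ} (ht : 0 ≤ t) (hδ : 0 < δ) :
    t - δ ≤ t ^ 2 / √(δ ^ 2 + t ^ 2) := by
  have hpos : 0 < √(δ ^ 2 + t ^ 2) := Real.sqrt_pos.2 (by positivity)
  rw [le_div_iff₀ hpos]
  rcases le_total t δ with h | h
  · exact (mul_nonpos_of_nonpos_of_nonneg (by linarith) hpos.le).trans (sq_nonneg t)
  · have : √(δ ^ 2 + t ^ 2) ≤ t + δ := Real.sqrt_le_iff.2 ⟨by positivity, by nlinarith⟩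
    nlinarith [sq_nonneg δ]

/-- An almost optimal dual field for `G`: its regularised direction times a bump function, so that
it is `C¹`, compactly supported in the ball and of norm at most `1`. -/
theorem exists_testField_of_contDiff {G : Plane → GradSpace} (hG : ContDiff ℝ 1 G) {s s' l : ℝ}
    (hs : 0 < s) (hss' : s < s') (hs'l : s' < l) {δ : ℝ} (hδ : 0 < δ) :
    ∃ ψ, IsTestField (Metric.ball (0 : Plane) l) ψ ∧
      (∀ x, x ∉ Metric.ball (0 : Plane) s' → testVec ψ x = 0) ∧
      ∃ χ : Plane → ℝ, Continuous χ ∧ (∀ x, 0 ≤ χ x) ∧ (∀ x, χ x ≤ 1) ∧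
        (∀ x ∈ Metric.ball (0 : Plane) s, χ x = 1) ∧
        (∀ x, x ∉ Metric.ball (0 : Plane) s' → χ x = 0) ∧
        ∀ x, inner ℝ (G x) (testVec ψ x) ≥ χ x * (‖G x‖ - δ) := by
  let χ : ContDiffBump (0 : Plane) := ⟨s, s', hs, hss'⟩
  have hsupp : Function.support χ = Metric.ball (0 : Plane) s' := χ.support_eq
  have hts : tsupport χ = Metric.closedBall (0 : Plane) s' := χ.tsupport_eq
  let c : Plane → ℝ := fun x => χ x * (√(δ ^ 2 + ‖G x‖ ^ 2))⁻¹
  have hpos : ∀ x, 0 < √(δ ^ 2 + ‖G x‖ ^ 2) := fun x => Real.sqrt_pos.2 (by positivity)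
  have hc : ContDiff ℝ 1 c := by
    refine χ.contDiff.mul (ContDiff.inv ?_ fun x => (hpos x).ne')
    exact ContDiff.sqrt (contDiff_const.add (hG.norm_sq ℝ)) fun x => by positivity
  have hzero : ∀ x, x ∉ Metric.ball (0 : Plane) s' → c x = 0 := by
    intro x hx
    rw [← hsupp, Function.notMem_support] at hx
    simp [c, hx]
  have hGi : ∀ i, ContDiff ℝ 1 fun x => G x i := fun i => by
    have := (PiLp.proj 2 (𝕜 := ℝ) (fun _ : Fin 2 => Plane) i).contDiff (n := 1)
    exact this.comp hG
  have htv : ∀ x, testVec (fun i x => c x • G x i) x = c x • G x := by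
    intro x; ext i j; simp [testVec]
  have hsub : ∀ i, tsupport (fun x => c x • G x i) ⊆ Metric.closedBall (0 : Plane) s' := by
    intro i
    rw [← hts]
    refine closure_mono fun x hx => ?_
    contrapose! hx
    rw [Function.notMem_support] at hx ⊢
    simp [c, hx]
  refine ⟨fun i x => c x • G x i, ⟨fun i => hc.smul (hGi i), fun i => ?_, fun i => ?_, fun x => ?_⟩,
    ?_, χ, χ.continuous, fun x => χ.nonneg, fun x => χ.le_one, ?_, ?_, ?_⟩
  · exact HasCompactSupport.of_support_subset_isCompact (isCompact_closedBall (0 : Plane) s')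
      (subset_closure.trans (hsub i))
  · exact (hsub i).trans (Metric.closedBall_subset_ball hs'l)
  · have : ∑ i, ‖c x • G x i‖ ^ 2 = (c x) ^ 2 * ‖G x‖ ^ 2 := by
      rw [PiLp.norm_sq_eq_of_L2, Finset.mul_sum]
      refine Finset.sum_congr rfl fun i _ => ?_
      rw [norm_smul, mul_pow, Real.norm_eq_abs, sq_abs]
    rw [this]
    have h1 : (c x) ^ 2 = (χ x) ^ 2 * (δ ^ 2 + ‖G x‖ ^ 2)⁻¹ := by
      simp only [c]; rw [mul_pow, inv_pow, Real.sq_sqrt (by positivity)]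
    rw [h1]
    have h2 : (χ x) ^ 2 ≤ 1 := pow_le_one₀ χ.nonneg χ.le_one
    have h3 : (δ ^ 2 + ‖G x‖ ^ 2)⁻¹ * ‖G x‖ ^ 2 ≤ 1 := by
      rw [inv_mul_le_one₀ (by positivity)]; nlinarith
    rw [mul_assoc]
    exact mul_le_one₀ h2 (by positivity) h3
  · intro x hx; rw [htv, hzero x hx, zero_smul]
  · intro x hx; exact χ.one_of_mem_closedBall (Metric.ball_subset_closedBall hx)
  · intro x hx; rwa [← hsupp, Function.notMem_support] at hx
  · intro x
    rw [htv, inner_smul_right, real_inner_self_eq_norm_sq, mul_assoc, inv_mul_eq_div]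
    exact mul_le_mul_of_nonneg_left (sub_le_sq_div_sqrt (norm_nonneg _) hδ) χ.nonneg

/-- A test field built for a smooth approximation `g` still nearly computes the norm of `f`. The
distance `‖f - g‖` is paid twice: once in the pairing, once in comparing `‖g‖` with `‖f‖`. -/
theorem inner_ge_of_cutoff {f g t : GradSpace} {c ε : ℝ} (ht : ‖t‖ ≤ 1) (hc0 : 0 ≤ c)
    (hc1 : c ≤ 1) (hin : inner ℝ g t ≥ c * (‖g‖ - ε)) :
    c * ‖f‖ - 2 * ‖f - g‖ - ε * c ≤ inner ℝ f t := by
  have h1 : inner ℝ f t = inner ℝ g t + inner ℝ (f - g) t := by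
    rw [inner_sub_left]; ring
  have h2 : -‖f - g‖ ≤ inner ℝ (f - g) t := by
    have h3 := abs_real_inner_le_norm (f - g) t
    have h4 := mul_le_of_le_one_right (norm_nonneg (f - g)) ht
    linarith [neg_abs_le (inner ℝ (f - g) t)]
  have h3 : ‖f‖ - ‖f - g‖ ≤ ‖g‖ := by
    have := norm_add_le g (f - g)
    rw [add_sub_cancel] at this
    linarith
  have h4 : c * (‖f‖ - ‖f - g‖) ≤ c * ‖g‖ := mul_le_mul_of_nonneg_left h3 hc0
  have h5 : c * ‖f - g‖ ≤ ‖f - g‖ := mul_le_of_le_one_left (norm_nonneg _) hc1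
  linarith

theorem IsWeakGradient.lintegral_smaller_ball_le {F : Plane → GradSpace} {u : Plane → Plane}
    {l : ℝ} (h : IsWeakGradient F u (Metric.ball 0 l))
    (hF : ∀ s < l, IntegrableOn F (Metric.ball 0 s)) {s : ℝ} (hs : 0 < s) (hsl : s < l) :
    ∫⁻ x in Metric.ball 0 s, ‖F x‖ₑ ≤ totalVariation u (Metric.ball 0 l) := by
  set s' := (s + l) / 2
  have hss' : s < s' := by simp only [s']; linarith
  have hs'l : s' < l := by simp only [s']; linarith
  -- The sign cancels the one from integration by parts. Truncation at the intermediate radius `s'`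
  -- makes the field integrable on the plane and is invisible to test fields vanishing outside that
  -- ball.
  set f₀ : Plane → GradSpace := (Metric.ball (0 : Plane) s').indicator fun x => - F x
  have hf₀ : Integrable f₀ := (hF s' hs'l).neg.integrable_indicator Metric.isOpen_ball.measurableSet
  set C := (volume (Metric.ball (0 : Plane) s')).toReal
  have key : ∀ ε : ℝ, 0 < ε →
      ENNReal.ofReal ((∫ x in Metric.ball (0 : Plane) s, ‖F x‖) - (2 + C) * ε)
        ≤ totalVariation u (Metric.ball 0 l) := by
    intro ε hε
    obtain ⟨G, hGc, hG, hGε⟩ := MemLp.exist_eLpNorm_sub_le (p := 1) (by simp) le_rfl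
      (memLp_one_iff_integrable.2 hf₀) hε
    have hGi : Integrable G := hG.continuous.integrable_of_hasCompactSupport hGc
    have hdiff : ∫ x, ‖f₀ x - G x‖ ≤ ε := by
      rw [eLpNorm_one_eq_lintegral_enorm] at hGε
      refine (integral_norm_eq_lintegral_enorm (hf₀.sub hGi).aestronglyMeasurable).trans_le ?_
      exact ENNReal.toReal_le_of_le_ofReal hε.le hGε
    have hG1 : ContDiff ℝ 1 G := hG.of_le (by exact_mod_cast le_top)
    obtain ⟨ψ, hψ, hψ0, χ, hχc, hχ0, hχ1, hχs, hχs', hin⟩ :=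
      exists_testField_of_contDiff hG1 hs hss' hs'l hε
    refine le_trans (ENNReal.ofReal_le_ofReal ?_) (le_totalVariation hψ)
    rw [h ψ hψ, ← integral_neg, ← integral_indicator (s := Metric.ball (0 : Plane) l)
      Metric.isOpen_ball.measurableSet]
    have e1 : (Metric.ball (0 : Plane) l).indicator (fun x => - inner ℝ (F x) (testVec ψ x))
        = fun x => inner ℝ (f₀ x) (testVec ψ x) := by
      ext x
      by_cases hx : x ∈ Metric.ball (0 : Plane) s'
      · have : x ∈ Metric.ball (0 : Plane) l := Metric.ball_subset_ball hs'l.le hx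
        simp only [f₀]
        rw [Set.indicator_of_mem this, Set.indicator_of_mem hx, inner_neg_left]
      · rw [hψ0 x hx, inner_zero_right]
        exact Set.indicator_apply_eq_zero.2 fun _ => by rw [hψ0 x hx, inner_zero_right, neg_zero]
    rw [e1]
    have hpt : ∀ x, (Metric.ball (0 : Plane) s).indicator (fun x => ‖F x‖) x - 2 * ‖f₀ x - G x‖
        - ε * (Metric.ball (0 : Plane) s').indicator 1 x ≤ inner ℝ (f₀ x) (testVec ψ x) := by
      intro x
      have h3 := inner_ge_of_cutoff (f := f₀ x) (norm_testVec_le hψ x) (hχ0 x) (hχ1 x) (hin x)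
      have h4 : (Metric.ball (0 : Plane) s).indicator (fun x => ‖F x‖) x ≤ χ x * ‖f₀ x‖ := by
        by_cases hx : x ∈ Metric.ball (0 : Plane) s
        · rw [Set.indicator_of_mem hx, hχs x hx]
          simp [f₀, Set.indicator_of_mem (Metric.ball_subset_ball hss'.le hx)]
        · rw [Set.indicator_of_notMem hx]; exact mul_nonneg (hχ0 x) (norm_nonneg _)
      have h5 : χ x ≤ (Metric.ball (0 : Plane) s').indicator 1 x := by
        by_cases hx : x ∈ Metric.ball (0 : Plane) s'
        · rw [Set.indicator_of_mem hx]; exact hχ1 x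
        · rw [Set.indicator_of_notMem hx, hχs' x hx]
      have h6 := mul_le_mul_of_nonneg_left h5 hε.le
      linarith
    have hi1 : Integrable ((Metric.ball (0 : Plane) s).indicator fun x => ‖F x‖) :=
      (integrable_indicator_iff Metric.isOpen_ball.measurableSet).2 (hF s hsl).norm
    have hi2 : Integrable fun x => 2 * ‖f₀ x - G x‖ := (hf₀.sub hGi).norm.const_mul 2
    have hi3 : Integrable fun x => ε * (Metric.ball (0 : Plane) s').indicator (1 : Plane → ℝ) x :=
      ((integrable_indicator_iff Metric.isOpen_ball.measurableSet).2
        (integrableOn_const (by exact measure_ball_lt_top.ne))).const_mul ε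
    have hi4 : Integrable fun x => inner ℝ (f₀ x) (testVec ψ x) := by
      refine hf₀.norm.mono' (hf₀.aestronglyMeasurable.inner
        hψ.continuous_testVec.aestronglyMeasurable) (ae_of_all _ fun x => ?_)
      exact (norm_inner_le_norm _ _).trans
          (mul_le_of_le_one_right (norm_nonneg _) (norm_testVec_le hψ x))
    have := integral_mono ((hi1.sub hi2).sub hi3) hi4 hpt
    rw [integral_sub' (hi1.sub hi2) hi3, integral_sub' hi1 hi2, integral_const_mul,
      integral_const_mul, integral_indicator_one Metric.isOpen_ball.measurableSet,
      integral_indicator Metric.isOpen_ball.measurableSet] at this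
    refine le_trans ?_ this
    have : volume.real (Metric.ball (0 : Plane) s') = C := rfl
    rw [this]
    nlinarith
  have hlim : Tendsto (fun ε : ℝ => ENNReal.ofReal
      ((∫ x in Metric.ball (0 : Plane) s, ‖F x‖) - (2 + C) * ε)) (𝓝[>] 0)
      (𝓝 (ENNReal.ofReal ((∫ x in Metric.ball (0 : Plane) s, ‖F x‖) - (2 + C) * 0))) := by
    apply ENNReal.tendsto_ofReal
    exact (Continuous.tendsto (by fun_prop) 0).mono_left nhdsWithin_le_nhds
  have := le_of_tendsto hlim (eventually_nhdsWithin_of_forall key)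
  rwa [mul_zero, sub_zero, ofReal_integral_norm_eq_lintegral_enorm (hF s hsl)] at this

theorem iUnion_ball_sub (l : ℝ) :
    Metric.ball (0 : Plane) l = ⋃ n : ℕ, Metric.ball (0 : Plane) (l - 1 / (n + 1)) := by
  ext x
  simp only [Metric.mem_ball, dist_zero_right, Set.mem_iUnion]
  constructor
  · intro h
    obtain ⟨n, hn⟩ := exists_nat_one_div_lt (sub_pos.2 h)
    exact ⟨n, by linarith⟩
  · rintro ⟨n, hn⟩
    have : (0 : ℝ) < 1 / (n + 1) := by positivity
    linarith

/-- Exhaustion by smaller balls. Only local integrability is assumed, because the gradient of a `C¹`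
map on the open ball may blow up at the boundary; its integrability is a consequence of finite
variation, not a premise. -/
theorem IsWeakGradient.lintegral_le_totalVariation {F : Plane → GradSpace} {u : Plane → Plane}
    {l : ℝ} (h : IsWeakGradient F u (Metric.ball 0 l))
    (hF : ∀ s < l, IntegrableOn F (Metric.ball 0 s)) :
    ∫⁻ x in Metric.ball 0 l, ‖F x‖ₑ ≤ totalVariation u (Metric.ball 0 l) := by
  rw [iUnion_ball_sub, setLIntegral_iUnion_of_directed, ← iUnion_ball_sub]
  · refine iSup_le fun n => ?_
    rcases le_or_gt (l - 1 / ((n : ℝ) + 1)) 0 with h0 | h0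
    · rw [Metric.ball_eq_empty.2 h0]; simp
    · have : (0 : ℝ) < 1 / (n + 1) := by positivity
      exact h.lintegral_smaller_ball_le hF h0 (by linarith)
  · apply Monotone.directed_le
    intro m n hmn
    apply Metric.ball_subset_ball
    have : (1 : ℝ) / (n + 1) ≤ 1 / (m + 1) := one_div_le_one_div_of_le (by positivity)
      (by exact_mod_cast Nat.succ_le_succ hmn)
    linarith

theorem IsWeakGradient.totalVariation_eq {F : Plane → GradSpace} {u : Plane → Plane}
    {l : ℝ} (h : IsWeakGradient F u (Metric.ball 0 l)) (hF : IntegrableOn F (Metric.ball 0 l)) :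
    totalVariation u (Metric.ball 0 l) = ∫⁻ x in Metric.ball 0 l, ‖F x‖ₑ :=
  le_antisymm h.totalVariation_le (h.lintegral_le_totalVariation fun _ hs =>
    hF.mono_set (Metric.ball_subset_ball hs.le))

/-! ### Weak gradients of `C¹` maps and of dominated limits -/

theorem integrable_mul_of_tsupport_subset {Ω : Set Plane} {f g : Plane → ℝ}
    (hf : ContinuousOn f Ω) (hg : Continuous g) (hgc : HasCompactSupport g)
    (hgΩ : tsupport g ⊆ Ω) : Integrable fun x => f x * g x := by
  have h1 : IntegrableOn (fun x => f x * g x) (tsupport g) :=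
    ((hf.mono hgΩ).mul hg.continuousOn).integrableOn_compact hgc
  refine (integrableOn_iff_integrable_of_support_subset ?_).1 h1
  intro x hx
  apply subset_tsupport
  rw [Function.mem_support] at hx ⊢
  exact right_ne_zero_of_mul hx

theorem continuousOn_partialDeriv {v : Plane → Plane} {Ω : Set Plane} (hΩ : IsOpen Ω)
    (hv : ContDiffOn ℝ 1 v Ω) (i j : Fin 2) : ContinuousOn (partialDeriv v i j) Ω := by
  have := hv.continuousOn_fderiv_of_isOpen hΩ le_rfl
  exact (EuclideanSpace.proj (𝕜 := ℝ) i).continuous.comp_continuousOn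
    (this.clm_apply continuousOn_const)

theorem isWeakGradient_of_contDiffOn {v : Plane → Plane} {Ω : Set Plane} (hΩ : IsOpen Ω)
    (hv : ContDiffOn ℝ 1 v Ω) : IsWeakGradient (gradField v) v Ω := by
  intro ψ hψ
  have hdiff : ∀ x ∈ Ω, DifferentiableAt ℝ v x := fun x hx =>
    (hv.differentiableOn one_ne_zero).differentiableAt (hΩ.mem_nhds hx)
  have hpd : ∀ i j x, fderiv ℝ (fun x => ψ i x j) x (EuclideanSpace.single j 1)
      = partialDeriv (ψ i) j j x := by
    intro i j x
    have h1 : DifferentiableAt ℝ (ψ i) x := (hψ.contDiff i).differentiable one_ne_zero x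
    have h2 : HasFDerivAt (fun x => ψ i x j)
        ((EuclideanSpace.proj (𝕜 := ℝ) j).comp (fderiv ℝ (ψ i) x)) x :=
      (EuclideanSpace.proj (𝕜 := ℝ) j).hasFDerivAt.comp x h1.hasFDerivAt
    rw [h2.fderiv]; rfl
  have hvd : ∀ i j x, x ∈ Ω → fderiv ℝ (fun x => v x i) x (EuclideanSpace.single j 1)
      = partialDeriv v i j x := by
    intro i j x hx
    have h2 : HasFDerivAt (fun x => v x i)
        ((EuclideanSpace.proj (𝕜 := ℝ) i).comp (fderiv ℝ v x)) x :=
      (EuclideanSpace.proj (𝕜 := ℝ) i).hasFDerivAt.comp x (hdiff x hx).hasFDerivAt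
    rw [h2.fderiv]; rfl
  have hψj : ∀ i j, tsupport (fun x => ψ i x j) ⊆ tsupport (ψ i) := by
    intro i j
    refine closure_mono fun x hx => ?_
    contrapose! hx
    rw [Function.notMem_support] at hx ⊢
    simp [hx]
  have hψjc : ∀ i j, HasCompactSupport (fun x => ψ i x j) := fun i j =>
    (hψ.compactSupport i).of_isClosed_subset (isClosed_tsupport _) (hψj i j)
  have hψjd : ∀ i j, ContDiff ℝ 1 (fun x => ψ i x j) := fun i j =>
    (EuclideanSpace.proj (𝕜 := ℝ) j).contDiff.comp (hψ.contDiff i)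
  have hdsupp : ∀ i j, tsupport (partialDeriv (ψ i) j j) ⊆ tsupport (ψ i) := by
    intro i j
    refine closure_minimal (fun x hx => ?_) (isClosed_tsupport _)
    apply support_fderiv_subset ℝ
    rw [Function.mem_support] at hx ⊢
    contrapose! hx
    simp [partialDeriv, hx]
  have hdcont : ∀ i j, Continuous (partialDeriv (ψ i) j j) := fun i j =>
    continuousOn_univ.1 (continuousOn_partialDeriv isOpen_univ (hψ.contDiff i).contDiffOn j j)
  have hvi : ∀ i, ContinuousOn (fun x => v x i) Ω := fun i =>
    (EuclideanSpace.proj (𝕜 := ℝ) i).continuous.comp_continuousOn hv.continuousOn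
  have I1 : ∀ i j, Integrable fun x => v x i * partialDeriv (ψ i) j j x := fun i j =>
    integrable_mul_of_tsupport_subset (hvi i) (hdcont i j)
      ((hψ.compactSupport i).of_isClosed_subset (isClosed_tsupport _) (hdsupp i j))
      ((hdsupp i j).trans (hψ.support_subset i))
  have I2 : ∀ i j, Integrable fun x => partialDeriv v i j x * ψ i x j := fun i j =>
    integrable_mul_of_tsupport_subset (continuousOn_partialDeriv hΩ hv i j)
      (hψjd i j).continuous (hψjc i j) ((hψj i j).trans (hψ.support_subset i))
  have I3 : ∀ i j, Integrable fun x => v x i * ψ i x j := fun i j =>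
    integrable_mul_of_tsupport_subset (hvi i) (hψjd i j).continuous (hψjc i j)
      ((hψj i j).trans (hψ.support_subset i))
  have hIΩ : ∀ x, x ∉ Ω → ∀ i j, ψ i x j = 0 := by
    intro x hx i j
    have : ψ i x = 0 := image_eq_zero_of_notMem_tsupport fun h => hx (hψ.support_subset i h)
    simp [this]
  -- Outside `Ω` the map `v` is arbitrary, but there the test field vanishes. The products therefore
  -- agree on the whole plane, where the integration by parts takes place.
  have hswap : ∀ i j x, fderiv ℝ (fun x => v x i) x (EuclideanSpace.single j 1) * ψ i x j
      = partialDeriv v i j x * ψ i x j := by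
    intro i j x
    by_cases hx : x ∈ Ω
    · rw [hvd i j x hx]
    · rw [hIΩ x hx, mul_zero, mul_zero]
  have ibp : ∀ i j, ∫ x, v x i * partialDeriv (ψ i) j j x = - ∫ x, partialDeriv v i j x * ψ i x j := by
    intro i j
    have := integral_mul_fderiv_eq_neg_fderiv_mul_of_integrable (μ := volume)
      (f := fun x => v x i) (g := fun x => ψ i x j) (v := EuclideanSpace.single j 1)
      (by simpa only [hswap] using I2 i j) (by simpa only [hpd] using I1 i j) (I3 i j)
      (fun x hx => (EuclideanSpace.proj (𝕜 := ℝ) i).differentiableAt.comp x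
        (hdiff x (hψ.support_subset i (hψj i j hx))))
      (fun x _ => (hψjd i j).differentiable one_ne_zero x)
    simpa only [hswap, hpd] using this
  have e1 : ∀ i, ∫ x in Ω, v x i * divergence (ψ i) x = - ∑ j, ∫ x, partialDeriv v i j x * ψ i x j := by
    intro i
    rw [setIntegral_eq_integral_of_forall_compl_eq_zero]
    · simp only [divergence, Finset.mul_sum]
      rw [integral_finsetSum _ fun j _ => I1 i j, ← Finset.sum_neg_distrib]
      exact Finset.sum_congr rfl fun j _ => ibp i j
    · intro x hx
      simp only [divergence]
      rw [Finset.sum_eq_zero, mul_zero]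
      intro j _
      exact image_eq_zero_of_notMem_tsupport fun h =>
        hx (hψ.support_subset i (hdsupp i j h))
  have e2 : ∀ x, inner ℝ (gradField v x) (testVec ψ x) = ∑ i, ∑ j, partialDeriv v i j x * ψ i x j := by
    intro x
    simp only [gradField, testVec, PiLp.inner_apply]
    refine Finset.sum_congr rfl fun i _ => Finset.sum_congr rfl fun j _ => ?_
    simp [mul_comm]
  rw [setIntegral_eq_integral_of_forall_compl_eq_zero]
  · simp only [e2]
    rw [integral_finsetSum _ fun i _ => integrable_finsetSum _ fun j _ => I2 i j,
      ← Finset.sum_neg_distrib]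
    refine Finset.sum_congr rfl fun i _ => ?_
    rw [e1, integral_finsetSum _ fun j _ => I2 i j]
  · intro x hx
    rw [e2]
    exact Finset.sum_eq_zero fun i _ => Finset.sum_eq_zero fun j _ => by
      rw [hIΩ x hx, mul_zero]

theorem IsTestField.exists_divergence_bound {Ω : Set Plane} {ψ : Fin 2 → Plane → Plane}
    (h : IsTestField Ω ψ) (i : Fin 2) :
    Continuous (divergence (ψ i)) ∧ ∃ C, ∀ x, ‖divergence (ψ i) x‖ ≤ C := by
  have hdcont : ∀ j, Continuous (partialDeriv (ψ i) j j) := fun j =>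
    continuousOn_univ.1 (continuousOn_partialDeriv isOpen_univ (h.contDiff i).contDiffOn j j)
  have hc : Continuous (divergence (ψ i)) := by
    unfold divergence
    exact continuous_finsetSum _ fun j _ => hdcont j
  refine ⟨hc, ?_⟩
  have : HasCompactSupport (divergence (ψ i)) := by
    refine (h.compactSupport i).of_isClosed_subset (isClosed_tsupport _)
      (closure_minimal (fun x hx => ?_) (isClosed_tsupport _))
    apply support_fderiv_subset ℝ
    rw [Function.mem_support] at hx ⊢
    contrapose! hx
    simp [divergence, partialDeriv, hx]
  exact this.exists_bound_of_continuous hc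

/-- Weak gradients pass to dominated pointwise limits. -/
theorem IsWeakGradient.of_tendsto {Ω : Set Plane} {v : ℕ → Plane → Plane} {u : Plane → Plane}
    {F : ℕ → Plane → GradSpace} {G : Plane → GradSpace} {b B : Plane → ℝ}
    (hw : ∀ n, IsWeakGradient (F n) (v n) Ω)
    (hvm : ∀ n, AEStronglyMeasurable (v n) (volume.restrict Ω))
    (hFm : ∀ n, AEStronglyMeasurable (F n) (volume.restrict Ω))
    (hb : IntegrableOn b Ω) (hB : IntegrableOn B Ω)
    (hvb : ∀ n, ∀ᵐ x ∂volume.restrict Ω, ‖v n x‖ ≤ b x)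
    (hFB : ∀ n, ∀ᵐ x ∂volume.restrict Ω, ‖F n x‖ ≤ B x)
    (hv : ∀ᵐ x ∂volume.restrict Ω, Tendsto (fun n => v n x) atTop (𝓝 (u x)))
    (hF : ∀ᵐ x ∂volume.restrict Ω, Tendsto (fun n => F n x) atTop (𝓝 (G x))) :
    IsWeakGradient G u Ω := by
  intro ψ hψ
  have l1 : Tendsto (fun n => ∑ i, ∫ x in Ω, v n x i * divergence (ψ i) x) atTop
      (𝓝 (∑ i, ∫ x in Ω, u x i * divergence (ψ i) x)) := by
    refine tendsto_finsetSum _ fun i _ => ?_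
    obtain ⟨hc, C, hC⟩ := hψ.exists_divergence_bound i
    refine tendsto_integral_of_dominated_convergence (fun x => b x * C) ?_ (hb.mul_const C) ?_ ?_
    · intro n
      exact ((EuclideanSpace.proj (𝕜 := ℝ) i).continuous.comp_aestronglyMeasurable (hvm n)).mul
        hc.aestronglyMeasurable
    · intro n
      filter_upwards [hvb n] with x hx
      rw [norm_mul]
      exact mul_le_mul ((PiLp.norm_apply_le _ _).trans hx) (hC x) (norm_nonneg _)
        ((norm_nonneg _).trans hx)
    · filter_upwards [hv] with x hx
      exact (((EuclideanSpace.proj (𝕜 := ℝ) i).continuous.tendsto _).comp hx).mul_const _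
  have l2 : Tendsto (fun n => - ∫ x in Ω, inner ℝ (F n x) (testVec ψ x)) atTop
      (𝓝 (- ∫ x in Ω, inner ℝ (G x) (testVec ψ x))) := by
    refine (tendsto_integral_of_dominated_convergence B ?_ hB ?_ ?_).neg
    · intro n
      exact (hFm n).inner hψ.continuous_testVec.aestronglyMeasurable
    · intro n
      filter_upwards [hFB n] with x hx
      exact ((norm_inner_le_norm _ _).trans
        (mul_le_of_le_one_right (norm_nonneg _) (norm_testVec_le hψ x))).trans hx
    · filter_upwards [hF] with x hx
      exact hx.inner tendsto_const_nhds
  exact tendsto_nhds_unique l1 (l2.congr fun n => (hw n ψ hψ).symm)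

/-! ### Lower semicontinuity of length -/

section LowerSemicontinuity

variable {E : Type*} [NormedAddCommGroup E]

theorem enorm_toLp_prod (c : ℝ) (p : E) :
    ‖WithLp.toLp 2 (c, p)‖ₑ = ENNReal.ofReal √(c ^ 2 + ‖p‖ ^ 2) := by
  rw [← ofReal_norm, WithLp.prod_norm_eq_of_L2]
  simp

variable [NormedSpace ℝ E]

/-- The curve `(c s, f s)` has speed `√(c² + |f'|²)`. Lower semicontinuity of length in the product
space thus also covers the area integrand on a circle of radius `c`. -/
theorem hasDerivAt_graph (c : ℝ) {f : ℝ → E} {f' : E} {t : ℝ} (hf : HasDerivAt f f' t) :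
    HasDerivAt (fun s => WithLp.toLp 2 (c * s, f s)) (WithLp.toLp 2 (c, f')) t :=
  ((WithLp.prodContinuousLinearEquiv 2 ℝ ℝ E).symm.hasFDerivAt.comp_hasDerivAt t
    ((hasDerivAt_const_mul c).prodMk hf) :)

variable [CompleteSpace E]

/-- Bound the increment by the integral of the speed and exchange the order of integration: each `t`
is counted by the `θ` in an interval of length `h`. -/
theorem lintegral_enorm_shift_sub_le {f : ℝ → E} (hf : ContDiff ℝ 1 f) {a b h : ℝ} (hh : 0 < h) :
    ∫⁻ θ in Set.Ioo a (b - h), ‖f (θ + h) - f θ‖ₑ ≤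
      ENNReal.ofReal h * ∫⁻ θ in Set.Ioo a b, ‖deriv f θ‖ₑ := by
  have hfc : Continuous (deriv f) := hf.continuous_deriv le_rfl
  have hFm : Measurable fun t => ‖deriv f t‖ₑ := hfc.enorm.measurable
  have hset : MeasurableSet {p : ℝ × ℝ | p.2 ∈ Set.Ioc p.1 (p.1 + h)} :=
    (measurableSet_lt measurable_fst measurable_snd).inter
      (measurableSet_le measurable_snd (measurable_fst.add_const h))
  have hGm : Measurable fun p : ℝ × ℝ =>
      {p : ℝ × ℝ | p.2 ∈ Set.Ioc p.1 (p.1 + h)}.indicator (fun p => ‖deriv f p.2‖ₑ) p :=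
    (hFm.comp measurable_snd).indicator hset
  calc ∫⁻ θ in Set.Ioo a (b - h), ‖f (θ + h) - f θ‖ₑ
      ≤ ∫⁻ θ in Set.Ioo a (b - h), ∫⁻ t in Set.Ioo a b,
          {p : ℝ × ℝ | p.2 ∈ Set.Ioc p.1 (p.1 + h)}.indicator (fun p => ‖deriv f p.2‖ₑ) (θ, t) := by
        refine setLIntegral_mono' measurableSet_Ioo fun θ hθ => ?_
        have e1 : f (θ + h) - f θ = ∫ t in θ..θ + h, deriv f t :=
          (intervalIntegral.integral_deriv_eq_sub
            (fun x _ => hf.differentiable one_ne_zero x) (hfc.intervalIntegrable _ _)).symm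
        have e2 : ∀ t, {p : ℝ × ℝ | p.2 ∈ Set.Ioc p.1 (p.1 + h)}.indicator
            (fun p => ‖deriv f p.2‖ₑ) (θ, t)
            = (Set.Ioc θ (θ + h)).indicator (fun t => ‖deriv f t‖ₑ) t := fun t => rfl
        rw [e1, intervalIntegral.integral_of_le (by linarith)]
        refine (enorm_integral_le_lintegral_enorm _).trans ?_
        simp_rw [e2]
        rw [lintegral_indicator measurableSet_Ioc, Measure.restrict_restrict measurableSet_Ioc,
          Set.inter_eq_left.2]
        intro t ht
        exact ⟨hθ.1.trans ht.1, by linarith [ht.2, hθ.2]⟩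
    _ = ∫⁻ t in Set.Ioo a b, ∫⁻ θ in Set.Ioo a (b - h),
          {p : ℝ × ℝ | p.2 ∈ Set.Ioc p.1 (p.1 + h)}.indicator (fun p => ‖deriv f p.2‖ₑ) (θ, t) :=
        lintegral_lintegral_swap hGm.aemeasurable
    _ ≤ ∫⁻ t in Set.Ioo a b, ENNReal.ofReal h * ‖deriv f t‖ₑ := by
        refine lintegral_mono fun t => ?_
        have e2 : ∀ θ, {p : ℝ × ℝ | p.2 ∈ Set.Ioc p.1 (p.1 + h)}.indicator
            (fun p => ‖deriv f p.2‖ₑ) (θ, t)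
            = (Set.Ico (t - h) t).indicator (fun _ => ‖deriv f t‖ₑ) θ := by
          intro θ
          have : (θ < t ∧ t ≤ θ + h) ↔ (t - h ≤ θ ∧ θ < t) :=
            ⟨fun h => ⟨by linarith [h.2], h.1⟩, fun h => ⟨h.2, by linarith [h.1]⟩⟩
          simp only [Set.indicator, Set.mem_ofPred_eq, Set.mem_Ioc, Set.mem_Ico, this]
        simp_rw [e2]
        refine (setLIntegral_le_lintegral _ _).trans ?_
        rw [lintegral_indicator_const measurableSet_Ico, Real.volume_Ico, mul_comm]
        simp
    _ = _ := lintegral_const_mul _ hFm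

/-- The length functional is lower semicontinuous for almost everywhere convergence. -/
theorem lintegral_enorm_deriv_le_liminf {γ : ℕ → ℝ → E} {g : ℝ → E} {a b : ℝ}
    (hγ : ∀ k, ContDiff ℝ 1 (γ k)) (hg : Continuous g)
    (hgd : ∀ᵐ θ, DifferentiableAt ℝ g θ)
    (hlim : ∀ᵐ θ, θ ∈ Set.Ioo a b → Tendsto (fun k => γ k θ) atTop (𝓝 (g θ))) :
    ∫⁻ θ in Set.Ioo a b, ‖deriv g θ‖ₑ ≤
      liminf (fun k => ∫⁻ θ in Set.Ioo a b, ‖deriv (γ k) θ‖ₑ) atTop := by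
  set A := liminf (fun k => ∫⁻ θ in Set.Ioo a b, ‖deriv (γ k) θ‖ₑ) atTop
  -- For fixed `h` the increments converge almost everywhere, so Fatou's lemma bounds those of `g`.
  -- A second use of Fatou, as `h → 0`, turns difference quotients of `g` into its derivative.
  have step : ∀ h : ℝ, 0 < h →
      ∫⁻ θ in Set.Ioo a (b - h), ‖g (θ + h) - g θ‖ₑ ≤ ENNReal.ofReal h * A := by
    intro h hh
    have hae : ∀ᵐ θ ∂volume.restrict (Set.Ioo a (b - h)),
        ‖g (θ + h) - g θ‖ₑ = liminf (fun k => ‖γ k (θ + h) - γ k θ‖ₑ) atTop := by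
      have hsh := (measurePreserving_add_right volume h).quasiMeasurePreserving.ae hlim
      filter_upwards [ae_restrict_of_ae hlim, ae_restrict_of_ae hsh,
        ae_restrict_mem measurableSet_Ioo] with θ h1 h2 h3
      refine ((Tendsto.sub (h2 ?_) (h1 ?_)).enorm.liminf_eq).symm
      · exact ⟨by linarith [h3.1], by linarith [h3.2]⟩
      · exact ⟨h3.1, by linarith [h3.2]⟩
    rw [lintegral_congr_ae hae]
    refine (lintegral_liminf_le fun k => ?_).trans ?_
    · have := (hγ k).continuous
      exact (by fun_prop : Continuous fun θ => ‖γ k (θ + h) - γ k θ‖ₑ).measurable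
    · rw [← ENNReal.liminf_const_mul_of_ne_top ENNReal.ofReal_ne_top]
      exact liminf_le_liminf (Eventually.of_forall fun k => lintegral_enorm_shift_sub_le (hγ k) hh)
  let h : ℕ → ℝ := fun n => 1 / ((n : ℝ) + 1)
  have hpos : ∀ n, 0 < h n := fun n => by positivity
  have h0 : Tendsto h atTop (𝓝 0) := tendsto_one_div_add_atTop_nhds_zero_nat
  -- The cut-off at `b - h n` keeps both endpoints of the increment inside `(a, b)`; at a fixed `θ <
  -- b` it is eventually inactive.
  let q : ℕ → ℝ → ℝ≥0∞ := fun n => (Set.Ioo a (b - h n)).indicator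
    fun θ => ‖(h n)⁻¹ • (g (θ + h n) - g θ)‖ₑ
  have hqm : ∀ n, Measurable (q n) := fun n =>
    (by fun_prop : Continuous fun θ => ‖(h n)⁻¹ • (g (θ + h n) - g θ)‖ₑ).measurable.indicator
      measurableSet_Ioo
  have hq : ∀ᵐ θ ∂volume.restrict (Set.Ioo a b), ‖deriv g θ‖ₑ = liminf (fun n => q n θ) atTop := by
    filter_upwards [ae_restrict_of_ae hgd, ae_restrict_mem measurableSet_Ioo] with θ hd hθ
    have t1 : Tendsto (fun n => ‖(h n)⁻¹ • (g (θ + h n) - g θ)‖ₑ) atTop (𝓝 ‖deriv g θ‖ₑ) := by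
      have := hd.hasDerivAt.tendsto_slope_zero
      exact (this.comp (tendsto_nhdsWithin_iff.2 ⟨h0, Eventually.of_forall fun n =>
        (hpos n).ne'⟩)).enorm
    refine (t1.congr' ?_).liminf_eq.symm
    have : ∀ᶠ n in atTop, h n < b - θ := h0.eventually_lt_const (by linarith [hθ.2])
    filter_upwards [this] with n hn
    simp only [q]
    rw [Set.indicator_of_mem]
    exact ⟨hθ.1, by linarith⟩
  rw [lintegral_congr_ae hq]
  refine (lintegral_liminf_le hqm).trans ?_
  refine liminf_le_of_frequently_le' (Eventually.frequently (Eventually.of_forall fun n => ?_))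
  simp only [q]
  rw [lintegral_indicator measurableSet_Ioo, Measure.restrict_restrict measurableSet_Ioo,
    Set.inter_eq_left.2 (Set.Ioo_subset_Ioo_right (by linarith [hpos n]))]
  simp_rw [enorm_smul]
  rw [lintegral_const_mul' _ _ (by simp)]
  refine (mul_le_mul_right (step _ (hpos n)) _).trans ?_
  rw [← mul_assoc, Real.enorm_eq_ofReal (inv_nonneg.2 (hpos n).le),
    ← ENNReal.ofReal_mul (inv_nonneg.2 (hpos n).le), inv_mul_cancel₀ (hpos n).ne']
  simp

/-- Lower semicontinuity of the length of graphs of scaled parameter. -/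
theorem lintegral_sqrt_deriv_le_liminf (c : ℝ) {γ : ℕ → ℝ → E} {g : ℝ → E} {a b : ℝ}
    (hγ : ∀ k, ContDiff ℝ 1 (γ k)) (hg : Continuous g)
    (hgd : ∀ᵐ θ, DifferentiableAt ℝ g θ)
    (hlim : ∀ᵐ θ, θ ∈ Set.Ioo a b → Tendsto (fun k => γ k θ) atTop (𝓝 (g θ))) :
    ∫⁻ θ in Set.Ioo a b, ENNReal.ofReal √(c ^ 2 + ‖deriv g θ‖ ^ 2) ≤
      liminf (fun k => ∫⁻ θ in Set.Ioo a b, ENNReal.ofReal √(c ^ 2 + ‖deriv (γ k) θ‖ ^ 2))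
        atTop := by
  have h := lintegral_enorm_deriv_le_liminf (a := a) (b := b)
    (γ := fun k s => WithLp.toLp 2 (c * s, γ k s)) (g := fun s => WithLp.toLp 2 (c * s, g s))
    (fun k => (WithLp.prodContinuousLinearEquiv 2 ℝ ℝ E).symm.contDiff.comp
      ((contDiff_const.mul contDiff_id).prodMk (hγ k)))
    ((WithLp.prodContinuousLinearEquiv 2 ℝ ℝ E).symm.continuous.comp
      ((continuous_const.mul continuous_id).prodMk hg))
    (hgd.mono fun θ hθ => (hasDerivAt_graph c hθ.hasDerivAt).differentiableAt)
    (hlim.mono fun θ hθ hm =>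
      ((WithLp.prodContinuousLinearEquiv 2 ℝ ℝ E).symm.continuous.tendsto _).comp
        (tendsto_const_nhds.prodMk_nhds (hθ hm)))
  have e1 : ∫⁻ θ in Set.Ioo a b, ENNReal.ofReal √(c ^ 2 + ‖deriv g θ‖ ^ 2) =
      ∫⁻ θ in Set.Ioo a b, ‖deriv (fun s => WithLp.toLp 2 (c * s, g s)) θ‖ₑ := by
    refine lintegral_congr_ae (ae_restrict_of_ae (hgd.mono fun θ hθ => ?_))
    simp only
    rw [(hasDerivAt_graph c hθ.hasDerivAt).deriv, enorm_toLp_prod]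
  have e2 : ∀ k θ, ENNReal.ofReal √(c ^ 2 + ‖deriv (γ k) θ‖ ^ 2) =
      ‖deriv (fun s => WithLp.toLp 2 (c * s, γ k s)) θ‖ₑ := by
    intro k θ
    rw [(hasDerivAt_graph c ((hγ k).differentiable one_ne_zero θ).hasDerivAt).deriv,
      enorm_toLp_prod]
  rw [e1]
  simp_rw [e2]
  exact h

end LowerSemicontinuity

/-! ### Closed curves converging with their lengths -/

theorem LipschitzWith.intervalIntegrable_norm_deriv {K : NNReal} {g : ℝ → Plane}
    (hg : LipschitzWith K g) (a b : ℝ) :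
    IntervalIntegrable (fun θ => ‖deriv g θ‖) volume a b := by
  have h : IntervalIntegrable (fun _ => (K : ℝ)) volume a b := intervalIntegrable_const
  refine h.mono_fun ?_ (ae_of_all _ fun θ => ?_)
  · exact (aestronglyMeasurable_deriv g _).norm
  · simpa using norm_deriv_le_of_lipschitz hg

theorem intervalIntegral_norm_deriv_le {K : NNReal} {g : ℝ → Plane}
    (hg : LipschitzWith K g) {a b : ℝ} (hab : a ≤ b) :
    ∫ θ in a..b, ‖deriv g θ‖ ≤ K * (b - a) := by
  have := intervalIntegral.integral_mono_on hab (hg.intervalIntegrable_norm_deriv a b)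
    (intervalIntegrable_const (c := (K : ℝ))) fun θ _ => norm_deriv_le_of_lipschitz hg
  simpa [mul_comm] using this

theorem ofReal_intervalIntegral_norm_deriv {f : ℝ → Plane} {a b : ℝ} (hab : a ≤ b)
    (hf : IntervalIntegrable (fun θ => ‖deriv f θ‖) volume a b) :
    ENNReal.ofReal (∫ θ in a..b, ‖deriv f θ‖) = ∫⁻ θ in Set.Ioo a b, ‖deriv f θ‖ₑ := by
  rw [intervalIntegral.integral_of_le hab, integral_Ioc_eq_integral_Ioo,
    ofReal_integral_eq_lintegral_ofReal]
  · simp only [ofReal_norm]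
  · exact ((intervalIntegrable_iff_integrableOn_Ioc_of_le hab).1 hf).mono_set
      Set.Ioo_subset_Ioc_self
  · exact ae_of_all _ fun _ => norm_nonneg _

theorem ContDiff.intervalIntegrable_norm_deriv {f : ℝ → Plane} (hf : ContDiff ℝ 1 f) (a b : ℝ) :
    IntervalIntegrable (fun θ => ‖deriv f θ‖) volume a b :=
  (hf.continuous_deriv le_rfl).norm.intervalIntegrable a b

/-- Applied to the complement of a short arc, this prevents length from concentrating on the arc:
the complement already uses up almost all of the limiting length available to it. -/
theorem eventually_length_ge {γ : ℕ → ℝ → Plane} {g : ℝ → Plane} {K : NNReal} {a b η : ℝ}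
    (hab : a ≤ b) (hγ : ∀ k, ContDiff ℝ 1 (γ k)) (hg : LipschitzWith K g)
    (hlim : ∀ᵐ θ, Tendsto (fun k => γ k θ) atTop (𝓝 (g θ))) (hη : 0 < η) :
    ∀ᶠ k in atTop, (∫ θ in a..b, ‖deriv g θ‖) ≤ (∫ θ in a..b, ‖deriv (γ k) θ‖) + η := by
  have h0 : ∀ f : ℝ → Plane, 0 ≤ ∫ θ in a..b, ‖deriv f θ‖ := fun f =>
    intervalIntegral.integral_nonneg hab fun _ _ => norm_nonneg _
  rcases (h0 g).eq_or_lt with h | h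
  · rw [← h]
    exact Eventually.of_forall fun k => by linarith [h0 (γ k)]
  have := lintegral_enorm_deriv_le_liminf (a := a) (b := b) hγ hg.continuous
    hg.ae_differentiableAt (hlim.mono fun θ h _ => h)
  rw [← ofReal_intervalIntegral_norm_deriv hab (hg.intervalIntegrable_norm_deriv a b)] at this
  have h3 := ((ENNReal.ofReal_lt_ofReal_iff h).2 (sub_lt_self _ hη)).trans_le this
  filter_upwards [eventually_lt_of_lt_liminf h3] with k hk
  rw [← ofReal_intervalIntegral_norm_deriv hab ((hγ k).intervalIntegrable_norm_deriv a b),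
    ENNReal.ofReal_lt_ofReal_iff'] at hk
  linarith [hk.1]

theorem Function.Periodic.deriv_norm {f : ℝ → Plane} {T : ℝ} (hf : Function.Periodic f T) :
    Function.Periodic (fun θ => ‖deriv f θ‖) T := by
  intro θ
  simp only
  rw [← deriv_comp_add_const, show (fun x => f (x + T)) = f from funext hf]

theorem norm_sub_le_intervalIntegral {f : ℝ → Plane} (hf : ContDiff ℝ 1 f) {a b s t : ℝ}
    (hs : s ∈ Set.Icc a b) (ht : t ∈ Set.Icc a b) :
    ‖f t - f s‖ ≤ ∫ θ in a..b, ‖deriv f θ‖ := by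
  wlog hst : s ≤ t generalizing s t
  · rw [norm_sub_rev]; exact this ht hs (not_le.1 hst).le
  rw [← intervalIntegral.integral_deriv_eq_sub (fun x _ => hf.differentiable one_ne_zero x)
    ((hf.continuous_deriv le_rfl).intervalIntegrable _ _)]
  refine (intervalIntegral.norm_integral_le_integral_norm hst).trans ?_
  exact intervalIntegral.integral_mono_interval hs.1 hst ht.2
    (ae_of_all _ fun _ => norm_nonneg _) (hf.intervalIntegrable_norm_deriv _ _)

/-- Almost everywhere convergence together with convergence of lengths implies uniform
convergence. -/
theorem tendstoUniformlyOn_of_length_tendsto {γ : ℕ → ℝ → Plane} {g : ℝ → Plane} {K : NNReal}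
    (hγ : ∀ k, ContDiff ℝ 1 (γ k)) (hg : LipschitzWith K g)
    (hγp : ∀ k, Function.Periodic (γ k) (2 * π)) (hgp : Function.Periodic g (2 * π))
    (hlim : ∀ᵐ θ, Tendsto (fun k => γ k θ) atTop (𝓝 (g θ)))
    (hlen : Tendsto (fun k => ∫ θ in (-π)..π, ‖deriv (γ k) θ‖) atTop
      (𝓝 (∫ θ in (-π)..π, ‖deriv g θ‖))) :
    TendstoUniformlyOn γ g atTop (Set.Icc (-π) π) := by
  rw [← tendstoLocallyUniformlyOn_iff_tendstoUniformlyOn_of_compact isCompact_Icc]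
  apply TendstoLocallyUniformly.tendstoLocallyUniformlyOn
  rw [Metric.tendstoLocallyUniformly_iff]
  intro ε hε θ₀
  -- `h < π` leaves a complementary arc. On the window of length `2 h`, both the oscillation of `g`
  -- and its length are at most `2 h K`, together at most `ε / 2`. Three further errors of `ε / 8`
  -- (total length, length of the complement, distance at one point) keep the sum below `ε`.
  obtain ⟨h, hh0, hhπ, hhK⟩ : ∃ h : ℝ, 0 < h ∧ h < π ∧ 4 * h * K ≤ ε / 2 := by
    refine ⟨min 1 (ε / (8 * (K + 1))), by positivity, ?_, ?_⟩
    · exact (min_le_left _ _).trans_lt (by linarith [Real.pi_gt_three])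
    · have h1 : min 1 (ε / (8 * ((K : ℝ) + 1))) ≤ ε / (8 * (K + 1)) := min_le_right _ _
      have h2 : (0 : ℝ) ≤ K := K.2
      calc 4 * min 1 (ε / (8 * ((K : ℝ) + 1))) * K ≤ 4 * (ε / (8 * (K + 1))) * (K + 1) := by
            gcongr
            linarith
        _ = ε / 2 := by field_simp; ring
  -- The window has positive measure, so it contains a point of convergence to serve as an anchor.
  obtain ⟨t, htI, htlim⟩ : ∃ t ∈ Set.Icc (θ₀ - h) (θ₀ + h),
      Tendsto (fun k => γ k t) atTop (𝓝 (g t)) := by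
    by_contra hcon
    push Not at hcon
    have h1 : volume (Set.Icc (θ₀ - h) (θ₀ + h)) = 0 :=
      measure_mono_null (fun t ht => hcon t ht) (ae_iff.1 hlim)
    rw [Real.volume_Icc, ENNReal.ofReal_eq_zero] at h1
    linarith
  have hη : 0 < ε / 8 := by positivity
  have ev1 := eventually_length_ge (a := θ₀ + h) (b := θ₀ - h + 2 * π) (by linarith) hγ hg hlim hη
  have ev2 := (tendsto_order.1 hlen).2 _ (lt_add_of_pos_right _ hη)
  have ev3 := Metric.tendsto_nhds.1 htlim _ hη
  refine ⟨Set.Icc (θ₀ - h) (θ₀ + h), Icc_mem_nhds (by linarith) (by linarith), ?_⟩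
  filter_upwards [ev1, ev2, ev3] with k hk1 hk2 hk3 θ hθ
  have per : ∀ f : ℝ → Plane, Function.Periodic f (2 * π) →
      (∀ a b, IntervalIntegrable (fun θ => ‖deriv f θ‖) volume a b) →
      (∫ θ in (θ₀ - h)..(θ₀ + h), ‖deriv f θ‖) + ∫ θ in (θ₀ + h)..(θ₀ - h + 2 * π), ‖deriv f θ‖
        = ∫ θ in (-π)..π, ‖deriv f θ‖ := by
    intro f hf hi
    rw [intervalIntegral.integral_add_adjacent_intervals (hi _ _) (hi _ _),
      hf.deriv_norm.intervalIntegral_add_eq (θ₀ - h) (-π)]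
    congr 1; ring
  have p1 := per (γ k) (hγp k) (hγ k).intervalIntegrable_norm_deriv
  have p2 := per g hgp hg.intervalIntegrable_norm_deriv
  have b1 := intervalIntegral_norm_deriv_le hg (a := θ₀ - h) (b := θ₀ + h) (by linarith)
  have b2 := norm_sub_le_intervalIntegral (hγ k) htI hθ
  have b3 : ‖g θ - g t‖ ≤ K * (2 * h) := by
    refine (hg.norm_sub_le θ t).trans ?_
    gcongr
    rw [Real.norm_eq_abs, abs_le]
    constructor <;> linarith [hθ.1, hθ.2, htI.1, htI.2]
  rw [dist_eq_norm] at hk3 ⊢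
  have b4 : ‖g θ - γ k θ‖ ≤ ‖g θ - g t‖ + ‖γ k t - g t‖ + ‖γ k θ - γ k t‖ := by
    have : g θ - γ k θ = (g θ - g t) - (γ k t - g t) - (γ k θ - γ k t) := by abel
    rw [this]
    exact (norm_sub_le _ _).trans (add_le_add_left (norm_sub_le _ _) _)
  nlinarith

/-! ### The winding integral and its continuity -/

theorem HasDerivAt.apply_plane {f : ℝ → Plane} {f' : Plane} {t : ℝ} (hf : HasDerivAt f f' t)
    (i : Fin 2) : HasDerivAt (fun s => f s i) (f' i) t :=
  (EuclideanSpace.proj (𝕜 := ℝ) i).hasFDerivAt.comp_hasDerivAt t hf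

theorem HasDerivAt.cross {f g : ℝ → Plane} {f' g' : Plane} {t : ℝ} (hf : HasDerivAt f f' t)
    (hg : HasDerivAt g g' t) :
    HasDerivAt (fun s => _root_.cross (f s) (g s))
      (_root_.cross f' (g t) + _root_.cross (f t) g') t := by
  have := ((hf.apply_plane 0).mul (hg.apply_plane 1)).sub
    ((hf.apply_plane 1).mul (hg.apply_plane 0))
  refine this.congr_deriv ?_
  simp only [_root_.cross]
  ring

theorem cross_sub_left (a b c : Plane) : cross (a - b) c = cross a c - cross b c := by
  simp [cross]; ring

theorem cross_sub_right (a b c : Plane) : cross a (b - c) = cross a b - cross a c := by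
  simp [cross]; ring

theorem measurable_cross {α : Type*} [MeasurableSpace α] {f g : α → Plane} (hf : Measurable f)
    (hg : Measurable g) : Measurable fun x => cross (f x) (g x) := by
  have h : ∀ i, Measurable fun p : Plane => p i := fun i =>
    (EuclideanSpace.proj (𝕜 := ℝ) i).continuous.measurable
  unfold cross
  exact (((h 0).comp hf).mul ((h 1).comp hg)).sub (((h 1).comp hf).mul ((h 0).comp hg))

theorem continuous_cross : Continuous fun p : Plane × Plane => cross p.1 p.2 := by
  unfold cross
  fun_prop

theorem LipschitzWith.absolutelyContinuous_apply {K : NNReal} {g : ℝ → Plane}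
    (hg : LipschitzWith K g) (i : Fin 2) (a b : ℝ) :
    AbsolutelyContinuousOnInterval (fun θ => g θ i) a b := by
  have h : LipschitzWith K fun θ => g θ i := by
    refine LipschitzWith.of_dist_le_mul fun x y => ?_
    refine le_trans ?_ (hg.dist_le_mul x y)
    rw [dist_eq_norm, dist_eq_norm]
    exact PiLp.norm_apply_le (g x - g y) i
  exact (h.lipschitzOnWith (s := Set.uIcc a b)).absolutelyContinuousOnInterval

theorem intervalIntegrable_cross_deriv {K : NNReal} {f g : ℝ → Plane} (hf : Continuous f)
    (hg : LipschitzWith K g) (a b : ℝ) :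
    IntervalIntegrable (fun θ => cross (f θ) (deriv g θ)) volume a b := by
  have h : IntervalIntegrable (fun θ => ‖f θ‖ * K) volume a b :=
    (by fun_prop : Continuous fun θ => ‖f θ‖ * (K : ℝ)).intervalIntegrable a b
  refine h.mono_fun (measurable_cross hf.measurable (measurable_deriv g)).aestronglyMeasurable
    (ae_of_all _ fun θ => ?_)
  simp only
  rw [Real.norm_eq_abs, Real.norm_of_nonneg (by positivity)]
  exact (abs_cross_le _ _).trans
    (mul_le_mul_of_nonneg_left (norm_deriv_le_of_lipschitz hg) (norm_nonneg _))

theorem ContDiff.absolutelyContinuous_apply {g : ℝ → Plane}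
    (hg : ContDiff ℝ 1 g) (i : Fin 2) (a b : ℝ) :
    AbsolutelyContinuousOnInterval (fun θ => g θ i) a b :=
  ((EuclideanSpace.proj (𝕜 := ℝ) i).contDiff.comp hg).contDiffOn.absolutelyContinuousOnInterval

/-- The derivative of the periodic function `cross g (f - g)` integrates to zero. Subtracting it
removes `f' - g'` from the integrand and leaves `cross (f - g) f' - cross g' (f - g)`, which is
controlled by the sup distance and the lengths alone. -/
theorem abs_integral_cross_sub_le {f g : ℝ → Plane} {K : NNReal} {S : ℝ}
    (hf : ContDiff ℝ 1 f) (hg : LipschitzWith K g)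
    (hfp : Function.Periodic f (2 * π)) (hgp : Function.Periodic g (2 * π))
    (hfg : ∀ θ ∈ Set.Icc (-π) π, ‖f θ - g θ‖ ≤ S) :
    |(∫ θ in (-π)..π, cross (f θ) (deriv f θ)) - ∫ θ in (-π)..π, cross (g θ) (deriv g θ)| ≤
      S * ((∫ θ in (-π)..π, ‖deriv f θ‖) + K * (2 * π)) := by
  have hfper : f π = f (-π) := by
    have := hfp (-π); rw [← this]; congr 1; ring
  have hgper : g π = g (-π) := by
    have := hgp (-π); rw [← this]; congr 1; ring
  let F : ℝ → ℝ := fun θ => cross (g θ) (f θ - g θ)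
  have hFac : AbsolutelyContinuousOnInterval F (-π) π := by
    have hd : ∀ i, AbsolutelyContinuousOnInterval (fun θ => (f θ - g θ) i) (-π) π := fun i =>
      (hf.absolutelyContinuous_apply i _ _).fun_sub (hg.absolutelyContinuous_apply i _ _)
    exact ((hg.absolutelyContinuous_apply 0 _ _).fun_mul (hd 1)).fun_sub
      ((hg.absolutelyContinuous_apply 1 _ _).fun_mul (hd 0))
  have hF0 : ∫ θ in (-π)..π, deriv F θ = 0 := by
    rw [hFac.integral_deriv_eq_sub]
    simp only [F]
    rw [hfper, hgper, sub_self]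
  have hfi : IntervalIntegrable (fun θ => cross (f θ) (deriv f θ)) volume (-π) π :=
    (continuous_cross.comp (hf.continuous.prodMk (hf.continuous_deriv le_rfl))).intervalIntegrable
      _ _
  have hgi := intervalIntegrable_cross_deriv hg.continuous hg (-π) π
  have e : (∫ θ in (-π)..π, cross (f θ) (deriv f θ)) - ∫ θ in (-π)..π, cross (g θ) (deriv g θ)
      = ∫ θ in (-π)..π, (cross (f θ) (deriv f θ) - cross (g θ) (deriv g θ) - deriv F θ) := by
    rw [intervalIntegral.integral_sub (hfi.sub hgi) hFac.intervalIntegrable_deriv, hF0, sub_zero,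
      intervalIntegral.integral_sub hfi hgi]
  rw [e, ← Real.norm_eq_abs]
  have hbi : IntervalIntegrable (fun θ => S * (‖deriv f θ‖ + K)) volume (-π) π :=
    ((hf.intervalIntegrable_norm_deriv _ _).add intervalIntegrable_const).const_mul S
  refine (intervalIntegral.norm_integral_le_of_norm_le (by linarith [Real.pi_pos])
    (g := fun θ => S * (‖deriv f θ‖ + K)) ?_ hbi).trans_eq ?_
  · filter_upwards [hg.ae_differentiableAt] with θ hd hθ
    have hfd := (hf.differentiable one_ne_zero θ).hasDerivAt
    have hd' := hd.hasDerivAt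
    have hF' : deriv F θ = cross (deriv g θ) (f θ - g θ) + cross (g θ) (deriv f θ - deriv g θ) :=
      (hd'.cross (hfd.sub hd')).deriv
    rw [hF']
    have e1 : cross (f θ) (deriv f θ) - cross (g θ) (deriv g θ)
        - (cross (deriv g θ) (f θ - g θ) + cross (g θ) (deriv f θ - deriv g θ))
        = cross (f θ - g θ) (deriv f θ) - cross (deriv g θ) (f θ - g θ) := by
      simp only [cross_sub_left, cross_sub_right]; ring
    have hu := hfg θ (Set.Ioc_subset_Icc_self hθ)
    rw [e1]
    refine (abs_sub _ _).trans ?_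
    have b1 := (abs_cross_le (f θ - g θ) (deriv f θ)).trans
      (mul_le_mul_of_nonneg_right hu (norm_nonneg _))
    have b2 := (abs_cross_le (deriv g θ) (f θ - g θ)).trans
      (mul_le_mul (norm_deriv_le_of_lipschitz hg) hu (norm_nonneg _) K.2)
    have : (S : ℝ) * (‖deriv f θ‖ + K) = S * ‖deriv f θ‖ + K * S := by ring
    rw [this]
    exact add_le_add b1 b2
  · rw [intervalIntegral.integral_const_mul, intervalIntegral.integral_add
      (hf.intervalIntegrable_norm_deriv _ _) intervalIntegrable_const,
      intervalIntegral.integral_const]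
    simp only [smul_eq_mul]
    ring

/-- The winding integral is continuous for almost everywhere convergence together with
convergence of lengths. -/
theorem tendsto_integral_cross_deriv {γ : ℕ → ℝ → Plane} {g : ℝ → Plane} {K : NNReal}
    (hγ : ∀ k, ContDiff ℝ 1 (γ k)) (hg : LipschitzWith K g)
    (hγp : ∀ k, Function.Periodic (γ k) (2 * π)) (hgp : Function.Periodic g (2 * π))
    (hlim : ∀ᵐ θ, Tendsto (fun k => γ k θ) atTop (𝓝 (g θ)))
    (hlen : Tendsto (fun k => ∫ θ in (-π)..π, ‖deriv (γ k) θ‖) atTop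
      (𝓝 (∫ θ in (-π)..π, ‖deriv g θ‖))) :
    Tendsto (fun k => ∫ θ in (-π)..π, cross (γ k θ) (deriv (γ k) θ)) atTop
      (𝓝 (∫ θ in (-π)..π, cross (g θ) (deriv g θ))) := by
  have hu := tendstoUniformlyOn_of_length_tendsto hγ hg hγp hgp hlim hlen
  rw [Metric.tendstoUniformlyOn_iff] at hu
  set M := ∫ θ in (-π)..π, ‖deriv g θ‖
  have hM : 0 ≤ M := intervalIntegral.integral_nonneg (by linarith [Real.pi_pos])
    fun _ _ => norm_nonneg _
  set C := M + 1 + K * (2 * π)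
  have hC : 0 < C := by positivity
  rw [Metric.tendsto_nhds]
  intro ε hε
  have hS : 0 < ε / (2 * C) := by positivity
  filter_upwards [hu _ hS, (tendsto_order.1 hlen).2 _ (lt_add_one M)] with k hk1 hk2
  rw [Real.dist_eq]
  refine (abs_integral_cross_sub_le (S := ε / (2 * C)) (hγ k) hg (hγp k) hgp fun θ hθ => ?_).trans_lt ?_
  · rw [← dist_eq_norm, dist_comm]; exact (hk1 θ hθ).le
  · calc ε / (2 * C) * ((∫ θ in (-π)..π, ‖deriv (γ k) θ‖) + K * (2 * π))
        ≤ ε / (2 * C) * C := by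
          apply mul_le_mul_of_nonneg_left _ hS.le
          simp only [C]; linarith
      _ = ε / 2 := by field_simp
      _ < ε := half_lt_self hε

/-! ### Stokes' formula for `C¹` maps on discs -/

/-- Again an exact derivative of `cross g (f - g)` is discarded. The right side involves the
difference of the curves but not of their derivatives, so it can be divided by a radial increment
without mixed second derivatives. This makes Stokes' formula available for maps that are only `C¹`.
-/
theorem integral_cross_sub_eq {f g f' g' : ℝ → Plane}
    (hf : ∀ θ, HasDerivAt f (f' θ) θ) (hg : ∀ θ, HasDerivAt g (g' θ) θ)
    (hf' : Continuous f') (hg' : Continuous g')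
    (hfp : Function.Periodic f (2 * π)) (hgp : Function.Periodic g (2 * π)) :
    (∫ θ in (-π)..π, cross (f θ) (f' θ)) - ∫ θ in (-π)..π, cross (g θ) (g' θ) =
      ∫ θ in (-π)..π, cross (f θ - g θ) (f' θ + g' θ) := by
  have hfc : Continuous f := continuous_iff_continuousAt.2 fun θ => (hf θ).continuousAt
  have hgc : Continuous g := continuous_iff_continuousAt.2 fun θ => (hg θ).continuousAt
  have hfper : f π = f (-π) := by
    have := hfp (-π); rw [← this]; congr 1; ring
  have hgper : g π = g (-π) := by
    have := hgp (-π); rw [← this]; congr 1; ring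
  have hcc : ∀ {p q : ℝ → Plane}, Continuous p → Continuous q →
      Continuous fun θ => cross (p θ) (q θ) := fun hp hq => continuous_cross.comp (hp.prodMk hq)
  have h0 : ∫ θ in (-π)..π, (cross (g' θ) (f θ - g θ) + cross (g θ) (f' θ - g' θ)) = 0 := by
    refine (intervalIntegral.integral_eq_sub_of_hasDerivAt
      (fun θ _ => (hg θ).cross ((hf θ).sub (hg θ)))
      (((hcc hg' (hfc.sub hgc)).add (hcc hgc (hf'.sub hg'))).intervalIntegrable _ _)).trans ?_
    simp [hfper, hgper]
  have hi : ∀ {p q : ℝ → Plane}, Continuous p → Continuous q →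
      IntervalIntegrable (fun θ => cross (p θ) (q θ)) volume (-π) π :=
    fun hp hq => (hcc hp hq).intervalIntegrable _ _
  have hs : Continuous fun θ => f θ - g θ := hfc.sub hgc
  have hs' : Continuous fun θ => f' θ - g' θ := hf'.sub hg'
  have hs'' : Continuous fun θ => f' θ + g' θ := hf'.add hg'
  rw [← add_zero (∫ θ in (-π)..π, cross (f θ - g θ) (f' θ + g' θ)), ← h0,
    ← intervalIntegral.integral_sub (hi hfc hf') (hi hgc hg'),
    ← intervalIntegral.integral_add (hi hs hs'') ((hi hg' hs).add (hi hgc hs'))]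
  refine intervalIntegral.integral_congr fun θ _ => ?_
  simp only [cross, PiLp.sub_apply, PiLp.add_apply]
  ring

/-- By `integral_cross_sub_eq` the difference quotient is the integral of `cross ((V s - V ρ) / (s -
ρ)) (B s + B ρ)`. The mean value inequality on a compact box dominates it, and the limit is `2 cross
A B`. Negative radii are admitted so that the centre is an interior point. -/
theorem hasDerivAt_winding {V A B : ℝ → ℝ → Plane} {R : ℝ}
    (hA : ∀ ρ ∈ Set.Ioo (-R) R, ∀ θ, HasDerivAt (fun s => V s θ) (A ρ θ) ρ)
    (hB : ∀ ρ ∈ Set.Ioo (-R) R, ∀ θ, HasDerivAt (V ρ) (B ρ θ) θ)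
    (hAc : ContinuousOn (fun p : ℝ × ℝ => A p.1 p.2) (Set.Ioo (-R) R ×ˢ Set.univ))
    (hBc : ContinuousOn (fun p : ℝ × ℝ => B p.1 p.2) (Set.Ioo (-R) R ×ˢ Set.univ))
    (hp : ∀ ρ, Function.Periodic (V ρ) (2 * π)) {ρ : ℝ} (hρ : ρ ∈ Set.Ioo (-R) R) :
    HasDerivAt (fun s => ∫ θ in (-π)..π, cross (V s θ) (B s θ))
      (∫ θ in (-π)..π, 2 * cross (A ρ θ) (B ρ θ)) ρ := by
  obtain ⟨δ, hδ, hsub⟩ : ∃ δ > 0, Set.Icc (ρ - δ) (ρ + δ) ⊆ Set.Ioo (-R) R := by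
    obtain ⟨δ, hδ, h⟩ := Metric.nhds_basis_closedBall.mem_iff.1 (isOpen_Ioo.mem_nhds hρ)
    exact ⟨δ, hδ, by rwa [Real.closedBall_eq_Icc] at h⟩
  have hQ : IsCompact (Set.Icc (ρ - δ) (ρ + δ) ×ˢ Set.Icc (-π) π) := isCompact_Icc.prod isCompact_Icc
  have hQsub : Set.Icc (ρ - δ) (ρ + δ) ×ˢ Set.Icc (-π) π ⊆ Set.Ioo (-R) R ×ˢ Set.univ :=
    Set.prod_mono hsub (Set.subset_univ _)
  obtain ⟨MA, hMA⟩ := hQ.exists_bound_of_continuousOn (hAc.mono hQsub)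
  obtain ⟨MB, hMB⟩ := hQ.exists_bound_of_continuousOn (hBc.mono hQsub)
  have hBcont : ∀ s ∈ Set.Ioo (-R) R, Continuous (B s) := fun s hs =>
    continuousOn_univ.1 (hBc.comp (f := fun θ => (s, θ)) (by fun_prop) fun θ _ => ⟨hs, trivial⟩)
  have hVcont : ∀ s ∈ Set.Ioo (-R) R, Continuous (V s) := fun s hs =>
    continuous_iff_continuousAt.2 fun θ => (hB s hs θ).continuousAt
  have hnear : ∀ᶠ s in 𝓝[≠] ρ, s ∈ Set.Icc (ρ - δ) (ρ + δ) :=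
    nhdsWithin_le_nhds (Icc_mem_nhds (by linarith) (by linarith))
  have hρI : ρ ∈ Set.Icc (ρ - δ) (ρ + δ) := ⟨by linarith, by linarith⟩
  rw [hasDerivAt_iff_tendsto_slope]
  have hslope : ∀ᶠ s in 𝓝[≠] ρ, (∫ θ in (-π)..π, cross ((s - ρ)⁻¹ • (V s θ - V ρ θ))
      (B s θ + B ρ θ)) = slope (fun s => ∫ θ in (-π)..π, cross (V s θ) (B s θ)) ρ s := by
    filter_upwards [hnear] with s hs
    rw [slope_def_module, integral_cross_sub_eq (hB s (hsub hs)) (hB ρ hρ) (hBcont s (hsub hs))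
      (hBcont ρ hρ) (hp s) (hp ρ), smul_eq_mul, ← intervalIntegral.integral_const_mul]
    refine intervalIntegral.integral_congr fun θ _ => ?_
    simp only [cross, PiLp.smul_apply, smul_eq_mul]
    ring
  refine Tendsto.congr' hslope ?_
  have hconv : ∀ θ, 2 * cross (A ρ θ) (B ρ θ) = cross (A ρ θ) (B ρ θ + B ρ θ) := fun θ => by
    simp only [cross, PiLp.add_apply]; ring
  simp_rw [hconv]
  refine intervalIntegral.tendsto_integral_filter_of_dominated_convergence
    (fun _ => MA * (MB + MB)) ?_ ?_ intervalIntegrable_const ?_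
  · filter_upwards [hnear] with s hs
    have h1 := hVcont s (hsub hs)
    have h2 := hVcont ρ hρ
    have h3 := hBcont s (hsub hs)
    have h4 := hBcont ρ hρ
    exact (continuous_cross.comp (((h1.sub h2).const_smul (s - ρ)⁻¹).prodMk
      (h3.add h4))).aestronglyMeasurable
  · filter_upwards [hnear, self_mem_nhdsWithin] with s hs hne
    refine ae_of_all _ fun θ hθ => ?_
    have hθ' : θ ∈ Set.Icc (-π) π := by
      rw [Set.uIoc_of_le (by linarith [Real.pi_pos])] at hθ
      exact Set.Ioc_subset_Icc_self hθ
    have hV : ‖V s θ - V ρ θ‖ ≤ MA * ‖s - ρ‖ :=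
      (convex_Icc (ρ - δ) (ρ + δ)).norm_image_sub_le_of_norm_hasDerivWithin_le
        (f := fun s => V s θ) (f' := fun s => A s θ)
        (fun x hx => (hA x (hsub hx) θ).hasDerivWithinAt) (fun x hx => hMA (x, θ) ⟨hx, hθ'⟩) hρI hs
    have hMA0 : 0 ≤ MA := (norm_nonneg _).trans (hMA (ρ, θ) ⟨hρI, hθ'⟩)
    have hne' : 0 < ‖s - ρ‖ := norm_pos_iff.2 (sub_ne_zero.2 hne)
    refine (abs_cross_le _ _).trans (mul_le_mul ?_ ?_ (norm_nonneg _) hMA0)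
    · rw [norm_smul, norm_inv, inv_mul_le_iff₀ hne', mul_comm]; exact hV
    · exact (norm_add_le _ _).trans (add_le_add (hMB (s, θ) ⟨hs, hθ'⟩) (hMB (ρ, θ) ⟨hρI, hθ'⟩))
  · refine ae_of_all _ fun θ _ => ?_
    have t1 := hasDerivAt_iff_tendsto_slope.1 (hA ρ hρ θ)
    have t2 : Tendsto (fun s => B s θ) (𝓝[≠] ρ) (𝓝 (B ρ θ)) := by
      have : ContinuousAt (fun p : ℝ × ℝ => B p.1 p.2) (ρ, θ) :=
        hBc.continuousAt ((isOpen_Ioo.prod isOpen_univ).mem_nhds ⟨hρ, trivial⟩)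
      exact (this.tendsto.comp ((continuous_id.prodMk continuous_const).tendsto ρ)).mono_left
        nhdsWithin_le_nhds
    exact (continuous_cross.tendsto (A ρ θ, B ρ θ + B ρ θ)).comp
      (t1.prodMk_nhds (t2.add tendsto_const_nhds))

/-- Integrate the radial derivative from the centre, where the curve is constant and the winding
integral vanishes. -/
theorem abs_winding_le {V A B : ℝ → ℝ → Plane} {R : ℝ}
    (hA : ∀ ρ ∈ Set.Ioo (-R) R, ∀ θ, HasDerivAt (fun s => V s θ) (A ρ θ) ρ)
    (hB : ∀ ρ ∈ Set.Ioo (-R) R, ∀ θ, HasDerivAt (V ρ) (B ρ θ) θ)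
    (hAc : ContinuousOn (fun p : ℝ × ℝ => A p.1 p.2) (Set.Ioo (-R) R ×ˢ Set.univ))
    (hBc : ContinuousOn (fun p : ℝ × ℝ => B p.1 p.2) (Set.Ioo (-R) R ×ˢ Set.univ))
    (hp : ∀ ρ, Function.Periodic (V ρ) (2 * π)) (hB0 : ∀ θ, B 0 θ = 0)
    {r : ℝ} (hr : r ∈ Set.Ioo 0 R) :
    ENNReal.ofReal |∫ θ in (-π)..π, cross (V r θ) (B r θ)| ≤
      2 * ∫⁻ ρ in Set.Ioo 0 r, ∫⁻ θ in Set.Ioo (-π) π, ‖cross (A ρ θ) (B ρ θ)‖ₑ := by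
  have hsub : Set.Icc 0 r ⊆ Set.Ioo (-R) R := fun x hx =>
    ⟨by linarith [hx.1, hr.1, hr.2], hx.2.trans_lt hr.2⟩
  have hcont : ContinuousOn (fun ρ => ∫ θ in (-π)..π, 2 * cross (A ρ θ) (B ρ θ)) (Set.Icc 0 r) := by
    -- Clamping the radius to `[0, r]` extends the integrand continuously to all real radii.
    let c : ℝ → ℝ := fun ρ => max 0 (min ρ r)
    have hcI : ∀ ρ, c ρ ∈ Set.Icc 0 r := fun ρ =>
      ⟨le_max_left _ _, max_le hr.1.le (min_le_right _ _)⟩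
    have hcc : Continuous c := by fun_prop
    have hAcc : Continuous fun p : ℝ × ℝ => A (c p.1) p.2 := continuousOn_univ.1
      (hAc.comp (f := fun p : ℝ × ℝ => (c p.1, p.2)) (by fun_prop)
        fun p _ => ⟨hsub (hcI _), trivial⟩)
    have hBcc : Continuous fun p : ℝ × ℝ => B (c p.1) p.2 := continuousOn_univ.1
      (hBc.comp (f := fun p : ℝ × ℝ => (c p.1, p.2)) (by fun_prop)
        fun p _ => ⟨hsub (hcI _), trivial⟩)
    have := intervalIntegral.continuous_parametric_intervalIntegral_of_continuous' (μ := volume)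
      (f := fun ρ θ => 2 * cross (A (c ρ) θ) (B (c ρ) θ))
      ((continuous_cross.comp (hAcc.prodMk hBcc)).const_mul 2 :) (-π) π
    refine this.continuousOn.congr fun ρ hρ => ?_
    have : c ρ = ρ := by simp only [c]; rw [min_eq_left hρ.2, max_eq_right hρ.1]
    simp only [this]
  have hftc := intervalIntegral.integral_eq_sub_of_hasDerivAt
    (fun ρ hρ => hasDerivAt_winding hA hB hAc hBc hp (hsub (by rwa [Set.uIcc_of_le hr.1.le] at hρ)))
    (hcont.intervalIntegrable_of_Icc hr.1.le)
  have h0 : ∫ θ in (-π)..π, cross (V 0 θ) (B 0 θ) = 0 := by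
    simp [hB0, cross]
  rw [h0, sub_zero] at hftc
  rw [← hftc, ← Real.enorm_eq_ofReal_abs, intervalIntegral.integral_of_le hr.1.le,
    integral_Ioc_eq_integral_Ioo]
  refine (enorm_integral_le_lintegral_enorm _).trans ?_
  rw [← lintegral_const_mul' _ _ (by simp)]
  refine lintegral_mono fun ρ => ?_
  rw [intervalIntegral.integral_of_le (by linarith [Real.pi_pos]), integral_Ioc_eq_integral_Ioo]
  refine (enorm_integral_le_lintegral_enorm _).trans ?_
  rw [← lintegral_const_mul' _ _ (by simp)]
  refine lintegral_mono fun θ => ?_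
  rw [enorm_mul]
  gcongr
  rw [Real.enorm_eq_ofReal zero_le_two]
  simp

theorem polarPoint_periodic (r : ℝ) : Function.Periodic (polarPoint r) (2 * π) := fun θ => by
  simp [polarPoint]

theorem polarPoint_mem_ball {r θ l : ℝ} (h : r ∈ Set.Ioo (-l) l) :
    polarPoint r θ ∈ Metric.ball (0 : Plane) l := by
  rw [mem_ball_zero_iff, norm_polarPoint]
  exact abs_lt.2 h

theorem continuous_radialVec : Continuous radialVec := by
  unfold radialVec; fun_prop

theorem continuous_angularVec : Continuous angularVec := by
  unfold angularVec; fun_prop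

/-- The Jacobian controls the winding integral on circles. -/
theorem abs_winding_le_lintegral_jacobian {v : Plane → Plane} {l r : ℝ}
    (hv : ContDiffOn ℝ 1 v (Metric.ball 0 l)) (hr : r ∈ Set.Ioo 0 l) :
    ENNReal.ofReal |∫ θ in (-π)..π, cross (v (polarPoint r θ))
      (deriv (fun t => v (polarPoint r t)) θ)| ≤
      2 * ∫⁻ x in Metric.ball 0 r, ‖jacobian v x‖ₑ := by
  have hdiff : ∀ ρ ∈ Set.Ioo (-l) l, ∀ θ, DifferentiableAt ℝ v (polarPoint ρ θ) := fun ρ hρ θ =>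
    (hv.differentiableOn one_ne_zero).differentiableAt
      (Metric.isOpen_ball.mem_nhds (polarPoint_mem_ball hρ))
  have hfd : ContinuousOn (fun p : ℝ × ℝ => fderiv ℝ v (polarPoint p.1 p.2))
      (Set.Ioo (-l) l ×ˢ Set.univ) :=
    (hv.continuousOn_fderiv_of_isOpen Metric.isOpen_ball le_rfl).comp
      continuous_polarPoint.continuousOn fun p hp => polarPoint_mem_ball hp.1
  have key := abs_winding_le (V := fun ρ θ => v (polarPoint ρ θ))
    (A := fun ρ θ => fderiv ℝ v (polarPoint ρ θ) (radialVec θ))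
    (B := fun ρ θ => ρ • fderiv ℝ v (polarPoint ρ θ) (angularVec θ)) (R := l)
    (fun ρ hρ θ => (hdiff ρ hρ θ).hasDerivAt_radius)
    (fun ρ hρ θ => (hdiff ρ hρ θ).hasDerivAt_angle)
    (hfd.clm_apply (continuous_radialVec.comp continuous_snd).continuousOn)
    (continuous_fst.continuousOn.smul
      (hfd.clm_apply (continuous_angularVec.comp continuous_snd).continuousOn))
    (fun ρ θ => by simp only [polarPoint_periodic ρ θ]) (fun θ => zero_smul _ _) hr
  have hrI : r ∈ Set.Ioo (-l) l := ⟨by linarith [hr.1, hr.2], hr.2⟩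
  have e1 : ∀ θ, deriv (fun t => v (polarPoint r t)) θ =
      r • fderiv ℝ v (polarPoint r θ) (angularVec θ) := fun θ =>
    (hdiff r hrI θ).hasDerivAt_angle.deriv
  simp_rw [e1]
  refine key.trans_eq ?_
  rw [lintegral_ball_polar (measurable_jacobian v).enorm]
  congr 1
  refine setLIntegral_congr_fun measurableSet_Ioo fun ρ hρ => ?_
  refine lintegral_congr fun θ => ?_
  rw [jacobian_eq v _ θ, ← Real.enorm_eq_ofReal hρ.1.le, ← enorm_mul]
  congr 1
  simp only [cross, PiLp.smul_apply, smul_eq_mul]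
  ring

/-! ### The vortex type map in polar coordinates -/

/-- The circle map `φ` in the arc length parameter. -/
def profile (φ : UnitCircle → UnitCircle) (θ : ℝ) : Plane := φ (circlePoint θ)

theorem norm_radialVec (θ : ℝ) : ‖radialVec θ‖ = 1 := by
  simp [radialVec, EuclideanSpace.norm_eq]

theorem norm_angularVec (θ : ℝ) : ‖angularVec θ‖ = 1 := by
  simp [angularVec, EuclideanSpace.norm_eq]

theorem hasDerivAt_radialVec (θ : ℝ) : HasDerivAt radialVec (angularVec θ) θ := by
  have := hasDerivAt_polarPoint_angle 1 θ
  simpa [polarPoint, radialVec] using! this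

theorem lipschitzWith_circlePoint : LipschitzWith 1 circlePoint := by
  have h : LipschitzWith 1 radialVec :=
    lipschitzWith_of_nnnorm_deriv_le (fun θ => (hasDerivAt_radialVec θ).differentiableAt)
      fun θ => by
        rw [(hasDerivAt_radialVec θ).deriv, ← NNReal.coe_le_coe, coe_nnnorm, norm_angularVec]
        simp
  exact fun x y => h x y

theorem circlePoint_periodic : Function.Periodic circlePoint (2 * π) := fun θ => by
  simp [circlePoint]

theorem profile_periodic (φ : UnitCircle → UnitCircle) :
    Function.Periodic (profile φ) (2 * π) := fun θ => by
  simp [profile, circlePoint_periodic θ]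

theorem norm_profile (φ : UnitCircle → UnitCircle) (θ : ℝ) : ‖profile φ θ‖ = 1 := by
  have := (φ (circlePoint θ)).2
  rwa [mem_sphere_zero_iff_norm] at this

theorem lipschitzWith_profile {φ : UnitCircle → UnitCircle} {K : NNReal} (h : LipschitzWith K φ) :
    LipschitzWith K (profile φ) := by
  have := h.comp lipschitzWith_circlePoint
  rw [mul_one] at this
  exact fun x y => this x y

theorem polarPoint_eq_smul (r θ : ℝ) : polarPoint r θ = r • radialVec θ := by
  ext i; fin_cases i <;> simp [polarPoint, radialVec]

theorem polarPoint_ne_zero {r θ : ℝ} (hr : 0 < r) : polarPoint r θ ≠ 0 := by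
  rw [← norm_pos_iff, norm_polarPoint]; exact abs_pos.2 hr.ne'

theorem vortexMap_polarPoint {r : ℝ} (hr : 0 < r) (θ : ℝ) :
    vortexMap (polarPoint r θ) = radialVec θ := by
  rw [vortexMap, norm_polarPoint, abs_of_pos hr, polarPoint_eq_smul, smul_smul,
    inv_mul_cancel₀ hr.ne', one_smul]

theorem vortexTypeMap_polarPoint (φ : UnitCircle → UnitCircle) {r : ℝ} (hr : 0 < r) (θ : ℝ) :
    vortexTypeMap φ (polarPoint r θ) = profile φ θ := by
  rw [vortexTypeMap, dif_pos (polarPoint_ne_zero hr), profile]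
  congr 2
  exact Subtype.ext (vortexMap_polarPoint hr θ)

theorem vortexTypeMap_eq (φ : UnitCircle → UnitCircle) {x : Plane} (hx : x ≠ 0) :
    vortexTypeMap φ x = profile φ (planeArg x) := by
  rw [← vortexTypeMap_polarPoint φ (norm_pos_iff.2 hx), polarPoint_norm_planeArg]

theorem measurable_vortexTypeMap {φ : UnitCircle → UnitCircle} (h : Continuous (profile φ)) :
    Measurable (vortexTypeMap φ) := by
  have : vortexTypeMap φ = ({0}ᶜ : Set Plane).indicator fun x => profile φ (planeArg x) := by
    ext1 x
    by_cases hx : x = 0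
    · simp [hx, vortexTypeMap]
    · rw [vortexTypeMap_eq φ hx, Set.indicator_of_mem (by simpa using hx)]
  rw [this]
  exact (h.measurable.comp measurable_planeArg).indicator (measurableSet_singleton 0).compl

theorem differentiableAt_planeArg {x : Plane} (hx : planeToComplex x ∈ Complex.slitPlane) :
    DifferentiableAt ℝ planeArg x := by
  have h1 : planeArg = fun x => (Complex.log (planeToComplex x)).im := by
    ext x; rw [Complex.log_im]; rfl
  rw [h1]
  have h2 : DifferentiableAt ℝ Complex.log (planeToComplex x) :=
    (Complex.hasStrictDerivAt_log hx).hasDerivAt.differentiableAt.restrictScalars ℝ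
  exact Complex.imCLM.differentiableAt.comp x
    (h2.comp x planeToComplex.toContinuousLinearEquiv.differentiableAt)

theorem differentiableAt_vortexTypeMap {φ : UnitCircle → UnitCircle} {x : Plane}
    (hx : planeToComplex x ∈ Complex.slitPlane)
    (h : DifferentiableAt ℝ (profile φ) (planeArg x)) :
    DifferentiableAt ℝ (vortexTypeMap φ) x := by
  have hx0 : x ≠ 0 := by
    rintro rfl
    simp at hx
  have : vortexTypeMap φ =ᶠ[𝓝 x] fun y => profile φ (planeArg y) := by
    filter_upwards [isOpen_ne.mem_nhds hx0] with y hy using vortexTypeMap_eq φ hy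
  exact (this.differentiableAt_iff).2 (h.comp x (differentiableAt_planeArg hx))

theorem fderiv_vortexTypeMap {φ : UnitCircle → UnitCircle} {r θ : ℝ} (hr : 0 < r)
    (hθ : θ ∈ Set.Ioo (-π) π) (h : DifferentiableAt ℝ (profile φ) θ) :
    fderiv ℝ (vortexTypeMap φ) (polarPoint r θ) (radialVec θ) = 0 ∧
    r • fderiv ℝ (vortexTypeMap φ) (polarPoint r θ) (angularVec θ) = deriv (profile φ) θ := by
  have hd : DifferentiableAt ℝ (vortexTypeMap φ) (polarPoint r θ) :=
    differentiableAt_vortexTypeMap (polarPoint_mem_slitPlane hr hθ)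
      (by rwa [planeArg_polarPoint hr ⟨hθ.1, hθ.2.le⟩])
  constructor
  · rw [← hd.hasDerivAt_radius.deriv]
    have : (fun ρ => vortexTypeMap φ (polarPoint ρ θ)) =ᶠ[𝓝 r] fun _ => profile φ θ := by
      filter_upwards [isOpen_Ioi.mem_nhds hr] with ρ hρ using vortexTypeMap_polarPoint φ hρ θ
    rw [this.deriv_eq, deriv_const]
  · rw [← hd.hasDerivAt_angle.deriv]
    congr 1
    ext1 t
    exact vortexTypeMap_polarPoint φ hr t

theorem gradNormSq_vortexTypeMap {φ : UnitCircle → UnitCircle} {r θ : ℝ} (hr : 0 < r)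
    (hθ : θ ∈ Set.Ioo (-π) π) (h : DifferentiableAt ℝ (profile φ) θ) :
    r ^ 2 * gradNormSq (vortexTypeMap φ) (polarPoint r θ) = ‖deriv (profile φ) θ‖ ^ 2 := by
  obtain ⟨h1, h2⟩ := fderiv_vortexTypeMap hr hθ h
  rw [gradNormSq_eq _ _ θ, h1, ← h2, norm_smul, Real.norm_eq_abs, abs_of_pos hr]
  simp
  ring

theorem ae_differentiableAt_vortexTypeMap {φ : UnitCircle → UnitCircle} {K : NNReal}
    (h : LipschitzWith K φ) : ∀ᵐ x, DifferentiableAt ℝ (vortexTypeMap φ) x :=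
  (ae_planeArg_of_ae (lipschitzWith_profile h).ae_differentiableAt).mono
    fun _ hx => differentiableAt_vortexTypeMap hx.1 hx.2

theorem mul_sqrt_eq {r G : ℝ} (hr : 0 ≤ r) : r * √(1 + G) = √(r ^ 2 + r ^ 2 * G) := by
  rw [show r ^ 2 + r ^ 2 * G = r ^ 2 * (1 + G) by ring, Real.sqrt_mul (sq_nonneg r),
    Real.sqrt_sq hr]

theorem lintegral_area_vortexTypeMap {φ : UnitCircle → UnitCircle} {K : NNReal}
    (h : LipschitzWith K φ) (l : ℝ) :
    ∫⁻ x in Metric.ball 0 l, ENNReal.ofReal √(1 + gradNormSq (vortexTypeMap φ) x) =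
      ∫⁻ r in Set.Ioo 0 l, ∫⁻ θ in Set.Ioo (-π) π,
        ENNReal.ofReal √(r ^ 2 + ‖deriv (profile φ) θ‖ ^ 2) := by
  rw [lintegral_ball_polar
    (((measurable_gradNormSq _).const_add 1).sqrt.ennreal_ofReal)]
  refine setLIntegral_congr_fun measurableSet_Ioo fun r hr => lintegral_congr_ae ?_
  filter_upwards [ae_restrict_mem measurableSet_Ioo,
    ae_restrict_of_ae (lipschitzWith_profile h).ae_differentiableAt] with θ hθ hd
  rw [← ENNReal.ofReal_mul hr.1.le, mul_sqrt_eq hr.1.le, gradNormSq_vortexTypeMap hr.1 hθ hd]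

/-- The weight `r` of polar coordinates cancels the factor `1 / r` of the tangential derivative, so
each circle contributes the same amount, the length of `profile φ`. -/
theorem lintegral_grad_vortexTypeMap {φ : UnitCircle → UnitCircle} {K : NNReal}
    (h : LipschitzWith K φ) (l : ℝ) :
    ∫⁻ x in Metric.ball 0 l, ‖gradField (vortexTypeMap φ) x‖ₑ =
      ∫⁻ _ in Set.Ioo 0 l, ∫⁻ θ in Set.Ioo (-π) π, ‖deriv (profile φ) θ‖ₑ := by
  rw [lintegral_ball_polar (measurable_gradField _).enorm]
  refine setLIntegral_congr_fun measurableSet_Ioo fun r hr => lintegral_congr_ae ?_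
  filter_upwards [ae_restrict_mem measurableSet_Ioo,
    ae_restrict_of_ae (lipschitzWith_profile h).ae_differentiableAt] with θ hθ hd
  rw [enorm_gradField, ← ENNReal.ofReal_mul hr.1.le, ← ofReal_norm]
  congr 1
  rw [← Real.sqrt_sq (norm_nonneg (deriv (profile φ) θ)), ← gradNormSq_vortexTypeMap hr.1 hθ hd,
    Real.sqrt_mul (sq_nonneg r), Real.sqrt_sq hr.1.le]

/-! ### The lower bound -/

theorem ae_of_ae_restrict_of_periodic {p : ℝ → Prop}
    (hp : ∀ θ (n : ℤ), p (θ + n • (2 * π)) → p θ)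
    (h : ∀ᵐ θ ∂volume.restrict (Set.Ioo (-π) π), p θ) : ∀ᵐ θ, p θ := by
  rw [restrict_Ioo_eq_restrict_Ioc, ae_restrict_iff' measurableSet_Ioc] at h
  have h2 : ∀ᵐ θ : ℝ, ∀ n : ℤ, θ + n • (2 * π) ∈ Set.Ioc (-π) π → p (θ + n • (2 * π)) :=
    ae_all_iff.2 fun n =>
      (measurePreserving_add_right volume (n • (2 * π))).quasiMeasurePreserving.ae h
  filter_upwards [h2] with θ hθ
  obtain ⟨n, hn, -⟩ := existsUnique_add_zsmul_mem_Ioc Real.two_pi_pos θ (-π)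
  rw [show -π + 2 * π = π by ring] at hn
  exact hp θ n (hθ n hn)

theorem ENNReal.add_liminf_le_of_forall_le {a b : ℕ → ℝ≥0∞} {A c : ℝ≥0∞}
    (ha : Tendsto a atTop (𝓝 A)) (h : ∀ k, a k + b k ≤ c) : A + liminf b atTop ≤ c := by
  rcases eq_or_ne c ⊤ with rfl | hc
  · exact le_top
  have hA : A ≤ c := le_of_tendsto' ha fun k => le_self_add.trans (h k)
  have h1 : liminf b atTop ≤ c - A := by
    rw [← (ENNReal.Tendsto.sub (tendsto_const_nhds (x := c)) ha (Or.inl hc)).liminf_eq]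
    exact liminf_le_liminf (Eventually.of_forall fun k => by
      have hk := h k
      rw [add_comm] at hk
      exact ENNReal.le_sub_of_add_le_right ((le_add_self.trans hk).trans_lt hc.lt_top).ne hk)
  calc A + liminf b atTop ≤ A + (c - A) := by gcongr
    _ = c := add_tsub_cancel_of_le hA

theorem measurable_fderiv_angularVec (v : Plane → Plane) :
    Measurable fun p : ℝ × ℝ => fderiv ℝ v (polarPoint p.1 p.2) (angularVec p.2) := by
  have h : ∀ y : Plane, Measurable fun p : ℝ × ℝ => fderiv ℝ v (polarPoint p.1 p.2) y := fun y =>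
    (measurable_fderiv_apply_const ℝ v y).comp continuous_polarPoint.measurable
  simp only [angularVec, fderiv_polar_apply]
  exact (((by fun_prop : Continuous fun p : ℝ × ℝ => -Real.sin p.2).measurable).smul (h _)).add
    (((by fun_prop : Continuous fun p : ℝ × ℝ => Real.cos p.2).measurable).smul (h _))

theorem ContDiffOn.differentiableAt_polarPoint {v : Plane → Plane} {l r : ℝ}
    (hv : ContDiffOn ℝ 1 v (Metric.ball 0 l)) (hr : r ∈ Set.Ioo 0 l) (θ : ℝ) :
    DifferentiableAt ℝ v (polarPoint r θ) :=
  (hv.differentiableOn one_ne_zero).differentiableAt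
    (Metric.isOpen_ball.mem_nhds (polarPoint_mem_ball ⟨by linarith [hr.1, hr.2], hr.2⟩))

theorem contDiff_polarPoint (r : ℝ) : ContDiff ℝ 1 (polarPoint r) := by
  rw [contDiff_euclidean]
  intro i
  fin_cases i
  · simpa [polarPoint] using! contDiff_const.mul Real.contDiff_cos
  · simpa [polarPoint] using! contDiff_const.mul Real.contDiff_sin

theorem ContDiffOn.contDiff_circle {v : Plane → Plane} {l r : ℝ}
    (hv : ContDiffOn ℝ 1 v (Metric.ball 0 l)) (hr : r ∈ Set.Ioo 0 l) :
    ContDiff ℝ 1 fun θ => v (polarPoint r θ) :=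
  contDiffOn_univ.1 (hv.comp (contDiff_polarPoint r).contDiffOn fun θ _ =>
    polarPoint_mem_ball ⟨by linarith [hr.1, hr.2], hr.2⟩)

/-- The subsequence realises the liminf of the lengths from above, and lower semicontinuity bounds
them from below. Hence lengths converge along it, which is what continuity of the winding integral
requires. -/
theorem exists_subseq_winding_tendsto {φ : UnitCircle → UnitCircle} {K : NNReal}
    (hφ : LipschitzWith K φ) {γ : ℕ → ℝ → Plane} (hγ : ∀ k, ContDiff ℝ 1 (γ k))
    (hγp : ∀ k, Function.Periodic (γ k) (2 * π))
    (hlim : ∀ᵐ θ ∂volume.restrict (Set.Ioo (-π) π),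
      Tendsto (fun k => γ k θ) atTop (𝓝 (profile φ θ)))
    (hlen : liminf (fun k => ∫⁻ θ in Set.Ioo (-π) π, ‖deriv (γ k) θ‖ₑ) atTop =
      ∫⁻ θ in Set.Ioo (-π) π, ‖deriv (profile φ) θ‖ₑ) :
    ∃ τ : ℕ → ℕ, StrictMono τ ∧
      Tendsto (fun k => ∫ θ in (-π)..π, cross (γ (τ k) θ) (deriv (γ (τ k)) θ)) atTop
        (𝓝 (∫ θ in (-π)..π, cross (profile φ θ) (deriv (profile φ) θ))) := by
  have hg := lipschitzWith_profile hφ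
  have hππ : -π ≤ π := by linarith [Real.pi_pos]
  have hlim' : ∀ᵐ θ, Tendsto (fun k => γ k θ) atTop (𝓝 (profile φ θ)) := by
    refine ae_of_ae_restrict_of_periodic (fun θ n h => ?_) hlim
    simpa only [(hγp _).zsmul n θ, (profile_periodic φ).zsmul n θ] using h
  set M := ∫ θ in (-π)..π, ‖deriv (profile φ) θ‖
  have hfreq : ∀ n : ℕ, ∃ᶠ k in atTop, ∫ θ in (-π)..π, ‖deriv (γ k) θ‖ < M + 1 / ((n : ℝ) + 1) := by
    intro n
    have hM : 0 ≤ M := intervalIntegral.integral_nonneg hππ fun _ _ => norm_nonneg _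
    have hn : (0 : ℝ) < 1 / ((n : ℝ) + 1) := by positivity
    rw [← ofReal_intervalIntegral_norm_deriv hππ (hg.intervalIntegrable_norm_deriv _ _)] at hlen
    have hlt := hlen.trans_lt ((ENNReal.ofReal_lt_ofReal_iff (by positivity)).2
      (lt_add_of_pos_right M hn))
    refine (frequently_lt_of_liminf_lt (by isBoundedDefault) hlt).mono fun k hk => ?_
    rw [← ofReal_intervalIntegral_norm_deriv hππ ((hγ k).intervalIntegrable_norm_deriv _ _)] at hk
    exact (ENNReal.ofReal_lt_ofReal_iff'.1 hk).1
  obtain ⟨τ, hτ, hτlt⟩ := extraction_forall_of_frequently hfreq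
  refine ⟨τ, hτ, ?_⟩
  have hlimτ : ∀ᵐ θ, Tendsto (fun k => γ (τ k) θ) atTop (𝓝 (profile φ θ)) :=
    hlim'.mono fun θ h => h.comp hτ.tendsto_atTop
  refine tendsto_integral_cross_deriv (fun k => hγ (τ k)) hg (fun k => hγp (τ k))
    (profile_periodic φ) hlimτ ?_
  rw [Metric.tendsto_nhds]
  intro ε hε
  have h0 : Tendsto (fun n : ℕ => 1 / ((n : ℝ) + 1)) atTop (𝓝 0) :=
    tendsto_one_div_add_atTop_nhds_zero_nat
  filter_upwards [eventually_length_ge hππ (fun k => hγ (τ k)) hg hlimτ (half_pos hε),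
    h0.eventually_lt_const hε] with k h1 h2
  rw [Real.dist_eq, abs_lt]
  constructor <;> linarith [hτlt k]

theorem exists_subseq_ae_tendsto {φ : UnitCircle → UnitCircle} (hφ : Continuous (profile φ))
    {l : ℝ} {v : ℕ → Plane → Plane} (hv : ∀ k, ContDiffOn ℝ 1 (v k) (Metric.ball 0 l))
    (h : Tendsto (fun k => ∫⁻ x in Metric.ball 0 l, ‖v k x - vortexTypeMap φ x‖ₑ) atTop (𝓝 0)) :
    ∃ σ : ℕ → ℕ, StrictMono σ ∧ ∀ᵐ r ∂volume.restrict (Set.Ioo 0 l),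
      ∀ᵐ θ ∂volume.restrict (Set.Ioo (-π) π),
        Tendsto (fun k => v (σ k) (polarPoint r θ)) atTop (𝓝 (profile φ θ)) := by
  have hmeas : TendstoInMeasure (volume.restrict (Metric.ball (0 : Plane) l)) v atTop
      (vortexTypeMap φ) := by
    refine tendstoInMeasure_of_tendsto_eLpNorm (p := 1) one_ne_zero (fun k =>
      (hv k).continuousOn.aestronglyMeasurable Metric.isOpen_ball.measurableSet)
      (measurable_vortexTypeMap hφ).aestronglyMeasurable ?_
    simpa only [eLpNorm_one_eq_lintegral_enorm] using! h
  obtain ⟨σ, hσ, hae⟩ := hmeas.exists_seq_tendsto_ae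
  refine ⟨σ, hσ, ?_⟩
  filter_upwards [ae_polarPoint_of_ae_ball hae, ae_restrict_mem measurableSet_Ioo] with r hr hr0
  simpa only [vortexTypeMap_polarPoint φ hr0.1] using hr

theorem lintegral_angular_le {v : Plane → Plane} (l : ℝ) :
    ∫⁻ r in Set.Ioo 0 l, ∫⁻ θ in Set.Ioo (-π) π,
        ‖r • fderiv ℝ v (polarPoint r θ) (angularVec θ)‖ₑ ≤
      ∫⁻ x in Metric.ball 0 l, ‖gradField v x‖ₑ := by
  rw [lintegral_ball_polar (measurable_gradField v).enorm]
  refine setLIntegral_mono' measurableSet_Ioo fun r hr => lintegral_mono fun θ => ?_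
  rw [enorm_smul, Real.enorm_eq_ofReal hr.1.le]
  gcongr
  rw [enorm_le_iff_norm_le, norm_gradField, gradNormSq_eq v _ θ]
  exact Real.le_sqrt_of_sq_le (le_add_of_nonneg_left (sq_nonneg _))

/-- Convergence of the total variations enters here: the tangential derivative is bounded by the
full gradient, and Fatou's lemma in the radius moves the liminf onto single circles. -/
theorem lintegral_liminf_angular_le {φ : UnitCircle → UnitCircle} {l : ℝ}
    {v : ℕ → Plane → Plane} (hv : ∀ k, ContDiffOn ℝ 1 (v k) (Metric.ball 0 l))
    (hst : StrictTendsto v (vortexTypeMap φ) (Metric.ball 0 l)) :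
    ∫⁻ r in Set.Ioo 0 l, liminf (fun k => ∫⁻ θ in Set.Ioo (-π) π,
        ‖r • fderiv ℝ (v k) (polarPoint r θ) (angularVec θ)‖ₑ) atTop ≤
      totalVariation (vortexTypeMap φ) (Metric.ball 0 l) := by
  have hm : ∀ k, Measurable fun r : ℝ => ∫⁻ θ in Set.Ioo (-π) π,
      ‖r • fderiv ℝ (v k) (polarPoint r θ) (angularVec θ)‖ₑ := fun k =>
    Measurable.lintegral_prod_right' (f := fun p : ℝ × ℝ =>
        ‖p.1 • fderiv ℝ (v k) (polarPoint p.1 p.2) (angularVec p.2)‖ₑ)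
      (measurable_fst.smul (measurable_fderiv_angularVec (v k))).enorm
  refine (lintegral_liminf_le hm).trans ?_
  rw [← hst.tendsto_variation.liminf_eq]
  refine liminf_le_liminf (Eventually.of_forall fun k => (lintegral_angular_le l).trans ?_)
  refine (isWeakGradient_of_contDiffOn Metric.isOpen_ball (hv k)).lintegral_le_totalVariation
    fun s hs => ?_
  have hc : ∀ i j, ContinuousOn (partialDeriv (v k) i j) (Metric.closedBall 0 s) := fun i j =>
    (continuousOn_partialDeriv Metric.isOpen_ball (hv k) i j).mono
      (Metric.closedBall_subset_ball hs)
  have : ContinuousOn (gradField (v k)) (Metric.closedBall 0 s) := by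
    unfold gradField
    exact (PiLp.continuous_toLp 2 _).comp_continuousOn (continuousOn_pi.2 fun i =>
      (PiLp.continuous_toLp 2 _).comp_continuousOn (continuousOn_pi.2 fun j => hc i j))
  exact (this.integrableOn_compact (isCompact_closedBall _ _)).mono_set
    Metric.ball_subset_closedBall

/-- On the inner disc only the Jacobian is kept, and Stokes' formula bounds it below by the winding.
On the annulus only `1` and the tangential derivative are kept, with the weight `ρ` absorbed under
the root. -/
theorem graphArea_ge {v : Plane → Plane} {l r : ℝ}
    (hv : ContDiffOn ℝ 1 v (Metric.ball 0 l)) (hr : r ∈ Set.Ioo 0 l) :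
    ENNReal.ofReal |(1 / 2) * ∫ θ in (-π)..π, cross (v (polarPoint r θ))
        (deriv (fun t => v (polarPoint r t)) θ)| +
      ∫⁻ ρ in Set.Ioo r l, ∫⁻ θ in Set.Ioo (-π) π,
        ENNReal.ofReal √(ρ ^ 2 + ‖ρ • fderiv ℝ v (polarPoint ρ θ) (angularVec θ)‖ ^ 2) ≤
      graphArea v (Metric.ball 0 l) := by
  have hm : Measurable fun x => ENNReal.ofReal √(1 + gradNormSq v x + jacobian v x ^ 2) :=
    (((measurable_gradNormSq v).const_add 1).add
      ((measurable_jacobian v).pow_const 2)).sqrt.ennreal_ofReal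
  have hS : MeasurableSet {x : Plane | ‖x‖ ∈ Set.Ioo r l} := measurable_norm measurableSet_Ioo
  have hdisj : Disjoint (Metric.ball (0 : Plane) r) {x : Plane | ‖x‖ ∈ Set.Ioo r l} := by
    rw [Set.disjoint_left]
    intro x hx hx'
    rw [mem_ball_zero_iff] at hx
    exact lt_asymm hx hx'.1
  have hsub : Metric.ball (0 : Plane) r ∪ {x : Plane | ‖x‖ ∈ Set.Ioo r l} ⊆ Metric.ball 0 l := by
    rintro x (hx | hx)
    · exact Metric.ball_subset_ball hr.2.le hx
    · exact mem_ball_zero_iff.2 hx.2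
  refine le_trans ?_ (lintegral_mono_set hsub)
  rw [lintegral_union hS hdisj]
  refine add_le_add ?_ ?_
  · have h1 := abs_winding_le_lintegral_jacobian hv hr
    rw [abs_mul, ENNReal.ofReal_mul (abs_nonneg _)]
    calc ENNReal.ofReal |1 / 2| * _ ≤ ENNReal.ofReal |1 / 2| *
          (2 * ∫⁻ x in Metric.ball 0 r, ‖jacobian v x‖ₑ) := by gcongr
      _ = ∫⁻ x in Metric.ball 0 r, ‖jacobian v x‖ₑ := by
          have : ENNReal.ofReal |1 / 2| * 2 = 1 := by
            rw [show (2 : ℝ≥0∞) = ENNReal.ofReal 2 by simp, ← ENNReal.ofReal_mul (abs_nonneg _)]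
            norm_num [abs_of_pos]
          rw [← mul_assoc, this, one_mul]
      _ ≤ _ := by
          refine lintegral_mono fun x => ?_
          rw [← ofReal_norm, Real.norm_eq_abs]
          refine ENNReal.ofReal_le_ofReal (Real.abs_le_sqrt ?_)
          linarith [gradNormSq_nonneg v x]
  · rw [setLIntegral_polar hm measurableSet_Ioo
      (fun ρ hρ => hr.1.trans hρ.1)]
    refine setLIntegral_mono' measurableSet_Ioo fun ρ hρ => lintegral_mono fun θ => ?_
    have hρ0 : 0 < ρ := hr.1.trans hρ.1
    rw [← ENNReal.ofReal_mul hρ0.le]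
    refine ENNReal.ofReal_le_ofReal ?_
    rw [add_assoc, mul_sqrt_eq hρ0.le]
    refine Real.sqrt_le_sqrt ?_
    rw [norm_smul, mul_pow, Real.norm_eq_abs, sq_abs, gradNormSq_eq v _ θ]
    have : 0 ≤ ρ ^ 2 * (‖fderiv ℝ v (polarPoint ρ θ) (radialVec θ)‖ ^ 2
      + jacobian v (polarPoint ρ θ) ^ 2) := by positivity
    nlinarith

theorem lower_bound_annulus {φ : UnitCircle → UnitCircle} {K : NNReal} (hφ : LipschitzWith K φ)
    {l : ℝ} {v : ℕ → Plane → Plane} (hv : ∀ k, ContDiffOn ℝ 1 (v k) (Metric.ball 0 l))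
    (hlim : ∀ᵐ r ∂volume.restrict (Set.Ioo 0 l), ∀ᵐ θ ∂volume.restrict (Set.Ioo (-π) π),
        Tendsto (fun k => v k (polarPoint r θ)) atTop (𝓝 (profile φ θ)))
    {r : ℝ} (hr : 0 < r) :
    ∫⁻ ρ in Set.Ioo r l, ∫⁻ θ in Set.Ioo (-π) π,
        ENNReal.ofReal √(ρ ^ 2 + ‖deriv (profile φ) θ‖ ^ 2) ≤
      liminf (fun k => ∫⁻ ρ in Set.Ioo r l, ∫⁻ θ in Set.Ioo (-π) π, ENNReal.ofReal
        √(ρ ^ 2 + ‖ρ • fderiv ℝ (v k) (polarPoint ρ θ) (angularVec θ)‖ ^ 2)) atTop := by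
  have hg := lipschitzWith_profile hφ
  have hm : ∀ k, Measurable fun ρ : ℝ => ∫⁻ θ in Set.Ioo (-π) π, ENNReal.ofReal
        √(ρ ^ 2 + ‖ρ • fderiv ℝ (v k) (polarPoint ρ θ) (angularVec θ)‖ ^ 2) := fun k =>
    Measurable.lintegral_prod_right' (f := fun p : ℝ × ℝ => ENNReal.ofReal
        √(p.1 ^ 2 + ‖p.1 • fderiv ℝ (v k) (polarPoint p.1 p.2) (angularVec p.2)‖ ^ 2))
      ((measurable_fst.pow_const 2).add ((measurable_fst.smul
        (measurable_fderiv_angularVec (v k))).norm.pow_const 2)).sqrt.ennreal_ofReal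
  refine le_trans ?_ (lintegral_liminf_le hm)
  refine lintegral_mono_ae ?_
  have hsub : Set.Ioo r l ⊆ Set.Ioo 0 l := Set.Ioo_subset_Ioo_left hr.le
  filter_upwards [ae_restrict_of_ae_restrict_of_subset hsub hlim,
    ae_restrict_mem measurableSet_Ioo] with ρ hρ hρ0
  have := lintegral_sqrt_deriv_le_liminf ρ (a := -π) (b := π)
    (γ := fun k θ => v k (polarPoint ρ θ)) (g := profile φ)
    (fun k => (hv k).contDiff_circle (hsub hρ0)) hg.continuous hg.ae_differentiableAt
    ((ae_restrict_iff' measurableSet_Ioo).1 hρ)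
  simpa only [((hv _).differentiableAt_polarPoint (hsub hρ0) _).hasDerivAt_angle.deriv] using this

/-- The lower bound along a strictly convergent sequence of smooth maps of bounded area. -/
theorem lower_bound {φ : UnitCircle → UnitCircle} {K : NNReal} (hφ : LipschitzWith K φ)
    {l : ℝ} (hl : 0 < l) {v : ℕ → Plane → Plane}
    (hv : ∀ k, ContDiffOn ℝ 1 (v k) (Metric.ball 0 l))
    (hst : StrictTendsto v (vortexTypeMap φ) (Metric.ball 0 l))
    (htv : totalVariation (vortexTypeMap φ) (Metric.ball 0 l) ≤
      ∫⁻ x in Metric.ball 0 l, ‖gradField (vortexTypeMap φ) x‖ₑ)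
    {c : ℝ≥0∞} (hc : ∀ k, graphArea (v k) (Metric.ball 0 l) ≤ c) :
    ENNReal.ofReal |(1 / 2) * ∫ θ in (-π)..π, cross (profile φ θ) (deriv (profile φ) θ)| +
      ∫⁻ x in Metric.ball 0 l, ENNReal.ofReal √(1 + gradNormSq (vortexTypeMap φ) x) ≤ c := by
  have hg := lipschitzWith_profile hφ
  obtain ⟨σ, hσ, hlim⟩ := exists_subseq_ae_tendsto hg.continuous hv hst.tendsto_L1
  set u : ℕ → Plane → Plane := fun k => v (σ k)
  have hu : ∀ k, ContDiffOn ℝ 1 (u k) (Metric.ball 0 l) := fun k => hv _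
  have hstu : StrictTendsto u (vortexTypeMap φ) (Metric.ball 0 l) :=
    ⟨fun k => hst.memBV_seq _, hst.memBV_limit, hst.tendsto_L1.comp hσ.tendsto_atTop,
      hst.tendsto_variation.comp hσ.tendsto_atTop⟩
  set M : ℝ≥0∞ := ∫⁻ θ in Set.Ioo (-π) π, ‖deriv (profile φ) θ‖ₑ
  have hMtop : M < ⊤ := by
    simp only [M]
    rw [← ofReal_intervalIntegral_norm_deriv (by linarith [Real.pi_pos])
      (hg.intervalIntegrable_norm_deriv _ _)]
    exact ENNReal.ofReal_lt_top
  -- On almost every circle the liminf is at least `M`, while its integral over `(0, l)` is at most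
  -- the total variation, hence at most `l M`. As `M` is finite, equality holds almost everywhere.
  have hlen : ∀ᵐ r ∂volume.restrict (Set.Ioo 0 l),
      liminf (fun k => ∫⁻ θ in Set.Ioo (-π) π,
        ‖r • fderiv ℝ (u k) (polarPoint r θ) (angularVec θ)‖ₑ) atTop = M := by
    have hge : ∀ᵐ r ∂volume.restrict (Set.Ioo 0 l), M ≤ liminf (fun k => ∫⁻ θ in Set.Ioo (-π) π,
        ‖r • fderiv ℝ (u k) (polarPoint r θ) (angularVec θ)‖ₑ) atTop := by
      filter_upwards [hlim, ae_restrict_mem measurableSet_Ioo] with r hr hr0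
      have := lintegral_enorm_deriv_le_liminf (a := -π) (b := π)
        (γ := fun k θ => u k (polarPoint r θ)) (g := profile φ)
        (fun k => (hu k).contDiff_circle hr0) hg.continuous hg.ae_differentiableAt
        ((ae_restrict_iff' measurableSet_Ioo).1 hr)
      simpa only [((hu _).differentiableAt_polarPoint hr0 _).hasDerivAt_angle.deriv] using this
    have hle := lintegral_liminf_angular_le hu hstu
    rw [lintegral_grad_vortexTypeMap hφ] at htv
    have hm : Measurable fun r : ℝ => liminf (fun k => ∫⁻ θ in Set.Ioo (-π) π,
        ‖r • fderiv ℝ (u k) (polarPoint r θ) (angularVec θ)‖ₑ) atTop :=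
      Measurable.liminf fun k =>
        Measurable.lintegral_prod_right' (f := fun p : ℝ × ℝ =>
          ‖p.1 • fderiv ℝ (u k) (polarPoint p.1 p.2) (angularVec p.2)‖ₑ)
          (measurable_fst.smul (measurable_fderiv_angularVec (u k))).enorm
    have := ae_eq_of_ae_le_of_lintegral_le hge
      (by rw [lintegral_const]; exact (ENNReal.mul_lt_top hMtop (by simp)).ne)
      hm.aemeasurable (hle.trans htv)
    filter_upwards [this] with r hr using hr.symm
  set W := ENNReal.ofReal
    |(1 / 2) * ∫ θ in (-π)..π, cross (profile φ θ) (deriv (profile φ) θ)|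
  set H : ℝ → ℝ≥0∞ := fun ρ => ∫⁻ θ in Set.Ioo (-π) π,
    ENNReal.ofReal √(ρ ^ 2 + ‖deriv (profile φ) θ‖ ^ 2)
  -- The subsequence `τ` depends on `r`. This is harmless because the bound `c` holds along the
  -- whole sequence and the conclusion no longer mentions `τ`.
  have hgood : ∀ᵐ r ∂volume.restrict (Set.Ioo 0 l), W + ∫⁻ ρ in Set.Ioo r l, H ρ ≤ c := by
    filter_upwards [hlim, hlen, ae_restrict_mem measurableSet_Ioo] with r hr1 hr2 hr0
    obtain ⟨τ, hτ, hτlim⟩ := exists_subseq_winding_tendsto hφ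
      (γ := fun k θ => u k (polarPoint r θ)) (fun k => (hu k).contDiff_circle hr0)
      (fun k θ => by simp only [polarPoint_periodic r θ]) hr1
      (by simpa only [((hu _).differentiableAt_polarPoint hr0 _).hasDerivAt_angle.deriv] using hr2)
    have hW := ENNReal.tendsto_ofReal ((hτlim.const_mul (1 / 2)).abs)
    have hlimτ : ∀ᵐ r ∂volume.restrict (Set.Ioo 0 l), ∀ᵐ θ ∂volume.restrict (Set.Ioo (-π) π),
        Tendsto (fun k => u (τ k) (polarPoint r θ)) atTop (𝓝 (profile φ θ)) :=
      hlim.mono fun r h => h.mono fun θ h => h.comp hτ.tendsto_atTop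
    refine le_trans (add_le_add_right (lower_bound_annulus hφ (fun k => hu (τ k)) hlimτ hr0.1) W) ?_
    exact ENNReal.add_liminf_le_of_forall_le hW fun k =>
      (graphArea_ge (hu (τ k)) hr0).trans (hc _)
  rw [lintegral_area_vortexTypeMap hφ]
  -- Almost every radius is admissible, so there is one below `l / (n + 1)`; shrinking the annulus
  -- only decreases the integral.
  have hall : ∀ n : ℕ, W + ∫⁻ ρ in Set.Ioo (l / ((n : ℝ) + 1)) l, H ρ ≤ c := by
    intro n
    have hn : 0 < l / ((n : ℝ) + 1) := by positivity
    have hsub : Set.Ioo 0 (l / ((n : ℝ) + 1)) ⊆ Set.Ioo 0 l :=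
      Set.Ioo_subset_Ioo_right (div_le_self hl.le (by linarith [n.cast_nonneg (α := ℝ)]))
    have hne : (ae (volume.restrict (Set.Ioo 0 (l / ((n : ℝ) + 1))))).NeBot := by
      rw [ae_neBot, Ne, Measure.restrict_eq_zero, Real.volume_Ioo, ENNReal.ofReal_eq_zero]
      linarith
    obtain ⟨r, hr, hr0⟩ := ((ae_restrict_of_ae_restrict_of_subset hsub hgood).and
      (ae_restrict_mem measurableSet_Ioo)).exists
    refine le_trans (add_le_add_right (lintegral_mono_set ?_) W) hr
    exact Set.Ioo_subset_Ioo_left hr0.2.le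
  have hunion : Set.Ioo 0 l = ⋃ n : ℕ, Set.Ioo (l / ((n : ℝ) + 1)) l := by
    ext ρ
    simp only [Set.mem_Ioo, Set.mem_iUnion]
    constructor
    · rintro ⟨h0, h1⟩
      obtain ⟨n, hn⟩ := exists_nat_one_div_lt (div_pos h0 hl)
      refine ⟨n, ?_, h1⟩
      rw [lt_div_iff₀ hl] at hn
      calc l / ((n : ℝ) + 1) = 1 / ((n : ℝ) + 1) * l := by ring
        _ < ρ := hn
    · rintro ⟨n, h0, h1⟩
      exact ⟨lt_trans (by positivity) h0, h1⟩
  rw [hunion, setLIntegral_iUnion_of_directed, ENNReal.add_iSup]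
  · exact iSup_le hall
  · apply Monotone.directed_le
    intro m n hmn
    apply Set.Ioo_subset_Ioo_left
    gcongr

/-! ### Degree and angular lift -/

theorem Function.Periodic.deriv_plane {f : ℝ → Plane} {T : ℝ} (hf : Function.Periodic f T) :
    Function.Periodic (deriv f) T := fun θ => by
  rw [← deriv_comp_add_const, show (fun x => f (x + T)) = f from funext hf]

theorem cross_profile_periodic (φ : UnitCircle → UnitCircle) :
    Function.Periodic (fun θ => cross (profile φ θ) (deriv (profile φ) θ)) (2 * π) := fun θ => by
  simp only [profile_periodic φ θ, (profile_periodic φ).deriv_plane θ]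

theorem two_pi_mul_degree {φ : UnitCircle → UnitCircle} {K : NNReal} (h : LipschitzWith K φ) :
    2 * π * degree φ = ∫ θ in (0 : ℝ)..(2 * π), cross (profile φ θ) (deriv (profile φ) θ) := by
  rw [degree, ← mul_assoc, mul_one_div_cancel Real.two_pi_pos.ne', one_mul]
  refine intervalIntegral.integral_congr_ae ?_
  filter_upwards [(lipschitzWith_profile h).ae_differentiableAt] with θ hθ _
  have h0 := (hθ.hasDerivAt.apply_plane 0).deriv
  have h1 := (hθ.hasDerivAt.apply_plane 1).deriv
  rw [cross, ← h0, ← h1]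
  rfl

theorem integral_cross_profile {φ : UnitCircle → UnitCircle} {K : NNReal} (h : LipschitzWith K φ)
    (t : ℝ) : ∫ θ in t..(t + 2 * π), cross (profile φ θ) (deriv (profile φ) θ)
      = 2 * π * degree φ := by
  rw [two_pi_mul_degree h, (cross_profile_periodic φ).intervalIntegral_add_eq t 0, zero_add]

theorem winding_eq_degree {φ : UnitCircle → UnitCircle} {K : NNReal} (h : LipschitzWith K φ) :
    (1 / 2) * ∫ θ in (-π)..π, cross (profile φ θ) (deriv (profile φ) θ) = π * degree φ := by
  have := integral_cross_profile h (-π)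
  rw [show -π + 2 * π = π by ring] at this
  rw [this]; ring

theorem exists_radialVec_eq {p : Plane} (hp : ‖p‖ = 1) : ∃ t, p = radialVec t := by
  refine ⟨planeArg p, ?_⟩
  have := polarPoint_norm_planeArg p
  rw [hp, polarPoint_eq_smul, one_smul] at this
  exact this.symm

/-- Differentiating `|φ|² = 1` shows that `φ'` is orthogonal to `φ`, so it is the rotated vector
times the scalar `cross φ φ'`. That scalar is the angular speed to be integrated for the lift. -/
theorem deriv_profile_apply {φ : UnitCircle → UnitCircle} {θ : ℝ}
    (h : DifferentiableAt ℝ (profile φ) θ) :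
    deriv (profile φ) θ 0 =
        -(cross (profile φ θ) (deriv (profile φ) θ)) * profile φ θ 1 ∧
      deriv (profile φ) θ 1 =
        cross (profile φ θ) (deriv (profile φ) θ) * profile φ θ 0 := by
  have hn : ∀ t, profile φ t 0 ^ 2 + profile φ t 1 ^ 2 = 1 := by
    intro t
    have := norm_profile φ t
    rw [← sq_eq_sq₀ (norm_nonneg _) zero_le_one, EuclideanSpace.norm_sq_eq] at this
    simpa [Fin.sum_univ_two] using this
  have hd := ((h.hasDerivAt.apply_plane 0).pow 2).add ((h.hasDerivAt.apply_plane 1).pow 2)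
  have hc : ((fun t => profile φ t 0) ^ 2 + (fun t => profile φ t 1) ^ 2) = fun _ => (1 : ℝ) :=
    funext hn
  rw [hc] at hd
  have h0 := hd.unique (hasDerivAt_const θ 1)
  simp only [Nat.cast_ofNat, Nat.add_one_sub_one, pow_one] at h0
  have h1 := hn θ
  simp only [cross]
  generalize deriv (profile φ) θ 0 = a' at *
  generalize deriv (profile φ) θ 1 = b' at *
  generalize profile φ θ 0 = a at *
  generalize profile φ θ 1 = b at *
  constructor
  · linear_combination (-a') * h1 + (a / 2) * h0
  · linear_combination (-b') * h1 + (b / 2) * h0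

/-- A Lipschitz circle map lifts to a Lipschitz angle function. -/
theorem exists_angle_lift {φ : UnitCircle → UnitCircle} {K : NNReal} (h : LipschitzWith K φ) :
    ∃ Φ : ℝ → ℝ, LipschitzWith K Φ ∧ (∀ θ, profile φ θ = radialVec (Φ θ)) ∧
      ∀ θ, Φ (θ + 2 * π) = Φ θ + 2 * π * degree φ := by
  have hg := lipschitzWith_profile h
  obtain ⟨t₀, ht₀⟩ := exists_radialVec_eq (norm_profile φ 0)
  set q : ℝ → ℝ := fun θ => cross (profile φ θ) (deriv (profile φ) θ)
  have hqi : ∀ a b, IntervalIntegrable q volume a b := intervalIntegrable_cross_deriv hg.continuous hg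
  have hqb : ∀ θ, ‖q θ‖ ≤ K := fun θ => by
    refine (abs_cross_le _ _).trans ?_
    rw [norm_profile, one_mul]
    exact norm_deriv_le_of_lipschitz hg
  set Φ : ℝ → ℝ := fun θ => t₀ + ∫ s in (0 : ℝ)..θ, q s
  have hΦsub : ∀ s t, Φ t - Φ s = ∫ x in s..t, q x := fun s t => by
    simp only [Φ, add_sub_add_left_eq_sub]
    exact intervalIntegral.integral_interval_sub_left (hqi _ _) (hqi _ _)
  have hΦL : LipschitzWith K Φ := by
    refine LipschitzWith.of_dist_le_mul fun s t => ?_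
    rw [Real.dist_eq, Real.dist_eq, hΦsub]
    exact intervalIntegral.norm_integral_le_of_norm_le_const fun x _ => hqb x
  have hΦR : LipschitzWith K fun θ => radialVec (Φ θ) := by
    have h1 : LipschitzWith 1 radialVec := fun x y => lipschitzWith_circlePoint x y
    simpa using! h1.comp hΦL
  refine ⟨Φ, hΦL, fun θ => ?_, fun θ => ?_⟩
  -- `p` is the scalar product of `φ` with `exp(iΦ)`. It is absolutely continuous with derivative
  -- zero almost everywhere, and `t₀` makes it `1` at the start. Unit vectors with scalar product
  -- `1` coincide.
  · let p : ℝ → ℝ := fun t => profile φ t 0 * radialVec (Φ t) 0 + profile φ t 1 * radialVec (Φ t) 1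
    have hpac : AbsolutelyContinuousOnInterval p 0 θ :=
      ((hg.absolutelyContinuous_apply 0 _ _).fun_mul (hΦR.absolutelyContinuous_apply 0 _ _)).fun_add
        ((hg.absolutelyContinuous_apply 1 _ _).fun_mul (hΦR.absolutelyContinuous_apply 1 _ _))
    obtain ⟨C, hC⟩ := hpac.const_of_ae_hasDerivAt_zero (by
      filter_upwards [hg.ae_differentiableAt, (hqi 0 θ).ae_hasDerivAt_integral] with t ht1 ht2 htm
      have hΦd : HasDerivAt Φ (q t) t := (ht2 htm 0 (by simp)).const_add t₀
      have hR : HasDerivAt (fun s => radialVec (Φ s)) (q t • angularVec (Φ t)) t :=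
        (hasDerivAt_radialVec (Φ t)).scomp t hΦd
      have := ((ht1.hasDerivAt.apply_plane 0).mul (hR.apply_plane 0)).add
        ((ht1.hasDerivAt.apply_plane 1).mul (hR.apply_plane 1))
      refine this.congr_deriv ?_
      rw [(deriv_profile_apply ht1).1, (deriv_profile_apply ht1).2]
      simp only [q, radialVec, angularVec, PiLp.smul_apply, smul_eq_mul, PiLp.toLp_apply,
        Matrix.cons_val_zero, Matrix.cons_val_one]
      ring)
    have hp0 : p 0 = 1 := by
      simp only [p, Φ, intervalIntegral.integral_same, add_zero, ht₀]
      simp only [radialVec, PiLp.toLp_apply, Matrix.cons_val_zero, Matrix.cons_val_one]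
      linear_combination Real.sin_sq_add_cos_sq t₀
    have hpθ : p θ = 1 := by
      rw [hC θ (by simp), ← hC 0 (by simp), hp0]
    have h1 : ‖profile φ θ - radialVec (Φ θ)‖ ^ 2 = 0 := by
      rw [norm_sub_sq_real, norm_profile, norm_radialVec]
      have : inner ℝ (profile φ θ) (radialVec (Φ θ)) = p θ := by
        simp [PiLp.inner_apply, p, Fin.sum_univ_two, mul_comm]
      rw [this, hpθ]; norm_num
    rw [← sub_eq_zero, ← norm_eq_zero]
    exact pow_eq_zero_iff two_ne_zero |>.1 h1
  · rw [← sub_eq_iff_eq_add', hΦsub]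
    exact integral_cross_profile h θ

/-- The lift gains `2π deg φ` over one turn while `exp(iΦ)` returns to its value. Integrality is
what makes the phase `d θ` define a single-valued map of the plane. -/
theorem exists_int_degree {φ : UnitCircle → UnitCircle} {K : NNReal} (h : LipschitzWith K φ) :
    ∃ n : ℤ, degree φ = n := by
  obtain ⟨Φ, -, h1, h2⟩ := exists_angle_lift h
  have hp : radialVec (Φ 0 + 2 * π * degree φ) = radialVec (Φ 0) := by
    rw [← h2, ← h1, ← h1]
    exact profile_periodic φ 0
  have hc := congrArg (fun p : Plane => p 0) hp
  have hs := congrArg (fun p : Plane => p 1) hp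
  simp only [radialVec, PiLp.toLp_apply, Matrix.cons_val_zero, Matrix.cons_val_one] at hc hs
  have : Real.cos (2 * π * degree φ) = 1 := by
    rw [show 2 * π * degree φ = (Φ 0 + 2 * π * degree φ) - Φ 0 by ring, Real.cos_sub, hc, hs]
    linear_combination Real.sin_sq_add_cos_sq (Φ 0)
  obtain ⟨n, hn⟩ := (Real.cos_eq_one_iff _).1 this
  refine ⟨n, ?_⟩
  have := Real.two_pi_pos
  field_simp at hn
  linarith

/-! ### Maps given by polar expressions -/

/-- The planar map with given expression in polar coordinates. -/
def polarMap (f : ℝ → ℝ → Plane) (x : Plane) : Plane := f ‖x‖ (planeArg x)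

theorem polarMap_polarPoint {f : ℝ → ℝ → Plane} (hf : ∀ r, Function.Periodic (f r) (2 * π))
    {r : ℝ} (hr : 0 < r) (θ : ℝ) : polarMap f (polarPoint r θ) = f r θ := by
  obtain ⟨n, hn, -⟩ := existsUnique_add_zsmul_mem_Ioc Real.two_pi_pos θ (-π)
  rw [show -π + 2 * π = π by ring] at hn
  rw [polarMap, norm_polarPoint, abs_of_pos hr, ← (polarPoint_periodic r).zsmul n θ,
    planeArg_polarPoint hr hn, (hf r).zsmul n θ]

theorem contDiffAt_planeArg {x : Plane} (hx : planeToComplex x ∈ Complex.slitPlane) :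
    ContDiffAt ℝ 1 planeArg x := by
  have h1 : planeArg = fun x => (Complex.log (planeToComplex x)).im := by
    ext x; rw [Complex.log_im]; rfl
  rw [h1]
  have h2 : ContDiffAt ℝ 1 Complex.log (planeToComplex x) :=
    (Complex.contDiffAt_log hx).restrict_scalars ℝ
  exact Complex.imCLM.contDiff.contDiffAt.comp x
    (h2.comp x planeToComplex.toContinuousLinearEquiv.contDiff.contDiffAt)

theorem polarPoint_add_pi (r θ : ℝ) : polarPoint r (θ + π) = - polarPoint r θ := by
  ext i; fin_cases i <;> simp [polarPoint]

/-- On the cut, where `planeArg` jumps, periodicity allows the angle to be replaced by `planeArg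
(-y) + π`, which is smooth there. -/
theorem contDiffAt_polarMap {f : ℝ → ℝ → Plane} (hf : ∀ r, Function.Periodic (f r) (2 * π))
    (hfc : ContDiff ℝ 1 fun p : ℝ × ℝ => f p.1 p.2) {x : Plane} (hx : x ≠ 0) :
    ContDiffAt ℝ 1 (polarMap f) x := by
  have hn : ContDiffAt ℝ 1 (fun y : Plane => ‖y‖) x := contDiffAt_norm ℝ hx
  by_cases hs : planeToComplex x ∈ Complex.slitPlane
  · exact hfc.contDiffAt.comp x (hn.prodMk (contDiffAt_planeArg hs))
  · have hs' : planeToComplex (-x) ∈ Complex.slitPlane := by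
      rw [map_neg]
      rw [Complex.mem_slitPlane_iff] at hs ⊢
      push Not at hs
      left
      have h0 : planeToComplex x ≠ 0 := fun h => hx (by simpa using h)
      have : (planeToComplex x).re ≠ 0 := fun h => h0 (Complex.ext h hs.2)
      rw [Complex.neg_re, neg_pos]
      exact lt_of_le_of_ne hs.1 this
    have harg : ContDiffAt ℝ 1 (fun y : Plane => planeArg (-y)) x :=
      ContDiffAt.comp x (g := planeArg) (contDiffAt_planeArg hs') contDiff_neg.contDiffAt
    have h2 : ContDiffAt ℝ 1 (fun y : Plane => f ‖y‖ (planeArg (-y) + π)) x :=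
      hfc.contDiffAt.comp x (hn.prodMk (harg.add contDiffAt_const))
    refine h2.congr_of_eventuallyEq ?_
    filter_upwards [isOpen_ne.mem_nhds hx] with y hy
    rw [← polarMap_polarPoint hf (norm_pos_iff.2 hy), polarPoint_add_pi]
    congr 1
    have := polarPoint_norm_planeArg (-y)
    rw [norm_neg] at this
    rw [this, neg_neg]

theorem fderiv_polarMap {f : ℝ → ℝ → Plane} (hf : ∀ r, Function.Periodic (f r) (2 * π))
    {r θ : ℝ} (hr : 0 < r) {A B : Plane} (hA : HasDerivAt (fun s => f s θ) A r)
    (hB : HasDerivAt (f r) B θ) (hd : DifferentiableAt ℝ (polarMap f) (polarPoint r θ)) :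
    fderiv ℝ (polarMap f) (polarPoint r θ) (radialVec θ) = A ∧
      fderiv ℝ (polarMap f) (polarPoint r θ) (angularVec θ) = r⁻¹ • B := by
  constructor
  · refine hd.hasDerivAt_radius.unique (hA.congr_of_eventuallyEq ?_)
    filter_upwards [isOpen_Ioi.mem_nhds hr] with s hs using polarMap_polarPoint hf hs θ
  · have := hd.hasDerivAt_angle.unique
      (hB.congr_of_eventuallyEq (Eventually.of_forall fun t => polarMap_polarPoint hf hr t))
    rw [← this, smul_smul, inv_mul_cancel₀ hr.ne', one_smul]

/-! ### Construction of the recovery maps -/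

/-- The Steklov average of a function over an interval of length `1 / m`. -/
def steklov (Φ : ℝ → ℝ) (m θ : ℝ) : ℝ := m * ∫ s in θ..(θ + 1 / m), Φ s

/-- The derivative is a difference quotient of `Φ`. For Lipschitz `Φ` it is thus bounded by the
Lipschitz constant and converges, as `m → ∞`, wherever `Φ` is differentiable. -/
theorem hasDerivAt_steklov {Φ : ℝ → ℝ} (hΦ : Continuous Φ) (m θ : ℝ) :
    HasDerivAt (steklov Φ m) (m * (Φ (θ + 1 / m) - Φ θ)) θ := by
  have h : ∀ t, HasDerivAt (fun u => ∫ s in (0:ℝ)..u, Φ s) (Φ t) t := fun t =>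
    intervalIntegral.integral_hasDerivAt_right (hΦ.intervalIntegrable _ _)
      hΦ.aestronglyMeasurable.stronglyMeasurableAtFilter hΦ.continuousAt
  have h2 : HasDerivAt (fun u => ∫ s in (0:ℝ)..(u + 1 / m), Φ s) (Φ (θ + 1 / m)) θ :=
    (h (θ + 1 / m)).comp_add_const θ (1 / m)
  refine ((h2.sub (h θ)).const_mul m).congr_of_eventuallyEq (Eventually.of_forall fun t => ?_)
  simp only [steklov, Pi.sub_apply]
  rw [intervalIntegral.integral_interval_sub_left (hΦ.intervalIntegrable _ _)
    (hΦ.intervalIntegrable _ _)]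

theorem contDiff_steklov {Φ : ℝ → ℝ} (hΦ : Continuous Φ) (m : ℝ) : ContDiff ℝ 1 (steklov Φ m) := by
  rw [contDiff_one_iff_deriv]
  refine ⟨fun θ => (hasDerivAt_steklov hΦ m θ).differentiableAt, ?_⟩
  rw [funext fun θ => (hasDerivAt_steklov hΦ m θ).deriv]
  fun_prop

theorem abs_deriv_steklov_le {Φ : ℝ → ℝ} {K : NNReal} (hΦ : LipschitzWith K Φ) {m : ℝ}
    (hm : 0 < m) (θ : ℝ) : |m * (Φ (θ + 1 / m) - Φ θ)| ≤ K := by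
  rw [abs_mul, abs_of_pos hm]
  have := hΦ.dist_le_mul (θ + 1 / m) θ
  rw [Real.dist_eq, Real.dist_eq, add_sub_cancel_left,
    abs_of_pos (by positivity : 0 < 1 / m)] at this
  calc m * |Φ (θ + 1 / m) - Φ θ| ≤ m * (K * (1 / m)) := by gcongr
    _ = K := by field_simp

theorem abs_steklov_sub_le {Φ : ℝ → ℝ} {K : NNReal} (hΦ : LipschitzWith K Φ) {m : ℝ}
    (hm : 0 < m) (θ : ℝ) : |steklov Φ m θ - Φ θ| ≤ K / m := by
  have h1 : steklov Φ m θ - Φ θ = m * ∫ s in θ..(θ + 1 / m), (Φ s - Φ θ) := by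
    rw [intervalIntegral.integral_sub (hΦ.continuous.intervalIntegrable _ _)
      intervalIntegrable_const, intervalIntegral.integral_const, steklov, smul_eq_mul]
    field_simp
    ring
  have hm' : 0 < 1 / m := by positivity
  rw [h1, abs_mul, abs_of_pos hm]
  have h2 : ‖∫ s in θ..(θ + 1 / m), (Φ s - Φ θ)‖ ≤ (K * (1 / m)) * |θ + 1 / m - θ| := by
    refine intervalIntegral.norm_integral_le_of_norm_le_const fun s hs => ?_
    rw [Set.uIoc_of_le (by linarith)] at hs
    refine (hΦ.dist_le_mul s θ).trans ?_
    gcongr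
    rw [Real.dist_eq, abs_of_pos (by linarith [hs.1])]
    linarith [hs.2]
  rw [add_sub_cancel_left, abs_of_pos hm', Real.norm_eq_abs] at h2
  calc m * _ ≤ m * ((K * (1 / m)) * (1 / m)) := by gcongr
    _ = K / m := by field_simp

theorem steklov_add {Φ : ℝ → ℝ} (hΦ : Continuous Φ) {T c : ℝ} (h : ∀ θ, Φ (θ + T) = Φ θ + c)
    {m : ℝ} (hm : m ≠ 0) (θ : ℝ) : steklov Φ m (θ + T) = steklov Φ m θ + c := by
  have h1 : ∫ s in (θ + T)..(θ + T + 1 / m), Φ s = ∫ s in θ..(θ + 1 / m), Φ (s + T) := by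
    rw [intervalIntegral.integral_comp_add_right, add_right_comm]
  rw [steklov, steklov, h1]
  simp_rw [h]
  rw [intervalIntegral.integral_add (hΦ.intervalIntegrable _ _) intervalIntegrable_const,
    intervalIntegral.integral_const, add_sub_cancel_left, smul_eq_mul]
  field_simp

/-- A smooth step from `0` to `1` on the interval `[1/4, 1/2]`. -/
def innerStep (t : ℝ) : ℝ := Real.smoothTransition (4 * t - 1)

/-- A smooth step from `0` to `1` on the interval `[1/2, 1]`. -/
def outerStep (t : ℝ) : ℝ := Real.smoothTransition (2 * t - 1)

theorem contDiff_innerStep : ContDiff ℝ 1 innerStep :=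
  Real.smoothTransition.contDiff.comp (by fun_prop)

theorem contDiff_outerStep : ContDiff ℝ 1 outerStep :=
  Real.smoothTransition.contDiff.comp (by fun_prop)

theorem innerStep_of_le {t : ℝ} (h : t ≤ 1 / 4) : innerStep t = 0 :=
  Real.smoothTransition.zero_of_nonpos (by linarith)

theorem innerStep_of_ge {t : ℝ} (h : 1 / 2 ≤ t) : innerStep t = 1 :=
  Real.smoothTransition.one_of_one_le (by linarith)

theorem outerStep_of_le {t : ℝ} (h : t ≤ 1 / 2) : outerStep t = 0 :=
  Real.smoothTransition.zero_of_nonpos (by linarith)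

theorem outerStep_of_ge {t : ℝ} (h : 1 ≤ t) : outerStep t = 1 :=
  Real.smoothTransition.one_of_one_le (by linarith)

theorem innerStep_nonneg (t : ℝ) : 0 ≤ innerStep t := Real.smoothTransition.nonneg _

theorem innerStep_le_one (t : ℝ) : innerStep t ≤ 1 := Real.smoothTransition.le_one _

theorem outerStep_nonneg (t : ℝ) : 0 ≤ outerStep t := Real.smoothTransition.nonneg _

theorem outerStep_le_one (t : ℝ) : outerStep t ≤ 1 := Real.smoothTransition.le_one _

theorem monotone_innerStep : Monotone innerStep := fun s t h => by
  unfold innerStep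
  exact Real.smoothTransition.monotone (by linarith)

theorem deriv_eq_zero_of_const_near {f : ℝ → ℝ} {c t : ℝ} {s : Set ℝ} (hs : s ∈ 𝓝 t)
    (h : ∀ u ∈ s, f u = c) : deriv f t = 0 := by
  have : f =ᶠ[𝓝 t] fun _ => c := Filter.mem_of_superset hs h
  rw [this.deriv_eq, deriv_const]

/-- Scale invariance: applied at `t = m r`, the bound says that the radial derivative of `f (m r)`
is at most `C / r`, uniformly in `m`. -/
theorem exists_mul_deriv_bound {f : ℝ → ℝ} (hf : ContDiff ℝ 1 f)
    (h1 : ∀ t, 1 ≤ t → f t = 1) :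
    ∃ C, 0 ≤ C ∧ ∀ t, 0 ≤ t → t * |deriv f t| ≤ C := by
  have hc := hf.continuous_deriv le_rfl
  obtain ⟨C, hC⟩ := (isCompact_Icc (a := (0:ℝ)) (b := 1)).exists_bound_of_continuousOn
    (f := fun t => t * |deriv f t|) (by fun_prop)
  have hC0 : 0 ≤ C := (norm_nonneg _).trans (hC 0 (by simp))
  refine ⟨C, hC0, fun t ht => ?_⟩
  rcases le_or_gt t 1 with h | h
  · exact (le_abs_self _).trans (hC t ⟨ht, h⟩)
  · rw [deriv_eq_zero_of_const_near (c := 1) (Ioi_mem_nhds h) fun u hu => h1 u (le_of_lt hu)]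
    simpa using hC0

/-- The modulus varies only where the phase is still `d θ`. The Jacobian therefore never sees the
actual lift, whose derivative may change sign and sweep excess area. -/
theorem deriv_innerStep_mul_outerStep (t : ℝ) : deriv innerStep t * outerStep t = 0 := by
  rcases le_or_gt t (1 / 2) with h | h
  · rw [outerStep_of_le h, mul_zero]
  · rw [deriv_eq_zero_of_const_near (c := 1) (Ioi_mem_nhds h)
      fun u hu => innerStep_of_ge (le_of_lt hu), zero_mul]

/-- The phase of the recovery maps: it interpolates between `d θ` near the centre and the averaged
lift away from it. -/
def recoveryPhase (Φ : ℝ → ℝ) (d m r θ : ℝ) : ℝ :=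
  d * θ + outerStep (m * r) * (steklov Φ m θ - d * θ)

/-- The recovery maps in polar coordinates. -/
def recoveryPolar (Φ : ℝ → ℝ) (d m r θ : ℝ) : Plane :=
  innerStep (m * r) • radialVec (recoveryPhase Φ d m r θ)

/-- The recovery maps. -/
def recoveryMap (Φ : ℝ → ℝ) (d m : ℝ) : Plane → Plane := polarMap (recoveryPolar Φ d m)

theorem radialVec_periodic : Function.Periodic radialVec (2 * π) := fun θ => by
  simp [radialVec]

section

variable {Φ : ℝ → ℝ} {d m : ℝ} {K : NNReal}

/-- Both `d θ` and the averaged lift gain `2πd` over a turn, hence so does every interpolation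
between them, and `d` is an integer. -/
theorem recoveryPolar_periodic (hΦ : Continuous Φ) (h : ∀ θ, Φ (θ + 2 * π) = Φ θ + 2 * π * d)
    {n : ℤ} (hd : d = n) (hm : 0 < m) (r : ℝ) :
    Function.Periodic (recoveryPolar Φ d m r) (2 * π) := fun θ => by
  have : recoveryPhase Φ d m r (θ + 2 * π) = recoveryPhase Φ d m r θ + n * (2 * π) := by
    simp only [recoveryPhase]
    rw [steklov_add hΦ h hm.ne', hd]
    ring
  rw [recoveryPolar, this, radialVec_periodic.int_mul n]
  rfl

theorem contDiff_radialVec : ContDiff ℝ 1 radialVec := by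
  have e : radialVec = polarPoint 1 := by
    ext1 θ
    simp [polarPoint, radialVec]
  exact e ▸ contDiff_polarPoint 1

theorem contDiff_recoveryPolar (hΦ : Continuous Φ) :
    ContDiff ℝ 1 fun p : ℝ × ℝ => recoveryPolar Φ d m p.1 p.2 := by
  have h1 := (contDiff_steklov hΦ m).comp (contDiff_snd (𝕜 := ℝ) (E := ℝ) (F := ℝ))
  have h2 : ContDiff ℝ 1 fun p : ℝ × ℝ => m * p.1 := by fun_prop
  have h3 := contDiff_innerStep.comp h2
  have h4 := contDiff_outerStep.comp h2
  have h5 : ContDiff ℝ 1 fun p : ℝ × ℝ => d * p.2 := by fun_prop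
  have h6 : ContDiff ℝ 1 fun p : ℝ × ℝ => recoveryPhase Φ d m p.1 p.2 :=
    h5.add (h4.mul (h1.sub h5))
  exact h3.smul (contDiff_radialVec.comp h6)

/-- The radial derivative of the recovery maps. -/
def recoveryRadial (Φ : ℝ → ℝ) (d m r θ : ℝ) : Plane :=
  (m * deriv innerStep (m * r)) • radialVec (recoveryPhase Φ d m r θ) +
    (innerStep (m * r) * (m * deriv outerStep (m * r) * (steklov Φ m θ - d * θ))) •
      angularVec (recoveryPhase Φ d m r θ)

/-- The angular derivative of the phase of the recovery maps. -/
def recoveryPhaseDeriv (Φ : ℝ → ℝ) (d m r θ : ℝ) : ℝ :=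
  d + outerStep (m * r) * (m * (Φ (θ + 1 / m) - Φ θ) - d)

/-- The angular derivative of the recovery maps. -/
def recoveryAngular (Φ : ℝ → ℝ) (d m r θ : ℝ) : Plane :=
  (innerStep (m * r) * recoveryPhaseDeriv Φ d m r θ) • angularVec (recoveryPhase Φ d m r θ)

theorem hasDerivAt_step {f : ℝ → ℝ} (hf : ContDiff ℝ 1 f) (m r : ℝ) :
    HasDerivAt (fun s => f (m * s)) (m * deriv f (m * r)) r := by
  have := (hf.differentiable one_ne_zero (m * r)).hasDerivAt.comp r (hasDerivAt_const_mul m)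
  rwa [mul_comm] at this

theorem hasDerivAt_recoveryPolar_radius (r θ : ℝ) :
    HasDerivAt (fun s => recoveryPolar Φ d m s θ) (recoveryRadial Φ d m r θ) r := by
  have h1 : HasDerivAt (fun s => recoveryPhase Φ d m s θ)
      (m * deriv outerStep (m * r) * (steklov Φ m θ - d * θ)) r :=
    ((hasDerivAt_step contDiff_outerStep m r).mul_const _).const_add _
  have h2 := (hasDerivAt_step contDiff_innerStep m r).smul
    ((hasDerivAt_radialVec _).scomp r h1)
  refine h2.congr_deriv ?_
  rw [recoveryRadial, smul_smul, add_comm]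
  rfl

theorem hasDerivAt_recoveryPolar_angle (hΦ : Continuous Φ) (r θ : ℝ) :
    HasDerivAt (recoveryPolar Φ d m r) (recoveryAngular Φ d m r θ) θ := by
  have h1 : HasDerivAt (fun t => recoveryPhase Φ d m r t) (recoveryPhaseDeriv Φ d m r θ) θ :=
    (hasDerivAt_const_mul d).add
      (((hasDerivAt_steklov hΦ m θ).sub (hasDerivAt_const_mul d)).const_mul _)
  have h2 := ((hasDerivAt_radialVec _).scomp θ h1).const_smul (innerStep (m * r))
  refine h2.congr_deriv ?_
  rw [recoveryAngular, smul_smul]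

theorem recoveryMap_eq_zero_near (hm : 0 < m) {x : Plane} (hx : ‖x‖ < 1 / (4 * m)) :
    recoveryMap Φ d m x = 0 := by
  rw [recoveryMap, polarMap, recoveryPolar, innerStep_of_le, zero_smul]
  rw [lt_div_iff₀ (by positivity)] at hx
  linarith

theorem contDiff_recoveryMap (hΦ : Continuous Φ) (h : ∀ θ, Φ (θ + 2 * π) = Φ θ + 2 * π * d)
    {n : ℤ} (hd : d = n) (hm : 0 < m) : ContDiff ℝ 1 (recoveryMap Φ d m) := by
  rw [contDiff_iff_contDiffAt]
  intro x
  rcases eq_or_ne x 0 with rfl | hx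
  · have : recoveryMap Φ d m =ᶠ[𝓝 0] fun _ => 0 := by
      filter_upwards [Metric.ball_mem_nhds (0 : Plane) (by positivity : 0 < 1 / (4 * m))] with y hy
      exact recoveryMap_eq_zero_near hm (mem_ball_zero_iff.1 hy)
    exact contDiffAt_const.congr_of_eventuallyEq this
  · exact contDiffAt_polarMap (recoveryPolar_periodic hΦ h hd hm) (contDiff_recoveryPolar hΦ) hx

/-! ### Gradient bound and Jacobian mass of the recovery maps -/

theorem norm_recoveryMap_le (x : Plane) : ‖recoveryMap Φ d m x‖ ≤ 1 := by
  rw [recoveryMap, polarMap, recoveryPolar, norm_smul, norm_radialVec, mul_one, Real.norm_eq_abs,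
    abs_of_nonneg (innerStep_nonneg _)]
  exact innerStep_le_one _

theorem fderiv_recoveryMap (hΦ : Continuous Φ) (h : ∀ θ, Φ (θ + 2 * π) = Φ θ + 2 * π * d)
    {n : ℤ} (hd : d = n) (hm : 0 < m) {r : ℝ} (hr : 0 < r) (θ : ℝ) :
    fderiv ℝ (recoveryMap Φ d m) (polarPoint r θ) (radialVec θ) = recoveryRadial Φ d m r θ ∧
      fderiv ℝ (recoveryMap Φ d m) (polarPoint r θ) (angularVec θ) =
        r⁻¹ • recoveryAngular Φ d m r θ :=
  fderiv_polarMap (recoveryPolar_periodic hΦ h hd hm) hr (hasDerivAt_recoveryPolar_radius r θ)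
    (hasDerivAt_recoveryPolar_angle hΦ r θ)
    ((contDiff_recoveryMap hΦ h hd hm).differentiable one_ne_zero _)

theorem abs_recoveryPhaseDeriv_le (hΦ : LipschitzWith K Φ) (hm : 0 < m) (r θ : ℝ) :
    |recoveryPhaseDeriv Φ d m r θ| ≤ |d| + K := by
  have h1 := abs_deriv_steklov_le hΦ hm θ
  have h2 := outerStep_nonneg (m * r)
  have h3 := outerStep_le_one (m * r)
  rw [recoveryPhaseDeriv, show d + outerStep (m * r) * (m * (Φ (θ + 1 / m) - Φ θ) - d) =
    (1 - outerStep (m * r)) * d + outerStep (m * r) * (m * (Φ (θ + 1 / m) - Φ θ)) by ring]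
  refine (abs_add_le _ _).trans ?_
  rw [abs_mul, abs_mul, abs_of_nonneg h2, abs_of_nonneg (by linarith : 0 ≤ 1 - outerStep (m * r))]
  refine add_le_add ?_ ?_
  · exact mul_le_of_le_one_left (abs_nonneg _) (by linarith)
  · exact (mul_le_of_le_one_left (abs_nonneg _) h3).trans h1

theorem norm_recoveryAngular_le (hΦ : LipschitzWith K Φ) (hm : 0 < m) (r θ : ℝ) :
    ‖recoveryAngular Φ d m r θ‖ ≤ |d| + K := by
  rw [recoveryAngular, norm_smul, norm_angularVec, mul_one, Real.norm_eq_abs, abs_mul,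
    abs_of_nonneg (innerStep_nonneg _)]
  exact (mul_le_of_le_one_left (abs_nonneg _) (innerStep_le_one _)).trans
    (abs_recoveryPhaseDeriv_le hΦ hm r θ)

/-- This supplies the majorant for every dominated convergence argument below: `C / |x|`,
independent of `m` and integrable near the origin in dimension two. -/
theorem exists_recovery_gradient_bound (hΦ : LipschitzWith K Φ)
    (h : ∀ θ, Φ (θ + 2 * π) = Φ θ + 2 * π * d) {n : ℤ} (hd : d = n) :
    ∃ C, 0 ≤ C ∧ ∀ m, 1 ≤ m → ∀ x ≠ 0, ‖gradField (recoveryMap Φ d m) x‖ ≤ C * ‖x‖⁻¹ := by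
  obtain ⟨C₁, hC₁, h₁⟩ := exists_mul_deriv_bound contDiff_innerStep
    fun t ht => innerStep_of_ge (by linarith)
  obtain ⟨C₂, hC₂, h₂⟩ := exists_mul_deriv_bound contDiff_outerStep fun t => outerStep_of_ge
  -- `P` bounds the phase correction `steklov Φ m θ - d θ` for `|θ| ≤ π` and `m ≥ 1`: the value at
  -- `0`, the variation of `Φ`, the averaging error `K / m ≤ K`, and `|d| π`.
  set P : ℝ := |Φ 0| + K * π + K + |d| * π
  have hπ := Real.pi_pos
  have hP0 : 0 ≤ P := by positivity
  refine ⟨C₁ + C₂ * P + (|d| + K), by positivity, fun m hm x hx => ?_⟩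
  have hm0 : 0 < m := by linarith
  set r := ‖x‖
  set θ := planeArg x
  have hr : 0 < r := norm_pos_iff.2 hx
  have hθ : |θ| ≤ π := Complex.abs_arg_le_pi _
  have hP : |steklov Φ m θ - d * θ| ≤ P := by
    have e1 := abs_steklov_sub_le hΦ hm0 θ
    have e2 : (K : ℝ) / m ≤ K := div_le_self K.2 hm
    have e3 : |Φ θ - Φ 0| ≤ K * π := by
      refine (hΦ.dist_le_mul θ 0).trans ?_
      rw [Real.dist_eq, sub_zero]
      gcongr
    have e4 : |d * θ| ≤ |d| * π := by rw [abs_mul]; gcongr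
    have : steklov Φ m θ - d * θ = (steklov Φ m θ - Φ θ) + (Φ θ - Φ 0) + Φ 0 - d * θ := by ring
    rw [this]
    refine (abs_sub _ _).trans ?_
    have := abs_add_three (steklov Φ m θ - Φ θ) (Φ θ - Φ 0) (Φ 0)
    simp only [P]
    linarith
  obtain ⟨hA, hB⟩ := fderiv_recoveryMap hΦ.continuous h hd hm0 hr θ
  have hx' : polarPoint r θ = x := polarPoint_norm_planeArg x
  rw [hx'] at hA hB
  have hAle : ‖recoveryRadial Φ d m r θ‖ ≤ (C₁ + C₂ * P) * r⁻¹ := by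
    have hmr : 0 ≤ m * r := by positivity
    rw [recoveryRadial, ← div_eq_mul_inv, le_div_iff₀ hr]
    have n1 : ‖(m * deriv innerStep (m * r)) • radialVec (recoveryPhase Φ d m r θ)‖ * r ≤ C₁ := by
      rw [norm_smul, norm_radialVec, mul_one, Real.norm_eq_abs, abs_mul, abs_of_pos hm0]
      linarith [h₁ (m * r) hmr]
    have n2 : ‖(innerStep (m * r) * (m * deriv outerStep (m * r) * (steklov Φ m θ - d * θ))) •
        angularVec (recoveryPhase Φ d m r θ)‖ * r ≤ C₂ * P := by
      rw [norm_smul, norm_angularVec, mul_one, Real.norm_eq_abs, abs_mul, abs_mul, abs_mul,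
        abs_of_pos hm0, abs_of_nonneg (innerStep_nonneg _)]
      calc innerStep (m * r) * (m * |deriv outerStep (m * r)| * |steklov Φ m θ - d * θ|) * r
          = innerStep (m * r) * ((m * r * |deriv outerStep (m * r)|) *
            |steklov Φ m θ - d * θ|) := by ring
        _ ≤ 1 * (C₂ * P) := by
          refine mul_le_mul (innerStep_le_one _) ?_ (by positivity) zero_le_one
          exact mul_le_mul (h₂ _ hmr) hP (abs_nonneg _) hC₂
        _ = C₂ * P := one_mul _
    calc _ ≤ (‖(m * deriv innerStep (m * r)) • radialVec (recoveryPhase Φ d m r θ)‖ +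
        ‖(innerStep (m * r) * (m * deriv outerStep (m * r) * (steklov Φ m θ - d * θ))) •
        angularVec (recoveryPhase Φ d m r θ)‖) * r := by gcongr; exact norm_add_le _ _
      _ ≤ C₁ + C₂ * P := by rw [add_mul]; exact add_le_add n1 n2
  have hBle : ‖r⁻¹ • recoveryAngular Φ d m r θ‖ ≤ (|d| + K) * r⁻¹ := by
    rw [norm_smul, norm_inv, Real.norm_eq_abs, abs_of_pos hr, mul_comm]
    gcongr
    exact norm_recoveryAngular_le hΦ hm0 r θ
  rw [norm_gradField, gradNormSq_eq _ _ θ, hA, hB]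
  refine (Real.sqrt_le_iff.2 ⟨by positivity, ?_⟩ :
    _ ≤ ‖recoveryRadial Φ d m r θ‖ + ‖r⁻¹ • recoveryAngular Φ d m r θ‖).trans ?_
  · nlinarith [norm_nonneg (recoveryRadial Φ d m r θ), norm_nonneg (r⁻¹ • recoveryAngular Φ d m r θ)]
  · rw [add_mul]; exact add_le_add hAle hBle

/-- The integrand is the derivative of half the squared modulus, which rises from `0` to at most `1
/ 2`. Multiplied by the angular range `2π`, this becomes the constant `π`. -/
theorem lintegral_deriv_innerStep_le (hm : 0 < m) {l : ℝ} (hl : 0 < l) :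
    ∫⁻ r in Set.Ioo 0 l, ENNReal.ofReal (m * deriv innerStep (m * r) * innerStep (m * r)) ≤
      ENNReal.ofReal (1 / 2) := by
  have hd : ∀ r, HasDerivAt (fun s => innerStep (m * s) ^ 2 / 2)
      (m * deriv innerStep (m * r) * innerStep (m * r)) r := fun r => by
    refine (((hasDerivAt_step contDiff_innerStep m r).pow 2).div_const 2).congr_deriv ?_
    simp only [Nat.cast_ofNat, Nat.add_one_sub_one, pow_one]
    ring
  have hc : Continuous fun r => m * deriv innerStep (m * r) * innerStep (m * r) := by
    have h1 := contDiff_innerStep.continuous_deriv le_rfl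
    have h2 := contDiff_innerStep.continuous
    fun_prop
  have hpos : ∀ r, 0 ≤ m * deriv innerStep (m * r) * innerStep (m * r) := fun r =>
    mul_nonneg (mul_nonneg hm.le (monotone_innerStep.deriv_nonneg)) (innerStep_nonneg _)
  rw [← ofReal_integral_eq_lintegral_ofReal
    ((hc.integrableOn_Icc (a := 0) (b := l)).mono_set Set.Ioo_subset_Icc_self)
    (ae_of_all _ hpos), ← integral_Ioc_eq_integral_Ioo, ← intervalIntegral.integral_of_le hl.le,
    intervalIntegral.integral_eq_sub_of_hasDerivAt (fun r _ => hd r) (hc.intervalIntegrable _ _)]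
  refine ENNReal.ofReal_le_ofReal ?_
  have h1 := innerStep_le_one (m * l)
  have h2 := innerStep_nonneg (m * l)
  rw [mul_zero, innerStep_of_le (t := 0) (by norm_num)]
  nlinarith

theorem cross_smul_radialVec_add (a b c p : ℝ) :
    cross (a • radialVec p + b • angularVec p) (c • angularVec p) = a * c := by
  simp only [cross, radialVec, angularVec, PiLp.add_apply, PiLp.smul_apply, smul_eq_mul,
    Matrix.cons_val_zero, Matrix.cons_val_one]
  linear_combination (a * c) * Real.sin_sq_add_cos_sq p

/-- The tangential part of the radial derivative is parallel to the angular derivative and drops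
out. In what remains, `deriv_innerStep_mul_outerStep` reduces the phase derivative to `d`. -/
theorem mul_jacobian_recoveryMap (hΦ : Continuous Φ) (h : ∀ θ, Φ (θ + 2 * π) = Φ θ + 2 * π * d)
    {n : ℤ} (hd : d = n) (hm : 0 < m) {r : ℝ} (hr : 0 < r) (θ : ℝ) :
    r * |jacobian (recoveryMap Φ d m) (polarPoint r θ)| =
      m * deriv innerStep (m * r) * innerStep (m * r) * |d| := by
  obtain ⟨hA, hB⟩ := fderiv_recoveryMap hΦ h hd hm hr θ
  rw [jacobian_eq _ _ θ, hA, hB, recoveryRadial, recoveryAngular, smul_smul,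
    cross_smul_radialVec_add]
  have h0 := deriv_innerStep_mul_outerStep (m * r)
  have hpos : 0 ≤ m * deriv innerStep (m * r) * innerStep (m * r) :=
    mul_nonneg (mul_nonneg hm.le (monotone_innerStep.deriv_nonneg)) (innerStep_nonneg _)
  have e : m * deriv innerStep (m * r) * (r⁻¹ * (innerStep (m * r) *
      recoveryPhaseDeriv Φ d m r θ)) =
      r⁻¹ * (m * deriv innerStep (m * r) * innerStep (m * r) * d) := by
    rw [recoveryPhaseDeriv]
    linear_combination r⁻¹ * m * innerStep (m * r) * (m * (Φ (θ + 1 / m) - Φ θ) - d) * h0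
  rw [e, abs_mul, abs_mul, abs_of_nonneg hpos, abs_of_pos (inv_pos.2 hr), ← mul_assoc,
    mul_inv_cancel₀ hr.ne', one_mul]

theorem lintegral_jacobian_recoveryMap_le (hΦ : Continuous Φ)
    (h : ∀ θ, Φ (θ + 2 * π) = Φ θ + 2 * π * d) {n : ℤ} (hd : d = n) (hm : 0 < m) {l : ℝ}
    (hl : 0 < l) :
    ∫⁻ x in Metric.ball 0 l, ‖jacobian (recoveryMap Φ d m) x‖ₑ ≤ ENNReal.ofReal (π * |d|) := by
  rw [lintegral_ball_polar (measurable_jacobian _).enorm]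
  have e : ∀ r ∈ Set.Ioo 0 l, ∫⁻ θ in Set.Ioo (-π) π, ENNReal.ofReal r *
      ‖jacobian (recoveryMap Φ d m) (polarPoint r θ)‖ₑ =
      ENNReal.ofReal (m * deriv innerStep (m * r) * innerStep (m * r)) *
        ENNReal.ofReal (|d| * (2 * π)) := by
    intro r hr
    have e1 : ∀ θ, ENNReal.ofReal r * ‖jacobian (recoveryMap Φ d m) (polarPoint r θ)‖ₑ =
        ENNReal.ofReal (m * deriv innerStep (m * r) * innerStep (m * r) * |d|) := fun θ => by
      rw [← mul_jacobian_recoveryMap hΦ h hd hm hr.1 θ, ENNReal.ofReal_mul hr.1.le,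
        Real.enorm_eq_ofReal_abs]
    simp_rw [e1]
    have hpos : 0 ≤ m * deriv innerStep (m * r) * innerStep (m * r) :=
      mul_nonneg (mul_nonneg hm.le (monotone_innerStep.deriv_nonneg)) (innerStep_nonneg _)
    rw [lintegral_const, Measure.restrict_apply_univ, Real.volume_Ioo,
      ← ENNReal.ofReal_mul (by positivity), ← ENNReal.ofReal_mul hpos]
    congr 1
    ring
  rw [setLIntegral_congr_fun measurableSet_Ioo e, lintegral_mul_const' _ _ ENNReal.ofReal_ne_top]
  calc _ ≤ ENNReal.ofReal (1 / 2) * ENNReal.ofReal (|d| * (2 * π)) := by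
        gcongr
        exact lintegral_deriv_innerStep_le hm hl
    _ = ENNReal.ofReal (π * |d|) := by
        rw [← ENNReal.ofReal_mul (by norm_num)]
        congr 1
        ring

end

/-! ### Convergence of the recovery maps -/

theorem integrableOn_inv_norm (l : ℝ) :
    IntegrableOn (fun x : Plane => ‖x‖⁻¹) (Metric.ball 0 l) := by
  have hm : Measurable fun x : Plane => ‖x‖⁻¹ := measurable_norm.inv
  refine ⟨hm.aestronglyMeasurable, ?_⟩
  rw [hasFiniteIntegral_iff_enorm, lintegral_ball_polar hm.enorm]
  have e : ∀ r ∈ Set.Ioo 0 l, ∫⁻ θ in Set.Ioo (-π) π,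
      ENNReal.ofReal r * ‖‖polarPoint r θ‖⁻¹‖ₑ = ENNReal.ofReal (2 * π) := by
    intro r hr
    have e1 : ∀ θ, ENNReal.ofReal r * ‖‖polarPoint r θ‖⁻¹‖ₑ = 1 := fun θ => by
      rw [norm_polarPoint, abs_of_pos hr.1, Real.enorm_eq_ofReal (inv_pos.2 hr.1).le,
        ← ENNReal.ofReal_mul hr.1.le, mul_inv_cancel₀ hr.1.ne', ENNReal.ofReal_one]
    simp_rw [e1]
    rw [lintegral_const, Measure.restrict_apply_univ, Real.volume_Ioo, one_mul]
    congr 1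
    ring
  rw [setLIntegral_congr_fun measurableSet_Ioo e, lintegral_const, Measure.restrict_apply_univ,
    Real.volume_Ioo]
  exact ENNReal.mul_lt_top ENNReal.ofReal_lt_top ENNReal.ofReal_lt_top

theorem tendsto_gradField {v : ℕ → Plane → Plane} {w : Plane → Plane} {x : Plane} {θ : ℝ}
    (hr : Tendsto (fun k => fderiv ℝ (v k) x (radialVec θ)) atTop (𝓝 (fderiv ℝ w x (radialVec θ))))
    (ha : Tendsto (fun k => fderiv ℝ (v k) x (angularVec θ)) atTop
      (𝓝 (fderiv ℝ w x (angularVec θ)))) :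
    Tendsto (fun k => gradField (v k) x) atTop (𝓝 (gradField w x)) := by
  have h : ∀ y, Tendsto (fun k => fderiv ℝ (v k) x y) atTop (𝓝 (fderiv ℝ w x y)) := fun y => by
    simp_rw [fderiv_eq_polar _ x y θ]
    exact (hr.const_smul _).add (ha.const_smul _)
  unfold gradField
  refine ((PiLp.continuous_toLp 2 _).tendsto _).comp (tendsto_pi_nhds.2 fun i => ?_)
  refine ((PiLp.continuous_toLp 2 _).tendsto _).comp (tendsto_pi_nhds.2 fun j => ?_)
  exact ((EuclideanSpace.proj (𝕜 := ℝ) i).continuous.tendsto _).comp (h _)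

section

variable {φ : UnitCircle → UnitCircle} {Φ : ℝ → ℝ} {d : ℝ} {K : NNReal}

theorem tendsto_nat_add_one : Tendsto (fun k : ℕ => (k : ℝ) + 1) atTop atTop :=
  tendsto_atTop_add_const_right _ _ tendsto_natCast_atTop_atTop

theorem eventually_lt_nat_mul {r : ℝ} (hr : 0 < r) : ∀ᶠ k : ℕ in atTop, 1 < ((k : ℝ) + 1) * r :=
  (tendsto_nat_add_one.atTop_mul_const hr).eventually_gt_atTop 1

theorem tendsto_steklov (hΦ : LipschitzWith K Φ) (θ : ℝ) :
    Tendsto (fun k : ℕ => steklov Φ ((k : ℝ) + 1) θ) atTop (𝓝 (Φ θ)) := by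
  rw [tendsto_iff_dist_tendsto_zero]
  refine squeeze_zero (fun _ => dist_nonneg) (fun k => ?_)
    (tendsto_nat_add_one.const_div_atTop (K : ℝ))
  exact abs_steklov_sub_le hΦ (by positivity) θ

theorem tendsto_recoveryMap (hΦ : LipschitzWith K Φ) (hφΦ : ∀ θ, profile φ θ = radialVec (Φ θ))
    {x : Plane} (hx : x ≠ 0) :
    Tendsto (fun k : ℕ => recoveryMap Φ d ((k : ℝ) + 1) x) atTop (𝓝 (vortexTypeMap φ x)) := by
  rw [vortexTypeMap_eq φ hx, hφΦ]
  refine ((continuous_radialVec.tendsto _).comp (tendsto_steklov hΦ (planeArg x))).congr' ?_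
  filter_upwards [eventually_lt_nat_mul (norm_pos_iff.2 hx)] with k hk
  rw [recoveryMap, polarMap, recoveryPolar, recoveryPhase, innerStep_of_ge (by linarith),
    outerStep_of_ge hk.le]
  simp

/-- Once `m r > 1` both steps are locally constant equal to `1`: the radial derivative is exactly
zero, and the angular one is `1 / r` times a difference quotient of `Φ` along the averaged phase. -/
theorem tendsto_gradField_recoveryMap (hΦ : LipschitzWith K Φ)
    (h : ∀ θ, Φ (θ + 2 * π) = Φ θ + 2 * π * d) {n : ℤ} (hd : d = n)
    (hφΦ : ∀ θ, profile φ θ = radialVec (Φ θ)) {x : Plane}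
    (hx : planeToComplex x ∈ Complex.slitPlane) (hΦd : DifferentiableAt ℝ Φ (planeArg x)) :
    Tendsto (fun k : ℕ => gradField (recoveryMap Φ d ((k : ℝ) + 1)) x) atTop
      (𝓝 (gradField (vortexTypeMap φ) x)) := by
  set θ := planeArg x
  have hx0 : x ≠ 0 := by
    rintro rfl
    simp at hx
  set r := ‖x‖
  have hr : 0 < r := norm_pos_iff.2 hx0
  have hxp : polarPoint r θ = x := polarPoint_norm_planeArg x
  have hθ : θ ∈ Set.Ioo (-π) π :=
    ⟨Complex.neg_pi_lt_arg _, (Complex.arg_le_pi _).lt_of_ne (Complex.slitPlane_arg_ne_pi hx)⟩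
  have hpd : HasDerivAt (profile φ) (deriv Φ θ • angularVec (Φ θ)) θ := by
    rw [show profile φ = fun t => radialVec (Φ t) from funext hφΦ]
    exact (hasDerivAt_radialVec _).scomp θ hΦd.hasDerivAt
  obtain ⟨w1, w2⟩ := fderiv_vortexTypeMap hr hθ hpd.differentiableAt
  rw [hxp] at w1 w2
  rw [hpd.deriv] at w2
  have w2' : fderiv ℝ (vortexTypeMap φ) x (angularVec θ) =
      r⁻¹ • (deriv Φ θ • angularVec (Φ θ)) := by
    rw [← w2, smul_smul, inv_mul_cancel₀ hr.ne', one_smul]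
  have hv := fun k : ℕ => fderiv_recoveryMap hΦ.continuous h hd
    (by positivity : (0:ℝ) < (k : ℝ) + 1) hr θ
  simp only [hxp] at hv
  refine tendsto_gradField (θ := θ) ?_ ?_
  · rw [w1]
    refine tendsto_const_nhds.congr' ?_
    filter_upwards [eventually_lt_nat_mul hr] with k hk
    rw [(hv k).1, recoveryRadial,
      deriv_eq_zero_of_const_near (c := 1) (Ioi_mem_nhds (by linarith : 1 / 2 < ((k : ℝ) + 1) * r))
        fun u hu => innerStep_of_ge (le_of_lt hu),
      deriv_eq_zero_of_const_near (c := 1) (Ioi_mem_nhds hk)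
        fun u hu => outerStep_of_ge (le_of_lt hu)]
    simp
  · rw [w2']
    have t1 : Tendsto (fun k : ℕ => ((k : ℝ) + 1) * (Φ (θ + 1 / ((k : ℝ) + 1)) - Φ θ)) atTop
        (𝓝 (deriv Φ θ)) := by
      have h0 : Tendsto (fun k : ℕ => 1 / ((k : ℝ) + 1)) atTop (𝓝[≠] 0) :=
        tendsto_nhdsWithin_iff.2 ⟨tendsto_one_div_add_atTop_nhds_zero_nat,
          Eventually.of_forall fun k => by
            have : (0:ℝ) < 1 / ((k : ℝ) + 1) := by positivity
            exact this.ne'⟩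
      refine (hΦd.hasDerivAt.tendsto_slope_zero.comp h0).congr fun k => ?_
      simp
    have t2 := ((continuous_angularVec.tendsto _).comp (tendsto_steklov hΦ θ))
    refine ((t1.smul t2).const_smul r⁻¹).congr' ?_
    filter_upwards [eventually_lt_nat_mul hr] with k hk
    rw [(hv k).2, recoveryAngular, recoveryPhaseDeriv, recoveryPhase,
      innerStep_of_ge (by linarith), outerStep_of_ge hk.le]
    simp

end

/-! ### The relaxation formula -/

theorem aestronglyMeasurable_gradField (v : Plane → Plane) (μ : Measure Plane) :
    AEStronglyMeasurable (gradField v) μ := (measurable_gradField v).aestronglyMeasurable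

theorem ae_ne_zero_plane : ∀ᵐ x : Plane, x ≠ 0 := by simp [ae_iff]

/-- Splitting the root loses nothing in the limit for the recovery maps, whose Jacobian lives on
discs of radius `1 / (2 m)`. -/
theorem graphArea_le {v : Plane → Plane} (Ω : Set Plane) :
    graphArea v Ω ≤ (∫⁻ x in Ω, ENNReal.ofReal √(1 + gradNormSq v x)) +
      ∫⁻ x in Ω, ‖jacobian v x‖ₑ := by
  rw [← lintegral_add_right _ (measurable_jacobian v).enorm]
  refine lintegral_mono fun x => ?_
  rw [Real.enorm_eq_ofReal_abs, ← ENNReal.ofReal_add (Real.sqrt_nonneg _) (abs_nonneg _)]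
  refine ENNReal.ofReal_le_ofReal (Real.sqrt_le_iff.2 ⟨by positivity, ?_⟩)
  have h1 := Real.sq_sqrt (by linarith [gradNormSq_nonneg v x] : 0 ≤ 1 + gradNormSq v x)
  have h2 := mul_nonneg (Real.sqrt_nonneg (1 + gradNormSq v x)) (abs_nonneg (jacobian v x))
  have h3 := sq_abs (jacobian v x)
  nlinarith

theorem sqrt_one_add_gradNormSq_le (v : Plane → Plane) (x : Plane) :
    √(1 + gradNormSq v x) ≤ 1 + ‖gradField v x‖ := by
  rw [← norm_gradField_sq]
  exact Real.sqrt_le_iff.2 ⟨by positivity, by nlinarith [norm_nonneg (gradField v x)]⟩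

/-- The total variation and the relaxed area of a vortex type map. -/
theorem vortexTypeMap_relaxation {φ : UnitCircle → UnitCircle} {K : NNReal}
    (hφ : LipschitzWith K φ) {l : ℝ} (hl : 0 < l) :
    MemBV (vortexTypeMap φ) (Metric.ball 0 l) ∧
      IntegrableOn (fun x => √(1 + gradNormSq (vortexTypeMap φ) x)) (Metric.ball 0 l) ∧
      relaxedAreaBV (vortexTypeMap φ) (Metric.ball 0 l) =
        ENNReal.ofReal ((∫ x in Metric.ball (0 : Plane) l,
          √(1 + gradNormSq (vortexTypeMap φ) x)) + π * |degree φ|) := by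
  obtain ⟨Φ, hΦ, hφΦ, hper⟩ := exists_angle_lift hφ
  obtain ⟨n, hd⟩ := exists_int_degree hφ
  obtain ⟨C, hC0, hC⟩ := exists_recovery_gradient_bound hΦ hper hd
  set d := degree φ
  set w := vortexTypeMap φ
  set B := Metric.ball (0 : Plane) l
  set v : ℕ → Plane → Plane := fun k => recoveryMap Φ d ((k : ℝ) + 1)
  have hk1 : ∀ k : ℕ, (1 : ℝ) ≤ (k : ℝ) + 1 := fun k => by linarith [k.cast_nonneg (α := ℝ)]
  have hk0 : ∀ k : ℕ, (0 : ℝ) < (k : ℝ) + 1 := fun k => by positivity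
  have hv : ∀ k, ContDiff ℝ 1 (v k) := fun k => contDiff_recoveryMap hΦ.continuous hper hd (hk0 k)
  have hfin : volume B < ⊤ := measure_ball_lt_top
  have hone : IntegrableOn (fun _ : Plane => (1 : ℝ)) B := integrableOn_const (hs := hfin.ne)
  have hbd : IntegrableOn (fun x : Plane => C * ‖x‖⁻¹) B := (integrableOn_inv_norm l).const_mul C
  have hvC : ∀ k, ∀ᵐ x ∂volume.restrict B, ‖gradField (v k) x‖ ≤ C * ‖x‖⁻¹ := fun k =>
    ae_restrict_of_ae (ae_ne_zero_plane.mono fun x hx => hC _ (hk1 k) x hx)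
  have hlimv : ∀ᵐ x ∂volume.restrict B, Tendsto (fun k => v k x) atTop (𝓝 (w x)) :=
    ae_restrict_of_ae (ae_ne_zero_plane.mono fun x hx => tendsto_recoveryMap hΦ hφΦ hx)
  have hlimG : ∀ᵐ x ∂volume.restrict B,
      Tendsto (fun k => gradField (v k) x) atTop (𝓝 (gradField w x)) :=
    ae_restrict_of_ae ((ae_planeArg_of_ae hΦ.ae_differentiableAt).mono fun x hx =>
      tendsto_gradField_recoveryMap hΦ hper hd hφΦ hx.1 hx.2)
  have hvm : ∀ k, AEStronglyMeasurable (v k) (volume.restrict B) := fun k =>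
    (hv k).continuous.aestronglyMeasurable
  have hwm : Measurable w := measurable_vortexTypeMap (lipschitzWith_profile hφ).continuous
  have hw1 : ∀ᵐ x ∂volume.restrict B, ‖w x‖ ≤ 1 := by
    filter_upwards [hlimv] with x hx
    exact le_of_tendsto' hx.norm fun k => norm_recoveryMap_le x
  have hwC : ∀ᵐ x ∂volume.restrict B, ‖gradField w x‖ ≤ C * ‖x‖⁻¹ := by
    filter_upwards [hlimG, ae_all_iff.2 hvC] with x hx hxC
    exact le_of_tendsto' hx.norm hxC
  have hvi : ∀ k, IntegrableOn (v k) B := fun k =>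
    Integrable.mono' hone (hvm k) (ae_of_all _ fun x => norm_recoveryMap_le x)
  have hwi : IntegrableOn w B := Integrable.mono' hone hwm.aestronglyMeasurable hw1
  have hGvi : ∀ k, IntegrableOn (gradField (v k)) B := fun k =>
    Integrable.mono' hbd (aestronglyMeasurable_gradField _ _) (hvC k)
  have hGwi : IntegrableOn (gradField w) B :=
    Integrable.mono' hbd (aestronglyMeasurable_gradField _ _) hwC
  have hwgv : ∀ k, IsWeakGradient (gradField (v k)) (v k) B := fun k =>
    isWeakGradient_of_contDiffOn Metric.isOpen_ball (hv k).contDiffOn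
  -- The singularity of `w` at the origin is crossed by approximation: the classical gradient of
  -- `w`, defined almost everywhere, is the dominated limit of gradients of `C¹` maps and hence the
  -- full weak gradient.
  have hwgw : IsWeakGradient (gradField w) w B :=
    IsWeakGradient.of_tendsto hwgv hvm (fun k => aestronglyMeasurable_gradField _ _) hone hbd
      (fun k => ae_of_all _ fun x => norm_recoveryMap_le x) hvC hlimv hlimG
  have htvw : totalVariation w B = ∫⁻ x in B, ‖gradField w x‖ₑ := hwgw.totalVariation_eq hGwi
  have htvv : ∀ k, totalVariation (v k) B = ∫⁻ x in B, ‖gradField (v k) x‖ₑ := fun k =>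
    (hwgv k).totalVariation_eq (hGvi k)
  have hbv : MemBV w B := ⟨hwi, by rw [htvw]; exact hGwi.2⟩
  have hbde : ∫⁻ x in B, ENNReal.ofReal (C * ‖x‖⁻¹) ≠ ⊤ := by
    have := hbd.2
    rw [hasFiniteIntegral_iff_ofReal (ae_of_all _ fun x => by positivity)] at this
    exact this.ne
  have hst : StrictTendsto v w B := by
    refine ⟨fun k => ⟨hvi k, by rw [htvv]; exact (hGvi k).2⟩, hbv, ?_, ?_⟩
    · have := tendsto_lintegral_of_dominated_convergence' (μ := volume.restrict B)
        (F := fun k x => ‖v k x - w x‖ₑ) (f := fun _ => 0) (fun _ => ENNReal.ofReal 2)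
        (fun k => ((hvm k).sub hwm.aestronglyMeasurable).enorm)
        (fun k => by
          filter_upwards [hw1] with x hx
          rw [← ofReal_norm]
          refine ENNReal.ofReal_le_ofReal ((norm_sub_le _ _).trans ?_)
          linarith [norm_recoveryMap_le (Φ := Φ) (d := d) (m := (k : ℝ) + 1) x])
        (by rw [lintegral_const, Measure.restrict_apply_univ]
            exact (ENNReal.mul_lt_top ENNReal.ofReal_lt_top hfin).ne)
        (by
          filter_upwards [hlimv] with x hx
          have := (hx.sub_const (w x)).enorm
          simpa using this)
      simpa using this
    · rw [htvw]
      simp_rw [htvv]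
      refine tendsto_lintegral_of_dominated_convergence' (fun x => ENNReal.ofReal (C * ‖x‖⁻¹))
        (fun k => (aestronglyMeasurable_gradField _ _).enorm) (fun k => ?_) hbde
        (hlimG.mono fun x hx => hx.enorm)
      filter_upwards [hvC k] with x hx
      rw [← ofReal_norm]
      exact ENNReal.ofReal_le_ofReal hx
  have hint : IntegrableOn (fun x => √(1 + gradNormSq w x)) B := by
    refine Integrable.mono' (hone.add hGwi.norm)
      ((measurable_gradNormSq w).const_add 1).sqrt.aestronglyMeasurable (ae_of_all _ fun x => ?_)
    rw [Real.norm_eq_abs, abs_of_nonneg (Real.sqrt_nonneg _)]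
    exact sqrt_one_add_gradNormSq_le w x
  have hpd : 0 ≤ π * |d| := by positivity
  refine ⟨hbv, hint, ?_⟩
  rw [ENNReal.ofReal_add (integral_nonneg fun x => Real.sqrt_nonneg _) hpd,
    ofReal_integral_eq_lintegral_ofReal hint (ae_of_all _ fun x => Real.sqrt_nonneg _)]
  apply le_antisymm
  · have hle : relaxedAreaBV w B ≤ liminf (fun k => graphArea (v k) B) atTop :=
      sInf_le ⟨v, fun k => (hv k).contDiffOn, hst, rfl⟩
    refine hle.trans ?_
    have hlim : Tendsto (fun k => ∫⁻ x in B, ENNReal.ofReal √(1 + gradNormSq (v k) x)) atTop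
        (𝓝 (∫⁻ x in B, ENNReal.ofReal √(1 + gradNormSq w x))) := by
      refine tendsto_lintegral_of_dominated_convergence'
        (fun x => 1 + ENNReal.ofReal (C * ‖x‖⁻¹))
        (fun k => ((measurable_gradNormSq (v k)).const_add 1).sqrt.ennreal_ofReal.aemeasurable)
        (fun k => ?_) ?_ ?_
      · filter_upwards [hvC k] with x hx
        rw [← ENNReal.ofReal_one, ← ENNReal.ofReal_add zero_le_one (by positivity)]
        exact ENNReal.ofReal_le_ofReal ((sqrt_one_add_gradNormSq_le _ x).trans (by linarith))
      · rw [lintegral_add_left measurable_const, lintegral_one, Measure.restrict_apply_univ]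
        exact ENNReal.add_ne_top.2 ⟨hfin.ne, hbde⟩
      · filter_upwards [hlimG] with x hx
        refine ENNReal.tendsto_ofReal ((Real.continuous_sqrt.tendsto _).comp ?_)
        simp_rw [← norm_gradField_sq]
        exact (hx.norm.pow 2).const_add 1
    refine (liminf_le_liminf (Eventually.of_forall fun k => (graphArea_le B).trans
      (add_le_add_right (lintegral_jacobian_recoveryMap_le hΦ.continuous hper hd (hk0 k) hl)
        _))).trans ?_
    exact (hlim.add_const _).liminf_eq.le
  · refine le_sInf ?_
    rintro a ⟨u, hu, hustr, rfl⟩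
    by_contra hcon
    rw [not_le] at hcon
    -- If some liminf were below the claimed value, a subsequence would have all its areas below an
    -- intermediate `c`, against `lower_bound`.
    obtain ⟨c, hc1, hc2⟩ := exists_between hcon
    obtain ⟨σ, hσ, hσc⟩ := extraction_of_frequently_atTop
      (frequently_lt_of_liminf_lt (by isBoundedDefault) hc1)
    have := lower_bound hφ hl (fun k => hu (σ k))
      (⟨fun k => hustr.memBV_seq _, hustr.memBV_limit, hustr.tendsto_L1.comp hσ.tendsto_atTop,
        hustr.tendsto_variation.comp hσ.tendsto_atTop⟩ : StrictTendsto (fun k => u (σ k)) w B)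
      htvw.le (fun k => (hσc k).le)
    rw [winding_eq_degree hφ, abs_mul, abs_of_pos Real.pi_pos, add_comm] at this
    exact this.not_gt hc2

/-! ### The vortex map as the case of the identity, of degree one -/

theorem vortexTypeMap_id : vortexTypeMap id = vortexMap := by
  ext1 x
  by_cases hx : x = 0
  · simp [vortexTypeMap, vortexMap, hx]
  · rw [vortexTypeMap, dif_pos hx]; rfl

theorem degree_id : degree id = 1 := by
  have h0 : ∀ θ, HasDerivAt (fun t => (circlePoint t : Plane) 0) (-Real.sin θ) θ := fun θ =>
    (hasDerivAt_radialVec θ).apply_plane 0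
  have h1 : ∀ θ, HasDerivAt (fun t => (circlePoint t : Plane) 1) (Real.cos θ) θ := fun θ =>
    (hasDerivAt_radialVec θ).apply_plane 1
  have e : ∀ θ, ((circlePoint θ : Plane) 0 * deriv (fun t => (circlePoint t : Plane) 1) θ
      - (circlePoint θ : Plane) 1 * deriv (fun t => (circlePoint t : Plane) 0) θ) = 1 := fun θ => by
    rw [(h0 θ).deriv, (h1 θ).deriv]
    simp only [circlePoint, Matrix.cons_val_zero, Matrix.cons_val_one]
    linear_combination Real.sin_sq_add_cos_sq θ
  simp only [degree, id_eq, e, intervalIntegral.integral_const, sub_zero, smul_eq_mul, mul_one]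
  exact one_div_mul_cancel Real.two_pi_pos.ne'

end

theorem theorem1p1 (l : ℝ) (hl : 0 < l) :
    (∀ φ : UnitCircle → UnitCircle, (∃ K : NNReal, LipschitzWith K φ) →
      MemBV (vortexTypeMap φ) (Metric.ball 0 l) ∧
      (∀ᵐ x ∂(volume.restrict (Metric.ball (0 : Plane) l)),
        DifferentiableAt ℝ (vortexTypeMap φ) x) ∧
      IntegrableOn (fun x => √(1 + gradNormSq (vortexTypeMap φ) x)) (Metric.ball 0 l) ∧
      relaxedAreaBV (vortexTypeMap φ) (Metric.ball 0 l) =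
        ENNReal.ofReal ((∫ x in Metric.ball (0 : Plane) l,
          √(1 + gradNormSq (vortexTypeMap φ) x)) + Real.pi * |degree φ|)) ∧
    relaxedAreaBV vortexMap (Metric.ball 0 l) =
      ENNReal.ofReal ((∫ x in Metric.ball (0 : Plane) l,
        √(1 + gradNormSq vortexMap x)) + Real.pi) := by
  have main : ∀ φ : UnitCircle → UnitCircle, (∃ K : NNReal, LipschitzWith K φ) →
      MemBV (vortexTypeMap φ) (Metric.ball 0 l) ∧
      (∀ᵐ x ∂(volume.restrict (Metric.ball (0 : Plane) l)),
        DifferentiableAt ℝ (vortexTypeMap φ) x) ∧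
      IntegrableOn (fun x => √(1 + gradNormSq (vortexTypeMap φ) x)) (Metric.ball 0 l) ∧
      relaxedAreaBV (vortexTypeMap φ) (Metric.ball 0 l) =
        ENNReal.ofReal ((∫ x in Metric.ball (0 : Plane) l,
          √(1 + gradNormSq (vortexTypeMap φ) x)) + Real.pi * |degree φ|) := by
    rintro φ ⟨K, hφ⟩
    obtain ⟨h1, h2, h3⟩ := vortexTypeMap_relaxation hφ hl
    exact ⟨h1, ae_restrict_of_ae (ae_differentiableAt_vortexTypeMap hφ), h2, h3⟩
  refine ⟨main, ?_⟩
  have h := (main id ⟨1, LipschitzWith.id⟩).2.2.2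
  rwa [vortexTypeMap_id, degree_id, abs_one, mul_one] at h
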